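/- **Setting.** Let $P$ be a row-stochastic $n\times n$ matrix and let $p_*=\pi$ be a PageRank vector of $P$, i.e. a probability vector with $\pi^TP=\pi^T$. The *spectral gap* of $P$ is $1$ minus the largest modulus of the other complex eigenvalues of $P$ (counted with algebraic multiplicity, one eigenvalue $1$ removed). A vertex $i$ is identified with the unit vector $e_i\in\mathbb R^n$. *Single-walk algorithm* (parameters $T^0<T$): $X:=0$, vertex $:=1$; for $t=1,\dots,T$: if $t\ge T^0$, then $X_k:=X_k+1$ for the current vertex $k$; then move to a random vertex according to $P$. Answer: $p=X/(T-T^0)$. *Parallel version* (parameters $N,T'$): $N$ independent walks start at vertices drawn independently from a probability vector $\nu$ and make $T'$ steps each; the answer is $p=\frac1N\sum_{k\le N}e_{x^k}$, where $x^k$ is the final vertex of walk $k$. *Operations* are those of a random access machine with unit-cost operations on integer and real registers and arrays and a unit-cost generator of uniform random numbers in $[0,1]$. $P$ (and $\nu$) are stored beforehand as lists of links with cumulative probabilities; a random transition is made by binary search in such a list. For the parallel version the operations of all walks are counted together. **Statement.** (1) For every $\kappa>0$ there are positive constants $C_0,C,K$, depending only on $\kappa$, such that the following holds for all $n\ge2$,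 all $P$ with PageRank vector $\pi$ such that the chain is reversible ($\pi_ip_{ij}=\pi_jp_{ji}$), $\pi_i>0$ and $\ln(\pi_i^{-1})\le\kappa\ln n$ for all $i$, and all $\alpha>0$ not exceeding the spectral gap of $P$. Put $$T^0_{\varepsilon}=\left\lceil \frac{C_0}{\alpha}\ln\frac n\varepsilon\right\rceil ,\qquad T_{\varepsilon,\sigma}=\left\lceil \frac{C\ln(n/\sigma)}{\alpha\varepsilon^2}\right\rceil .$$ (a) For $0<\delta\le1$, $t\ge T^0_\delta$ and every $i$: $\sum_j|(P^t)_{ij}-\pi_j|\le\delta$. Let now $0<\varepsilon\le1$, $0<\sigma<1$. (b) $T^0_\varepsilon<T_{\varepsilon,\sigma}$, and the estimator $p$ of the single-walk algorithm with these parameters satisfies $\|p-p_*\|_2\le\varepsilon$ with probability at least $1-\sigma$, for any law of the starting vertex. Started at vertex $1$, the algorithm always stops after at most $$K\left(n+\frac{\ln n\,\ln(n/\sigma)}{\alpha\varepsilon^2}\right)$$ operations. (c) For every $\nu$, the parallel version with $N=\lceil(4+6\ln\sigma^{-1})/\varepsilon^2\rceil$ and $T'=T^0_{\varepsilon/2}$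 gives $\|p-p_*\|_2\le\varepsilon$ with probability at least $1-\sigma$ and always stops after at most $$K\left(n+\frac{\ln n\,\ln(n/\varepsilon)\,(1+\ln\sigma^{-1})}{\alpha\varepsilon^2}\right)$$ operations. (2) Let $P$ be any row-stochastic matrix with a PageRank vector $\pi$, and let $x^1,\dots,x^N$ be the positions at time $t$ of $N$ independent walks with matrix $P$ and a common starting law. Put $S=\left\|\sum_{k=1}^N(e_{x^k}-\pi)\right\|_2$. If $N\ge1$, then $\mathbb P(S\ge r)\le\exp\left(-\frac1{4N}(r-\mathbb ES)^2\right)$ for all $r\ge\mathbb ES$. If $\varepsilon>0$, $0<\sigma<1$, $\sum_j|(P^t)_{ij}-\pi_j|\le\varepsilon/2$ for all $i$, and $N\ge(4+6\ln\sigma^{-1})/\varepsilon^2$, then $$\mathbb P\left(\left\|\frac1N\sum_{k=1}^Ne_{x^k}-\pi\right\|_2\ge\varepsilon\right)\le\sigma .$$ (3) The number of walks is optimal up to a constant factor. There is a constant $c>0$ such that for every $n\ge2$ there is a reversible chain $P$ on $n$ vertices with PageRank vector $\pi$, spectral gap $1$, $\pi_i>0$ and $\ln(\pi_i^{-1})\le2\ln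 n$ for all $i$, and $(P^t)_{ij}=\pi_j$ for all $t\ge1$ and all $i,j$, such that for all $0<\varepsilon\le c$, $0<\sigma\le c$, all $1\le N\le c\,(4+6\ln\sigma^{-1})/\varepsilon^2$, all $t\ge1$ and every common starting law, the probability in (2) is greater than $\sigma$. Moreover, there is a constant $c>0$ such that for every $\sigma\in(0,1)$ there is $n_0$ with the following property: for $n\ge n_0$ and $p_{ij}=\pi_j=1/n$, for all $\varepsilon>0$, all $1\le N\le c/\varepsilon^2$, all $t\ge1$ and every common starting law, the probability in (2) is greater than $\sigma$. -/

import Mathlib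

open MeasureTheory ProbabilityTheory

noncomputable section

/-! ### PageRank vectors, spectral gap, random walks -/

/-- The point of the Euclidean space `ℓ₂ⁿ` with the coordinates `x`. -/
def vec2 {n : ℕ} (x : Fin n → ℝ) : EuclideanSpace ℝ (Fin n) := WithLp.toLp 2 x

/-- The vector `x` of the position `i`: all components are `0` except component `i`, which is `1`. -/
def posVec {n : ℕ} (i : Fin n) : EuclideanSpace ℝ (Fin n) := EuclideanSpace.single i 1

/-- `π` is a PageRank vector of the row-stochastic matrix `P`: a probability vector with
`πᵀ = πᵀ P`. -/
structure IsPageRank {n : ℕ} (P : Matrix (Fin n) (Fin n) ℝ) (π : Fin n → ℝ) : Prop where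
  stochastic : P ∈ Matrix.rowStochastic ℝ (Fin n)
  prob : π ∈ stdSimplex ℝ (Fin n)
  invariant : Matrix.vecMul π P = π

/-- Detailed balance. -/
def IsReversible {n : ℕ} (P : Matrix (Fin n) (Fin n) ℝ) (π : Fin n → ℝ) : Prop :=
  ∀ i j, π i * P i j = π j * P j i

/-- The spectral gap of a stochastic matrix: the distance from its largest eigenvalue `1` to the
largest modulus among the other complex eigenvalues, counted with algebraic multiplicity. -/
def spectralGap {n : ℕ} (P : Matrix (Fin n) (Fin n) ℝ) : ℝ :=
  1 - (((((P.map (algebraMap ℝ ℂ)).charpoly.roots.erase 1).map (fun z => ‖z‖₊)).sup : NNReal) : ℝ)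

/-- `∑ⱼ |Pᵗ(i,j) - π(j)| ≤ δ` for every starting state `i`. -/
def MixedAt {n : ℕ} (P : Matrix (Fin n) (Fin n) ℝ) (π : Fin n → ℝ) (δ : ℝ) (t : ℕ) : Prop :=
  ∀ i, ∑ j, |(P ^ t) i j - π j| ≤ δ

/-- `X 0, X 1, …` is a random walk with starting law `ν` and transition matrix `P`. -/
structure IsRandomWalk {n : ℕ} {Ω : Type*} [MeasurableSpace Ω] (μ : Measure Ω)
    (P : Matrix (Fin n) (Fin n) ℝ) (ν : Fin n → ℝ) (X : ℕ → Ω → Fin n) : Prop where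
  measurable : ∀ t, Measurable (X t)
  law : ∀ (t : ℕ) (x : ℕ → Fin n), μ.real {ω | ∀ s ≤ t, X s ω = x s} =
    ν (x 0) * ∏ s ∈ Finset.range t, P (x s) (x (s + 1))

/-- `X 0, …, X (N-1)` are independent random walks with starting law `ν` and matrix `P`. -/
structure IndepWalks {n : ℕ} {Ω : Type*} [MeasurableSpace Ω] (μ : Measure Ω)
    (P : Matrix (Fin n) (Fin n) ℝ) (ν : Fin n → ℝ) (N : ℕ) (X : Fin N → ℕ → Ω → Fin n) :
    Prop where
  walk : ∀ k, IsRandomWalk μ P ν (X k)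
  indep : iIndepFun (fun k ω t => X k t ω) μ

/-- The answer of the estimator. In iteration `t + 1` (for `t < T`) the walk stands at `x t`; the
visit is counted if the number of the iteration is at least `T₀`; the counts are divided by
`T - T₀`. -/
def visitAverage {n : ℕ} (T₀ T : ℕ) (x : ℕ → Fin n) : EuclideanSpace ℝ (Fin n) :=
  ((T : ℝ) - T₀)⁻¹ • ∑ t ∈ (Finset.range T).filter (fun t => T₀ ≤ t + 1), posVec (x t)

/-- The average of the position vectors of `N` walkers. -/
def walkerAverage {n N : ℕ} (x : Fin N → Fin n) : EuclideanSpace ℝ (Fin n) :=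
  (N : ℝ)⁻¹ • ∑ k, posVec (x k)

/-- `T⁰(ε, α, n) = ⌈C ln(n/ε) / α⌉`. -/
def burnIn (C ε α : ℝ) (n : ℕ) : ℕ := ⌈C * Real.log (n / ε) / α⌉₊

/-- `T(ε, σ, α, n) = ⌈C ln(n/σ) / (α ε²)⌉`. -/
def runLength (C ε σ α : ℝ) (n : ℕ) : ℕ := ⌈C * Real.log (n / σ) / (α * ε ^ 2)⌉₊

/-- `(4 + 6 ln σ⁻¹) / ε²`. -/
def walkerBound (ε σ : ℝ) : ℝ := (4 + 6 * Real.log σ⁻¹) / ε ^ 2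

/-! ### A random access machine with real registers, and its operation count -/

/-- Integer registers. -/
inductive IReg where
  | one | zero | n | burn | len | walkers | v | t | k | m | lo | hi | mid
deriving DecidableEq

/-- Real registers. -/
inductive RReg where
  | one | zero | u | c | w | d
deriving DecidableEq

/-- Arrays of integers. -/
inductive IArr where
  | first | last | nbr
deriving DecidableEq

/-- Arrays of reals. -/
inductive RArr where
  | cum | X
deriving DecidableEq

/-- A state of the machine: the contents of the memory, and the number `pos` of random numbers
used so far. -/
structure State where
  ireg : IReg → ℕ
  rreg : RReg → ℝ
  iarr : IArr → ℕ → ℕ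
  rarr : RArr → ℕ → ℝ
  pos : ℕ

/-- The source of randomness: a sequence of numbers in `[0, 1]`. -/
abbrev Tape := ℕ → unitInterval

/-- Independent random numbers, uniform on `[0, 1]`. -/
def tapeMeasure : Measure Tape := Measure.infinitePi (fun _ : ℕ => (volume : Measure unitInterval))

/-- The elementary operations, each of unit cost. -/
inductive Instr where
  /-- `x := a` (an integer literal) -/
  | iconst (x : IReg) (a : ℕ)
  /-- `x := y` -/
  | icopy (x y : IReg)
  /-- `x := y + z` -/
  | iadd (x y z : IReg)
  /-- `x := y - z` (truncated) -/
  | isub (x y z : IReg)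
  /-- `x := ⌊y / 2⌋` -/
  | ihalf (x y : IReg)
  /-- `x := A[y]` -/
  | iload (x : IReg) (A : IArr) (y : IReg)
  /-- `r := x`, conversion of an integer to a real -/
  | cast (r : RReg) (x : IReg)
  /-- `r := s + q` -/
  | radd (r s q : RReg)
  /-- `r := s / q` -/
  | rdiv (r s q : RReg)
  /-- `r := A[y]` -/
  | rload (r : RReg) (A : RArr) (y : IReg)
  /-- `A[y] := r` -/
  | rstore (A : RArr) (y : IReg) (r : RReg)
  /-- `r :=` the next random number -/
  | rand (r : RReg)

namespace State

def setI (s : State) (x : IReg) (a : ℕ) : State := { s with ireg := Function.update s.ireg x a }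

def setR (s : State) (r : RReg) (a : ℝ) : State := { s with rreg := Function.update s.rreg r a }

def store (s : State) (A : RArr) (i : ℕ) (a : ℝ) : State :=
  { s with rarr := Function.update s.rarr A (Function.update (s.rarr A) i a) }

end State

/-- The effect of an elementary operation. -/
def Instr.exec (u : Tape) : Instr → State → State
  | .iconst x a, s => s.setI x a
  | .icopy x y, s => s.setI x (s.ireg y)
  | .iadd x y z, s => s.setI x (s.ireg y + s.ireg z)
  | .isub x y z, s => s.setI x (s.ireg y - s.ireg z)
  | .ihalf x y, s => s.setI x (s.ireg y / 2)
  | .iload x A y, s => s.setI x (s.iarr A (s.ireg y))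
  | .cast r x, s => s.setR r (s.ireg x)
  | .radd r a b, s => s.setR r (s.rreg a + s.rreg b)
  | .rdiv r a b, s => s.setR r (s.rreg a / s.rreg b)
  | .rload r A y, s => s.setR r (s.rarr A (s.ireg y))
  | .rstore A y r, s => s.store A (s.ireg y) (s.rreg r)
  | .rand r, s => { s.setR r (u s.pos) with pos := s.pos + 1 }

/-- Structured programs. -/
inductive Prog where
  | skip
  | op (i : Instr)
  | seq (p q : Prog)
  /-- if `x < y` then `p` else `q`, for integers -/
  | ifLt (x y : IReg) (p q : Prog)
  /-- if `r < s` then `p` else `q`, for reals -/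
  | ifRLt (r s : RReg) (p q : Prog)
  /-- while `x < y` do `p` -/
  | whileLt (x y : IReg) (p : Prog)

/-- `Runs u p s s' c`: on the random numbers `u`, started in `s`, the program `p` stops in `s'`
after exactly `c` elementary operations and comparisons. -/
inductive Runs (u : Tape) : Prog → State → State → ℕ → Prop where
  | skip (s) : Runs u .skip s s 0
  | op (i s) : Runs u (.op i) s (i.exec u s) 1
  | seq {p q s₁ s₂ s₃ c₁ c₂} : Runs u p s₁ s₂ c₁ → Runs u q s₂ s₃ c₂ →
      Runs u (.seq p q) s₁ s₃ (c₁ + c₂)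
  | ifLt_pos {x y p q s s' c} : s.ireg x < s.ireg y → Runs u p s s' c →
      Runs u (.ifLt x y p q) s s' (c + 1)
  | ifLt_neg {x y p q s s' c} : ¬ s.ireg x < s.ireg y → Runs u q s s' c →
      Runs u (.ifLt x y p q) s s' (c + 1)
  | ifRLt_pos {r r' p q s s' c} : s.rreg r < s.rreg r' → Runs u p s s' c →
      Runs u (.ifRLt r r' p q) s s' (c + 1)
  | ifRLt_neg {r r' p q s s' c} : ¬ s.rreg r < s.rreg r' → Runs u q s s' c →
      Runs u (.ifRLt r r' p q) s s' (c + 1)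
  | while_done {x y p s} : ¬ s.ireg x < s.ireg y → Runs u (.whileLt x y p) s s 1
  | while_step {x y p s₁ s₂ s₃ c₁ c₂} : s₁.ireg x < s₁.ireg y → Runs u p s₁ s₂ c₁ →
      Runs u (.whileLt x y p) s₂ s₃ c₂ → Runs u (.whileLt x y p) s₁ s₃ (c₁ + c₂ + 1)

/-- Sequential composition of a list of programs. -/
def Prog.block : List Prog → Prog
  | [] => .skip
  | p :: l => .seq p (Prog.block l)

/-- The law `q` is stored in row `i`: the cells `first[i] ≤ a < last[i]` of the array `nbr` list,
each once and in some order, the states of positive probability, and the same cells of `cum` hold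
the cumulative probabilities along this list. -/
structure StoresRow {n : ℕ} (s : State) (i : ℕ) (q : Fin n → ℝ) : Prop where
  bij : Set.BijOn (s.iarr .nbr) (Set.Ico (s.iarr .first i) (s.iarr .last i))
    {j | ∃ h : j < n, 0 < q ⟨j, h⟩}
  cumulative : ∀ a ∈ Set.Ico (s.iarr .first i) (s.iarr .last i), s.rarr .cum a =
    ∑ b ∈ Finset.Icc (s.iarr .first i) a,
      if h : s.iarr .nbr b < n then q ⟨s.iarr .nbr b, h⟩ else 0

/-- The matrix `P` is stored as a list of links; the number of states is in register `n`. -/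
structure StoresMatrix {n : ℕ} (s : State) (P : Matrix (Fin n) (Fin n) ℝ) : Prop where
  size : s.ireg .n = n
  row : ∀ i : Fin n, StoresRow s i (P i)

/-- The contents of the answer array. -/
def State.answer (n : ℕ) (s : State) : EuclideanSpace ℝ (Fin n) :=
  vec2 fun j => s.rarr .X (j : ℕ)

/-- Random transition from the current vertex `v`: binary search for the first cell of row `v`
whose cumulative probability exceeds a random number. -/
def moveProg : Prog := .block
  [ .op (.rand .u),
    .op (.iload .lo .first .v),
    .op (.iload .hi .last .v),
    .op (.isub .hi .hi .one),
    .whileLt .lo .hi (.block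
      [ .op (.iadd .mid .lo .hi),
        .op (.ihalf .mid .mid),
        .op (.rload .c .cum .mid),
        .ifRLt .u .c
          (.op (.icopy .hi .mid))
          (.op (.iadd .lo .mid .one)) ]),
    .op (.iload .v .nbr .lo) ]

/-- Constants, and `X := 0`. -/
def initProg : Prog := .block
  [ .op (.iconst .one 1),
    .op (.iconst .zero 0),
    .op (.cast .one .one),
    .op (.cast .zero .zero),
    .op (.iconst .k 0),
    .whileLt .k .n (.block
      [ .op (.rstore .X .k .zero),
        .op (.iadd .k .k .one) ]) ]

/-- `X[v] := X[v] + 1`. -/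
def countProg : Prog := .block
  [ .op (.rload .w .X .v),
    .op (.radd .w .w .one),
    .op (.rstore .X .v .w) ]

/-- `X := X / d`. -/
def scaleProg : Prog := .block
  [ .op (.iconst .k 0),
    .whileLt .k .n (.block
      [ .op (.rload .w .X .k),
        .op (.rdiv .w .w .d),
        .op (.rstore .X .k .w),
        .op (.iadd .k .k .one) ]) ]

/-- The algorithm with a single walk: it starts at the first vertex, makes `len` iterations,
counts the visits from iteration `burn` on, and divides the counts by `len - burn`. -/
def mcmcProg : Prog := .block
  [ initProg,
    .op (.iconst .v 0),
    .op (.iconst .t 0),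
    .whileLt .t .len (.block
      [ .op (.iadd .t .t .one),
        .ifLt .t .burn .skip countProg,
        moveProg ]),
    .op (.isub .m .len .burn),
    .op (.cast .d .m),
    scaleProg ]

/-- The version with `walkers` independent walks, all their operations counted together. Each walk
draws its starting vertex from the law stored in row `n`, makes `len` steps, and its final position
is counted; the counts are divided by `walkers`. -/
def parallelProg : Prog := .block
  [ initProg,
    .op (.iconst .m 0),
    .whileLt .m .walkers (.block
      [ .op (.icopy .v .n),
        moveProg,
        .op (.iconst .t 0),
        .whileLt .t .len (.block
          [ .op (.iadd .t .t .one),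
            moveProg ]),
        countProg,
        .op (.iadd .m .m .one) ]),
    .op (.cast .d .walkers),
    scaleProg ]

end

/-!
Three ingredients carry the theorem.

*Independent walks.* The positions of independent walks at a fixed time are an independent sample
from a law `q = ν Pᵗ`. Expectations over such a sample are the finite sums `iidExp`, for which
recursion on the number of variables gives McDiarmid's inequality (`iidExp_exp_le`) from
Hoeffding's lemma. Replacing one sample point moves the norm `‖∑ₖ (e_{xᵏ} - π)‖` by at most `√2`,
which is the Hoeffding-type tail bound with `1 / N` (stronger than the claimed `1 / (4 N)`). The
second moment of the same norm is computed exactly, so its mean is at most `√(N + (N ε / 2)²)` once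
`q` is within `ε / 2` of `π`; with `N ≥ (4 + 6 ln σ⁻¹) / ε²` the distance from this mean to `N ε`
is at least `√(N ln σ⁻¹)` (`iidExp_walkers_le`).

*One reversible walk.* The matrix `S = D^{1/2} P D^{-1/2}` with `D = diag π` is symmetric and has
the characteristic polynomial of `P`, so the spectral gap, defined through the complex eigenvalues
of `P`, bounds the quadratic form of `S` off the fixed vector `√π` (`abs_quadForm_symMat_le`).
This gives mixing at rate `(1 - α)ᵗ`. For the time average, the moment generating function of the
number of visits to a vertex is a power of `diag w · P`, where the weight `w` is `1 + a` at that
vertex and `1` elsewhere. This matrix is similar to the symmetric matrix `√w S √w`, whose norm is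
bounded by comparing `S` with `α √π √πᵀ + (1 - α) I`, in the manner of León and Perron
(`abs_quadForm_weighted_le`, `leon_perron_root`). The resulting Chernoff bound is of Bernstein
type: up to a small probability *every* coordinate deviates by at most `√(η πⱼ) + η`, where
`η = ε² / 7`. The squares of these deviations add up to at most `7 η` because both vectors have
bounded mass (`norm_vec2_sub_sq_le`), so no factor `n` enters the error; the union bound over the
coordinates costs only a factor `n` in the probability, which the logarithm `ln (n / σ)` absorbs.

*The machine.* Binary search in a row of cumulative probabilities maps a uniform random number to
a vertex with the stored law (`StoresRow.exists_sampler`) and takes at most `⌈log₂ n⌉` rounds.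
Hence each program, on each tape, outputs the estimator of a deterministic function `tapeWalk` of
the tape (`runs_mcmcProg`, `runs_parallelProg`), which under the tape measure is a random walk,
and on disjoint blocks of the tape gives independent walks (`tapeMeasure_real_blocks`).

The lower bounds use chains that forget their position in one step. With half of the mass at one
vertex, the error at this vertex is a sum of independent signs, whose tail is bounded from below by
Cauchy–Schwarz (`le_iidExp_tail`). With the uniform law, the squared error has relative variance of
order `1 / n`, so Chebyshev's inequality applies (`le_iidExp_uniform`).
-/

/-! ### Expectations over independent samples, and the bounded difference inequality -/

/-- The expectation of `F (y₀, …, y_{N-1})` for independent `yₖ` with the common law `q` on a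
finite type. -/
noncomputable def iidExp {α : Type*} [Fintype α] (q : α → ℝ) (N : ℕ) (F : (Fin N → α) → ℝ) : ℝ :=
  ∑ x, (∏ k, q (x k)) * F x

section IidExp

variable {α : Type*} [Fintype α] {q : α → ℝ} {N : ℕ}

lemma iidExp_zero (F : (Fin 0 → α) → ℝ) : iidExp q 0 F = F Fin.elim0 := by
  simp [iidExp]; congr!

lemma iidExp_succ (F : (Fin (N + 1) → α) → ℝ) :
    iidExp q (N + 1) F = iidExp q N (fun x => ∑ j, q j * F (Fin.cons j x)) := by
  unfold iidExp
  rw [← (Fin.consEquiv (fun _ => α)).sum_comp, Fintype.sum_prod_type, Finset.sum_comm]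
  refine Finset.sum_congr rfl fun x _ => ?_
  rw [Finset.mul_sum]
  refine Finset.sum_congr rfl fun j _ => ?_
  simp [Fin.consEquiv, Fin.prod_univ_succ]
  ring

lemma iidExp_add (F G : (Fin N → α) → ℝ) :
    iidExp q N (fun x => F x + G x) = iidExp q N F + iidExp q N G := by
  simp [iidExp, mul_add, Finset.sum_add_distrib]

lemma iidExp_const_mul (a : ℝ) (F : (Fin N → α) → ℝ) :
    iidExp q N (fun x => a * F x) = a * iidExp q N F := by
  simp only [iidExp, Finset.mul_sum]
  exact Finset.sum_congr rfl fun x _ => by ring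

lemma iidExp_mono (hq : q ∈ stdSimplex ℝ α) {F G : (Fin N → α) → ℝ} (h : ∀ x, F x ≤ G x) :
    iidExp q N F ≤ iidExp q N G :=
  Finset.sum_le_sum fun x _ =>
    mul_le_mul_of_nonneg_left (h x) (Finset.prod_nonneg fun _ _ => hq.1 _)

lemma iidExp_const (hq : q ∈ stdSimplex ℝ α) (a : ℝ) : iidExp q N (fun _ => a) = a := by
  induction N with
  | zero => rw [iidExp_zero]
  | succ N ih => rw [iidExp_succ, ← Finset.sum_mul, hq.2, one_mul, ih]

/-- The expectation of a product over the independent variables factorizes. -/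
lemma iidExp_prod (f : α → ℝ) : iidExp q N (fun x => ∏ k, f (x k)) = (∑ j, q j * f j) ^ N := by
  induction N with
  | zero => simp [iidExp_zero]
  | succ N ih =>
    rw [iidExp_succ, pow_succ, ← ih, mul_comm, ← iidExp_const_mul]
    congr 1
    funext x
    simp only [Fin.prod_univ_succ, Fin.cons_zero, Fin.cons_succ]
    rw [Finset.sum_mul]
    exact Finset.sum_congr rfl fun j _ => by ring

/-- The Cauchy–Schwarz inequality for `iidExp`. -/
lemma iidExp_mul_sq_le (hq : q ∈ stdSimplex ℝ α) (F G : (Fin N → α) → ℝ) :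
    iidExp q N (fun x => F x * G x) ^ 2 ≤
      iidExp q N (fun x => F x ^ 2) * iidExp q N (fun x => G x ^ 2) := by
  have h0 : ∀ x : Fin N → α, 0 ≤ ∏ k, q (x k) := fun x => Finset.prod_nonneg fun _ _ => hq.1 _
  refine Finset.sum_sq_le_sum_mul_sum_of_sq_le_mul _ (fun x _ => ?_) (fun x _ => ?_)
    (fun x _ => ?_)
  · exact mul_nonneg (h0 x) (sq_nonneg _)
  · exact mul_nonneg (h0 x) (sq_nonneg _)
  · exact le_of_eq (by ring)

/-- Hoeffding's lemma for a law on a finite type. -/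
lemma sum_mul_exp_le_of_abs_sub_le (hq : q ∈ stdSimplex ℝ α) (f : α → ℝ) {c : ℝ}
    (hf : ∀ i j, |f i - f j| ≤ c) (θ : ℝ) :
    ∑ j, q j * Real.exp (θ * (f j - ∑ i, q i * f i)) ≤ Real.exp (θ ^ 2 * c ^ 2 / 8) := by
  classical
  have hne : Nonempty α := by
    by_contra h
    rw [not_nonempty_iff] at h
    simpa using hq.2
  let _ : MeasurableSpace α := ⊤
  have h1 : ∑ j, ENNReal.ofReal (q j) = 1 := by
    rw [← ENNReal.ofReal_sum_of_nonneg fun j _ => hq.1 j, hq.2, ENNReal.ofReal_one]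
  let p : PMF α := PMF.ofFintype (fun j => ENNReal.ofReal (q j)) h1
  have hint : ∀ g : α → ℝ, ∫ j, g j ∂p.toMeasure = ∑ j, q j * g j := fun g => by
    rw [PMF.integral_eq_sum]
    refine Finset.sum_congr rfl fun j _ => ?_
    simp [p, PMF.ofFintype_apply, ENNReal.toReal_ofReal (hq.1 j)]
  obtain ⟨i₀, -, hi₀⟩ := Finset.exists_min_image Finset.univ f Finset.univ_nonempty
  have hc : 0 ≤ c := (abs_nonneg _).trans (hf i₀ i₀)
  have h2 := hasSubgaussianMGF_of_mem_Icc (μ := p.toMeasure) (X := f) (a := f i₀) (b := f i₀ + c)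
    (measurable_from_top.aemeasurable)
    (Filter.Eventually.of_forall fun j => ⟨hi₀ j (Finset.mem_univ _), by
      linarith [le_abs_self (f j - f i₀), hf j i₀]⟩)
  have h3 := h2.mgf_le θ
  rw [mgf, hint, hint] at h3
  refine h3.trans (le_of_eq ?_)
  congr 1
  simp [abs_of_nonneg hc]
  ring

/-- **McDiarmid's inequality**, in the form of a bound for the exponential moments. -/
lemma iidExp_exp_le (hq : q ∈ stdSimplex ℝ α) {c : ℝ} (F : (Fin N → α) → ℝ)
    (hF : ∀ x k j, |F (Function.update x k j) - F x| ≤ c) (θ : ℝ) :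
    iidExp q N (fun x => Real.exp (θ * (F x - iidExp q N F))) ≤
      Real.exp (N * (θ ^ 2 * c ^ 2 / 8)) := by
  induction N with
  | zero => simp [iidExp_zero]
  | succ N ih =>
    set G : (Fin N → α) → ℝ := fun x => ∑ j, q j * F (Fin.cons j x) with hG
    have hGF : iidExp q (N + 1) F = iidExp q N G := iidExp_succ F
    have hGd : ∀ x k j, |G (Function.update x k j) - G x| ≤ c := fun x k j => by
      simp only [hG, ← Finset.sum_sub_distrib, ← mul_sub]
      refine (Finset.abs_sum_le_sum_abs _ _).trans ?_
      calc _ ≤ ∑ i, q i * c := Finset.sum_le_sum fun i _ => by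
            rw [abs_mul, abs_of_nonneg (hq.1 i)]
            refine mul_le_mul_of_nonneg_left ?_ (hq.1 i)
            rw [Fin.cons_update]
            exact hF _ _ _
        _ = c := by rw [← Finset.sum_mul, hq.2, one_mul]
    rw [iidExp_succ, hGF]
    calc _ ≤ iidExp q N (fun x => Real.exp (θ ^ 2 * c ^ 2 / 8) *
          Real.exp (θ * (G x - iidExp q N G))) := by
          refine iidExp_mono hq fun x => ?_
          have h := sum_mul_exp_le_of_abs_sub_le hq (fun j => F (Fin.cons j x)) (c := c)
            (fun i j => by
              have := hF (Fin.cons j x) 0 i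
              rwa [Fin.update_cons_zero] at this) θ
          refine le_trans (le_of_eq ?_) (mul_le_mul_of_nonneg_right h (Real.exp_nonneg _))
          rw [Finset.sum_mul]
          refine Finset.sum_congr rfl fun j _ => ?_
          rw [mul_assoc, ← Real.exp_add]
          congr 2
          simp only [hG]
          ring
      _ ≤ _ := by
          rw [iidExp_const_mul]
          refine (mul_le_mul_of_nonneg_left (ih G hGd) (Real.exp_nonneg _)).trans (le_of_eq ?_)
          rw [← Real.exp_add]
          push_cast
          congr 1
          ring

/-- Markov's inequality for `iidExp`. -/
lemma iidExp_indicator_le (hq : q ∈ stdSimplex ℝ α) (A : Set (Fin N → α))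
    (F : (Fin N → α) → ℝ) (h0 : ∀ x, 0 ≤ F x) (h1 : ∀ x ∈ A, 1 ≤ F x) :
    iidExp q N (A.indicator 1) ≤ iidExp q N F := by
  refine iidExp_mono hq fun x => ?_
  by_cases hx : x ∈ A
  · simpa [hx] using h1 x hx
  · simpa [hx] using h0 x

/-- McDiarmid's inequality for the upper tail. -/
lemma iidExp_indicator_le_exp (hq : q ∈ stdSimplex ℝ α) {c : ℝ} (hc : 0 < c) (hN : 0 < N)
    (F : (Fin N → α) → ℝ) (hF : ∀ x k j, |F (Function.update x k j) - F x| ≤ c) {r : ℝ}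
    (hr : iidExp q N F ≤ r) :
    iidExp q N ({x | r ≤ F x}.indicator 1) ≤
      Real.exp (-(2 / (N * c ^ 2)) * (r - iidExp q N F) ^ 2) := by
  have hN' : (0 : ℝ) < N := by exact_mod_cast hN
  set d := r - iidExp q N F with hd
  have hd0 : 0 ≤ d := by linarith
  -- the exponent `N θ² c² / 8 - θ d` is minimal at this `θ`
  set θ := 4 * d / (N * c ^ 2) with hθ
  have hθ0 : 0 ≤ θ := by positivity
  calc _ ≤ iidExp q N (fun x => Real.exp (-(θ * d)) * Real.exp (θ * (F x - iidExp q N F))) := by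
        refine iidExp_indicator_le hq _ _ (fun x => by positivity) fun x hx => ?_
        rw [← Real.exp_add]
        refine Real.one_le_exp ?_
        have : d ≤ F x - iidExp q N F := by
          have : r ≤ F x := hx
          linarith
        nlinarith
    _ ≤ Real.exp (-(θ * d)) * Real.exp (N * (θ ^ 2 * c ^ 2 / 8)) := by
        rw [iidExp_const_mul]
        exact mul_le_mul_of_nonneg_left (iidExp_exp_le hq F hF θ) (Real.exp_nonneg _)
    _ = _ := by
        rw [← Real.exp_add]
        congr 1
        rw [hθ]
        field_simp
        ring

end IidExp

/-- Functions of random variables with the joint law of an independent sample are integrated by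
`iidExp`. -/
lemma integral_eq_iidExp {α Ω : Type*} [Fintype α] [MeasurableSpace α] [MeasurableSingletonClass α]
    [MeasurableSpace Ω] (μ : Measure Ω) [IsProbabilityMeasure μ] {N : ℕ} {q : α → ℝ}
    {Y : Ω → Fin N → α} (hY : Measurable Y)
    (hlaw : ∀ y, μ.real {ω | Y ω = y} = ∏ k, q (y k)) (F : (Fin N → α) → ℝ) :
    ∫ ω, F (Y ω) ∂μ = iidExp q N F := by
  have hF : AEStronglyMeasurable F (μ.map Y) :=
    (measurable_of_finite F).aestronglyMeasurable
  have : IsProbabilityMeasure (μ.map Y) := Measure.isProbabilityMeasure_map hY.aemeasurable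
  rw [← integral_map hY.aemeasurable hF, integral_fintype .of_finite]
  refine Finset.sum_congr rfl fun y _ => ?_
  rw [smul_eq_mul, map_measureReal_apply hY (measurableSet_singleton y), ← hlaw]
  rfl

lemma measureReal_eq_iidExp {α Ω : Type*} [Fintype α] [MeasurableSpace α]
    [MeasurableSingletonClass α]
    [MeasurableSpace Ω] (μ : Measure Ω) [IsProbabilityMeasure μ] {N : ℕ} {q : α → ℝ}
    {Y : Ω → Fin N → α} (hY : Measurable Y)
    (hlaw : ∀ y, μ.real {ω | Y ω = y} = ∏ k, q (y k)) (A : Set (Fin N → α)) :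
    μ.real {ω | Y ω ∈ A} = iidExp q N (A.indicator 1) := by
  rw [← integral_eq_iidExp μ hY hlaw]
  have : (fun ω => A.indicator (1 : (Fin N → α) → ℝ) (Y ω)) = (Y ⁻¹' A).indicator 1 := by
    funext ω; rfl
  rw [this, integral_indicator_one (hY (Set.toFinite A).measurableSet)]
  rfl

/-! ### Error of the mean of an independent sample -/

section SampleMean

variable {n N : ℕ} {q : Fin n → ℝ}

local notation "⟪" x ", " y "⟫" => inner ℝ x y

/-- The first moment of a sum of independent vectors. -/
lemma iidExp_inner_sum {E : Type*} [NormedAddCommGroup E] [InnerProductSpace ℝ E]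
    (hq : q ∈ stdSimplex ℝ (Fin n)) (g : Fin n → E) (v : E) :
    iidExp q N (fun x => ⟪∑ k, g (x k), v⟫) = N * ⟪∑ j, q j • g j, v⟫ := by
  induction N with
  | zero => simp [iidExp_zero]
  | succ N ih =>
    rw [iidExp_succ]
    have h : ∀ x : Fin N → Fin n, ∑ j, q j * ⟪∑ k, g ((Fin.cons j x : Fin (N + 1) → Fin n) k), v⟫ =
        ⟪∑ j, q j • g j, v⟫ + ⟪∑ k, g (x k), v⟫ := fun x => by
      simp only [Fin.sum_univ_succ, Fin.cons_zero, Fin.cons_succ, inner_add_left, mul_add,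
        Finset.sum_add_distrib, ← Finset.sum_mul, hq.2, one_mul, sum_inner, real_inner_smul_left]
    simp only [h]
    rw [iidExp_add, iidExp_const hq, ih]
    push_cast
    ring

/-- The second moment of a sum of independent vectors. -/
lemma iidExp_norm_sum_sq {E : Type*} [NormedAddCommGroup E] [InnerProductSpace ℝ E]
    (hq : q ∈ stdSimplex ℝ (Fin n)) (g : Fin n → E) :
    iidExp q N (fun x => ‖∑ k, g (x k)‖ ^ 2) =
      N * (∑ j, q j * ‖g j‖ ^ 2) + N * (N - 1) * ‖∑ j, q j • g j‖ ^ 2 := by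
  induction N with
  | zero => simp [iidExp_zero]
  | succ N ih =>
    rw [iidExp_succ]
    have h : ∀ x : Fin N → Fin n,
        ∑ j, q j * ‖∑ k, g ((Fin.cons j x : Fin (N + 1) → Fin n) k)‖ ^ 2 =
        ∑ j, q j * ‖g j‖ ^ 2 + (2 * ⟪∑ k, g (x k), ∑ j, q j • g j⟫ + ‖∑ k, g (x k)‖ ^ 2) :=
      fun x => by
        simp only [Fin.sum_univ_succ, Fin.cons_zero, Fin.cons_succ, norm_add_sq_real, mul_add,
          Finset.sum_add_distrib, ← Finset.sum_mul, hq.2, one_mul]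
        rw [inner_sum, Finset.mul_sum, ← add_assoc]
        congr 2
        refine Finset.sum_congr rfl fun j _ => ?_
        rw [real_inner_smul_right, real_inner_comm]
        ring
    simp only [h]
    rw [iidExp_add, iidExp_const hq, iidExp_add, iidExp_const_mul, iidExp_inner_sum hq, ih,
      real_inner_self_eq_norm_sq]
    push_cast
    ring

lemma iidExp_le_sqrt (hq : q ∈ stdSimplex ℝ (Fin n)) (F : (Fin N → Fin n) → ℝ) :
    iidExp q N F ≤ Real.sqrt (iidExp q N (fun x => F x ^ 2)) := by
  refine Real.le_sqrt_of_sq_le ?_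
  simpa [iidExp_const hq] using iidExp_mul_sq_le hq F (fun _ => 1)

lemma vec2_apply (x : Fin n → ℝ) (i : Fin n) : vec2 x i = x i := rfl

lemma posVec_apply (i j : Fin n) : posVec i j = if j = i then 1 else 0 := by
  simp [posVec]

lemma sum_smul_posVec (x : Fin n → ℝ) : ∑ j, x j • posVec j = vec2 x := by
  ext i
  simp [posVec_apply, vec2_apply]

lemma norm_posVec (i : Fin n) : ‖posVec i‖ = 1 := by simp [posVec]

lemma norm_posVec_sub_posVec_le (i j : Fin n) : ‖posVec i - posVec j‖ ≤ Real.sqrt 2 := by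
  refine Real.le_sqrt_of_sq_le ?_
  rw [norm_sub_sq_real, norm_posVec, norm_posVec]
  have : (0 : ℝ) ≤ ⟪posVec i, posVec j⟫ := by
    simp [posVec, EuclideanSpace.inner_single_left]
    split_ifs <;> norm_num
  linarith

lemma norm_vec2_le_sum_abs (x : Fin n → ℝ) : ‖vec2 x‖ ≤ ∑ j, |x j| := by
  rw [← sum_smul_posVec]
  refine (norm_sum_le _ _).trans ?_
  simp [norm_smul, norm_posVec]

/-- The norm of the centred sum has bounded differences. -/
lemma abs_norm_sum_update_sub_le (v : EuclideanSpace ℝ (Fin n)) (x : Fin N → Fin n) (k : Fin N)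
    (j : Fin n) :
    |‖∑ l, (posVec (Function.update x k j l) - v)‖ - ‖∑ l, (posVec (x l) - v)‖| ≤
      Real.sqrt 2 := by
  refine (abs_norm_sub_norm_le _ _).trans ?_
  rw [← Finset.sum_sub_distrib, Finset.sum_eq_single k]
  · simpa using norm_posVec_sub_posVec_le j (x k)
  · intro l _ hl
    simp [Function.update_of_ne hl]
  · simp

/-- McDiarmid's inequality for the distance of the sample sum from its target; the differences
are at most `√2`. -/
lemma iidExp_norm_sum_tail (hq : q ∈ stdSimplex ℝ (Fin n)) (v : EuclideanSpace ℝ (Fin n))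
    (hN : 0 < N) {r : ℝ} (hr : iidExp q N (fun x => ‖∑ k, (posVec (x k) - v)‖) ≤ r) :
    iidExp q N ({x | r ≤ ‖∑ k, (posVec (x k) - v)‖}.indicator 1) ≤
      Real.exp (-(1 / N) * (r - iidExp q N (fun x => ‖∑ k, (posVec (x k) - v)‖)) ^ 2) := by
  refine (iidExp_indicator_le_exp hq (by positivity : 0 < Real.sqrt 2) hN _
    (fun x k j => abs_norm_sum_update_sub_le v x k j) hr).trans (le_of_eq ?_)
  rw [Real.sq_sqrt (by norm_num)]
  congr 3
  field_simp

/-- The mean error of the sample sum: a bias and a fluctuation. -/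
lemma iidExp_norm_sum_le (hq : q ∈ stdSimplex ℝ (Fin n)) (p : Fin n → ℝ) :
    iidExp q N (fun x => ‖∑ k, (posVec (x k) - vec2 p)‖) ≤
      Real.sqrt (N + (N * ‖vec2 q - vec2 p‖) ^ 2) := by
  refine (iidExp_le_sqrt hq _).trans (Real.sqrt_le_sqrt ?_)
  rw [iidExp_norm_sum_sq hq (fun j => posVec j - vec2 p)]
  have h1 : ∑ j, q j • (posVec j - vec2 p) = vec2 q - vec2 p := by
    simp only [smul_sub, Finset.sum_sub_distrib, sum_smul_posVec, ← Finset.sum_smul, hq.2, one_smul]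
  have h2 : ∑ j, q j * ‖posVec j - vec2 p‖ ^ 2 = 1 - ‖vec2 q‖ ^ 2 + ‖vec2 q - vec2 p‖ ^ 2 := by
    have h3 : ∑ j, q j * ⟪posVec j, vec2 p⟫ = ⟪vec2 q, vec2 p⟫ := by
      rw [← sum_smul_posVec q, sum_inner]
      simp only [real_inner_smul_left]
    simp only [norm_sub_sq_real, norm_posVec, mul_add, mul_sub, Finset.sum_add_distrib,
      Finset.sum_sub_distrib, ← Finset.sum_mul, hq.2, mul_left_comm _ (2 : ℝ), ← Finset.mul_sum, h3]
    ring
  rw [h1, h2]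
  nlinarith [sq_nonneg ‖vec2 q‖, Nat.cast_nonneg (α := ℝ) N]

/-- A sample of size `walkerBound ε σ` from a law within `ε / 2` of the target is accurate. -/
lemma iidExp_walkers_le (hq : q ∈ stdSimplex ℝ (Fin n)) (p : Fin n → ℝ) {ε σ : ℝ} (hε : 0 < ε)
    (hσ : 0 < σ) (hσ1 : σ < 1) (hqp : ‖vec2 q - vec2 p‖ ≤ ε / 2) (hN : walkerBound ε σ ≤ N) :
    iidExp q N ({x | ε ≤ ‖walkerAverage x - vec2 p‖}.indicator 1) ≤ σ := by
  set L := Real.log σ⁻¹ with hL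
  have hL0 : 0 < L := Real.log_pos ((one_lt_inv₀ hσ).2 hσ1)
  have hM : 4 + 6 * L ≤ N * ε ^ 2 := by
    rwa [walkerBound, div_le_iff₀ (by positivity)] at hN
  have hN0 : (0 : ℝ) < N := by
    by_contra h
    nlinarith [sq_nonneg ε]
  set m := iidExp q N (fun x => ‖∑ k, (posVec (x k) - vec2 p)‖) with hm
  -- the deviation `N ε - m` is at least `√(N L)`, since the second moment bounds `m`
  have hdev : m + Real.sqrt (N * L) ≤ N * ε := by
    have h1 : m ≤ Real.sqrt (N + N * (N * ε ^ 2) / 4) := by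
      refine (iidExp_norm_sum_le hq p).trans (Real.sqrt_le_sqrt ?_)
      have : (N * ‖vec2 q - vec2 p‖) ^ 2 ≤ (N * (ε / 2)) ^ 2 := by gcongr
      nlinarith
    refine (add_le_add_left h1 _).trans ?_
    refine abs_le_of_sq_le_sq' ?_ (by positivity) |>.2
    have h2 := Real.sq_sqrt (show 0 ≤ N + N * (N * ε ^ 2) / 4 by positivity)
    have h3 := Real.sq_sqrt (show 0 ≤ N * L by positivity)
    nlinarith [sq_nonneg (Real.sqrt (N + N * (N * ε ^ 2) / 4) - Real.sqrt (N * L)),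
      mul_le_mul_of_nonneg_left hM hN0.le]
  have hset : {x : Fin N → Fin n | ε ≤ ‖walkerAverage x - vec2 p‖} =
      {x | N * ε ≤ ‖∑ k, (posVec (x k) - vec2 p)‖} := by
    ext x
    have : walkerAverage x - vec2 p = (N : ℝ)⁻¹ • ∑ k, (posVec (x k) - vec2 p) := by
      rw [Finset.sum_sub_distrib, smul_sub, walkerAverage]
      simp [← Nat.cast_smul_eq_nsmul ℝ, smul_smul, hN0.ne']
    rw [Set.mem_ofPred_eq, Set.mem_ofPred_eq, this, norm_smul, norm_inv, Real.norm_natCast,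
      le_inv_mul_iff₀ hN0]
  rw [hset]
  refine (iidExp_norm_sum_tail hq _ (by exact_mod_cast hN0)
    ((le_add_of_nonneg_right (Real.sqrt_nonneg _)).trans hdev)).trans ?_
  rw [← Real.le_log_iff_exp_le hσ]
  have h4 : N * L ≤ (N * ε - m) ^ 2 := by
    rw [← Real.sq_sqrt (show 0 ≤ N * L by positivity)]
    gcongr
    linarith
  have h5 : Real.log σ = -L := by rw [hL, Real.log_inv, neg_neg]
  rw [h5, neg_mul, neg_le_neg_iff, one_div, le_inv_mul_iff₀ hN0]
  exact h4

end SampleMean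

/-! ### Random walks at a fixed time and along paths -/

section Walks

variable {n : ℕ} {Ω : Type*} [MeasurableSpace Ω] {μ : Measure Ω}
  {P : Matrix (Fin n) (Fin n) ℝ} {ν : Fin n → ℝ} {X : ℕ → Ω → Fin n}

lemma vecMul_mem_stdSimplex (hP : P ∈ Matrix.rowStochastic ℝ (Fin n))
    (hν : ν ∈ stdSimplex ℝ (Fin n)) : Matrix.vecMul ν P ∈ stdSimplex ℝ (Fin n) := by
  refine ⟨fun j => ?_, ?_⟩ <;> simp only [Matrix.vecMul, dotProduct]
  · exact Finset.sum_nonneg fun i _ =>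
      mul_nonneg (hν.1 i) (Matrix.nonneg_of_mem_rowStochastic hP)
  rw [Finset.sum_comm]
  simp only [← Finset.mul_sum, Matrix.sum_row_of_mem_rowStochastic hP, mul_one, hν.2]

lemma vecMul_pow_mem_stdSimplex (hP : P ∈ Matrix.rowStochastic ℝ (Fin n))
    (hν : ν ∈ stdSimplex ℝ (Fin n)) (t : ℕ) :
    Matrix.vecMul ν (P ^ t) ∈ stdSimplex ℝ (Fin n) :=
  vecMul_mem_stdSimplex (pow_mem hP t) hν

/-- A random walk observed from time `1` on. -/
lemma IsRandomWalk.shift_one [IsProbabilityMeasure μ] (h : IsRandomWalk μ P ν X) :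
    IsRandomWalk μ P (Matrix.vecMul ν P) (fun s => X (s + 1)) := by
  refine ⟨fun t => h.measurable _, fun t x => ?_⟩
  have hm : Measurable (X 0) := h.measurable 0
  have hmeas : ∀ i, MeasurableSet {ω | X 0 ω = i ∧ ∀ s ≤ t, X (s + 1) ω = x s} := fun i => by
    refine (hm (measurableSet_singleton i)).inter ?_
    have : {ω | ∀ s ≤ t, X (s + 1) ω = x s} = ⋂ s, ⋂ (_ : s ≤ t), X (s + 1) ⁻¹' {x s} := by
      ext ω; simp
    change MeasurableSet {ω | ∀ s ≤ t, X (s + 1) ω = x s}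
    rw [this]
    exact MeasurableSet.iInter fun s => MeasurableSet.iInter fun _ =>
      h.measurable (s + 1) (measurableSet_singleton _)
  have h1 : {ω | ∀ s ≤ t, X (s + 1) ω = x s} =
      ⋃ i, {ω | X 0 ω = i ∧ ∀ s ≤ t, X (s + 1) ω = x s} := by
    ext ω; simp
  rw [h1, measureReal_iUnion_fintype (fun i j hij => ?_) hmeas, Matrix.vecMul, dotProduct,
    Finset.sum_mul]
  · refine Finset.sum_congr rfl fun i _ => ?_
    have h2 := h.law (t + 1) (fun s => Nat.casesOn s i x)
    rw [Finset.prod_range_succ'] at h2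
    have h3 : {ω | X 0 ω = i ∧ ∀ s ≤ t, X (s + 1) ω = x s} =
        {ω | ∀ s ≤ t + 1, X s ω = (Nat.casesOn s i x : Fin n)} := by
      ext ω
      constructor
      · rintro ⟨h0, h1⟩ s hs
        cases s with
        | zero => exact h0
        | succ s => exact h1 s (by omega)
      · exact fun h => ⟨h 0 (by omega), fun s hs => h (s + 1) (by omega)⟩
    rw [h3, h2]
    change ν i * ((∏ s ∈ Finset.range t, P (x s) (x (s + 1))) * P i (x 0)) =
      ν i * P i (x 0) * ∏ s ∈ Finset.range t, P (x s) (x (s + 1))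
    ring
  · refine Set.disjoint_left.2 fun ω h1 h2 => hij ?_
    exact h1.1.symm.trans h2.1

/-- The Markov property at a fixed time. -/
lemma IsRandomWalk.shift [IsProbabilityMeasure μ] (h : IsRandomWalk μ P ν X) (t₀ : ℕ) :
    IsRandomWalk μ P (Matrix.vecMul ν (P ^ t₀)) (fun s => X (t₀ + s)) := by
  induction t₀ with
  | zero => simpa using h
  | succ t₀ ih =>
    have := ih.shift_one
    rw [Matrix.vecMul_vecMul, ← pow_succ] at this
    simpa [add_assoc, add_comm 1] using this

lemma IsRandomWalk.law_eq [IsProbabilityMeasure μ] (h : IsRandomWalk μ P ν X) (t : ℕ) (j : Fin n) :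
    μ.real {ω | X t ω = j} = Matrix.vecMul ν (P ^ t) j := by
  simpa using (h.shift t).law 0 (fun _ => j)

/-- The sum over paths of length `m` of the products of the entries of a matrix along the path. -/
lemma sum_paths_eq (A : Matrix (Fin n) (Fin n) ℝ) (ν g : Fin n → ℝ) (m : ℕ) :
    ∑ x : Fin (m + 1) → Fin n,
      ν (x 0) * (∏ s : Fin m, A (x s.castSucc) (x s.succ)) * g (x (Fin.last m)) =
      ∑ i, ν i * ((A ^ m).mulVec g) i := by
  induction m generalizing ν with
  | zero =>
    rw [← (Equiv.funUnique (Fin 1) (Fin n)).symm.sum_comp]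
    simp
  | succ m ih =>
    rw [← (Fin.consEquiv (fun _ => Fin n)).sum_comp, Fintype.sum_prod_type]
    refine Finset.sum_congr rfl fun i _ => ?_
    rw [pow_succ', ← Matrix.mulVec_mulVec, Matrix.mulVec, dotProduct, Finset.mul_sum]
    have := ih (fun j => ν i * A i j)
    simp only [mul_assoc] at this ⊢
    rw [← this]
    refine Finset.sum_congr rfl fun x _ => ?_
    simp only [Fin.consEquiv, Equiv.coe_fn_mk, Fin.prod_univ_succ, Fin.cons_zero, Fin.castSucc_zero,
      ← Fin.succ_castSucc, Fin.cons_succ, ← Fin.succ_last]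
    ring

/-- The probability that a random walk follows a given path. -/
lemma IsRandomWalk.law_fin (h : IsRandomWalk μ P ν X) (m : ℕ)
    (x : Fin (m + 1) → Fin n) :
    μ.real {ω | (fun s : Fin (m + 1) => X s ω) = x} =
      ν (x 0) * ∏ s : Fin m, P (x s.castSucc) (x s.succ) := by
  have h1 := h.law m (fun s => x (Fin.ofNat (m + 1) s))
  have h2 : {ω | (fun s : Fin (m + 1) => X s ω) = x} =
      {ω | ∀ s ≤ m, X s ω = x (Fin.ofNat (m + 1) s)} := by
    ext ω
    constructor
    · rintro h s hs
      have := congrFun h ⟨s, by omega⟩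
      simp only at this
      rw [this]
      congr 1
      ext
      simp [Nat.mod_eq_of_lt (show s < m + 1 by omega)]
    · intro h
      funext s
      have := h s (by omega)
      simpa using this
  rw [h2, h1, ← Fin.prod_univ_eq_prod_range
    (fun s => P (x (Fin.ofNat (m + 1) s)) (x (Fin.ofNat (m + 1) (s + 1))))]
  congr 1
  refine Finset.prod_congr rfl fun s _ => ?_
  congr 2
  · ext; simp
  · ext; simp

/-- The Feynman–Kac formula for a random walk: the expectation of a product of weights along the
path is a power of the weighted transition matrix. -/
lemma IsRandomWalk.integral_prod [IsProbabilityMeasure μ] (h : IsRandomWalk μ P ν X)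
    (w : Fin n → ℝ) (m : ℕ) :
    ∫ ω, ∏ s ∈ Finset.range (m + 1), w (X s ω) ∂μ =
      ∑ i, ν i * (((Matrix.diagonal w * P) ^ m).mulVec w) i := by
  let Y : Ω → Fin (m + 1) → Fin n := fun ω s => X s ω
  have hY : Measurable Y := measurable_pi_lambda _ fun s => h.measurable s
  have := Measure.isProbabilityMeasure_map (μ := μ) hY.aemeasurable
  have h1 : ∀ ω, ∏ s ∈ Finset.range (m + 1), w (X s ω) = ∏ s, w (Y ω s) := fun ω =>
    (Fin.prod_univ_eq_prod_range (fun s => w (X s ω)) (m + 1)).symm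
  simp only [h1]
  rw [← integral_map (f := fun y : Fin (m + 1) → Fin n => ∏ s, w (y s)) hY.aemeasurable
    (measurable_of_finite _).aestronglyMeasurable, integral_fintype .of_finite, ← sum_paths_eq]
  refine Finset.sum_congr rfl fun x _ => ?_
  rw [smul_eq_mul, map_measureReal_apply hY (measurableSet_singleton x)]
  have h2 : Y ⁻¹' {x} = {ω | (fun s : Fin (m + 1) => X s ω) = x} := rfl
  rw [h2, h.law_fin, Fin.prod_univ_castSucc]
  simp only [Matrix.diagonal_mul, Finset.prod_mul_distrib]
  ring

/-- The positions of independent walks at a fixed time are an independent sample. -/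
lemma IndepWalks.law_eq [IsProbabilityMeasure μ] {N : ℕ} {X : Fin N → ℕ → Ω → Fin n}
    (h : IndepWalks μ P ν N X) (t : ℕ) (y : Fin N → Fin n) :
    μ.real {ω | (fun k => X k t ω) = y} = ∏ k, Matrix.vecMul ν (P ^ t) (y k) := by
  have h1 : iIndepFun (fun k => X k t) μ :=
    h.indep.comp (fun _ x => x t) (fun _ => measurable_pi_apply t)
  have h2 := h1.measure_inter_preimage_eq_mul Finset.univ (sets := fun k => {y k})
    (fun k _ => measurableSet_singleton _)
  have h3 : {ω | (fun k => X k t ω) = y} = ⋂ k ∈ Finset.univ, X k t ⁻¹' {y k} := by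
    ext ω; simp [funext_iff]
  rw [h3, measureReal_def, h2, ENNReal.toReal_prod]
  exact Finset.prod_congr rfl fun k _ => (h.walk k).law_eq t (y k)

lemma IndepWalks.measurable {N : ℕ} {X : Fin N → ℕ → Ω → Fin n}
    (h : IndepWalks μ P ν N X) (t : ℕ) : Measurable (fun ω k => X k t ω) :=
  measurable_pi_lambda _ fun k => (h.walk k).measurable t

/-- Mixing from every starting state is mixing from every starting law. -/
lemma MixedAt.norm_sub_le {p : Fin n → ℝ} {δ : ℝ} {t : ℕ} (h : MixedAt P p δ t)
    (hν : ν ∈ stdSimplex ℝ (Fin n)) : ‖vec2 (Matrix.vecMul ν (P ^ t)) - vec2 p‖ ≤ δ := by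
  have h1 : vec2 (Matrix.vecMul ν (P ^ t)) - vec2 p =
      ∑ i, ν i • vec2 (fun j => (P ^ t) i j - p j) := by
    ext j
    simp [vec2_apply, Matrix.vecMul, dotProduct, mul_sub, ← Finset.sum_mul, hν.2]
  rw [h1]
  refine (norm_sum_le _ _).trans ?_
  calc _ ≤ ∑ i, ν i * δ := Finset.sum_le_sum fun i _ => by
        rw [norm_smul, Real.norm_eq_abs, abs_of_nonneg (hν.1 i)]
        exact mul_le_mul_of_nonneg_left ((norm_vec2_le_sum_abs _).trans (h i)) (hν.1 i)
    _ = δ := by rw [← Finset.sum_mul, hν.2, one_mul]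

/-- The Hoeffding-type inequality for the sum of the positions of independent walks. -/
lemma IndepWalks.norm_sum_tail [IsProbabilityMeasure μ] {N : ℕ} {X : Fin N → ℕ → Ω → Fin n}
    (h : IndepWalks μ P ν N X) (hP : P ∈ Matrix.rowStochastic ℝ (Fin n))
    (hν : ν ∈ stdSimplex ℝ (Fin n)) (v : EuclideanSpace ℝ (Fin n)) (t : ℕ) (hN : 0 < N) {r : ℝ}
    (hr : ∫ ω, ‖∑ k, (posVec (X k t ω) - v)‖ ∂μ ≤ r) :
    μ.real {ω | r ≤ ‖∑ k, (posVec (X k t ω) - v)‖} ≤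
      Real.exp (-(1 / (4 * N)) * (r - ∫ ω, ‖∑ k, (posVec (X k t ω) - v)‖ ∂μ) ^ 2) := by
  have hI := integral_eq_iidExp μ (h.measurable t) (h.law_eq t)
    (fun x => ‖∑ k, (posVec (x k) - v)‖)
  have hA := measureReal_eq_iidExp μ (h.measurable t) (h.law_eq t)
    {x | r ≤ ‖∑ k, (posVec (x k) - v)‖}
  simp only [Set.mem_ofPred_eq] at hA
  rw [hA]
  rw [hI] at hr ⊢
  refine (iidExp_norm_sum_tail (vecMul_pow_mem_stdSimplex hP hν t) v hN hr).trans ?_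
  have hN' : (0 : ℝ) < N := by exact_mod_cast hN
  rw [Real.exp_le_exp]
  refine mul_le_mul_of_nonneg_right ?_ (sq_nonneg _)
  rw [neg_le_neg_iff]
  exact one_div_le_one_div_of_le hN' (by linarith)

lemma IndepWalks.measure_error_le [IsProbabilityMeasure μ] {N : ℕ} {X : Fin N → ℕ → Ω → Fin n}
    (h : IndepWalks μ P ν N X) (hP : P ∈ Matrix.rowStochastic ℝ (Fin n))
    (hν : ν ∈ stdSimplex ℝ (Fin n)) {p : Fin n → ℝ} {t : ℕ} {ε σ : ℝ} (hε : 0 < ε)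
    (hσ : 0 < σ) (hσ1 : σ < 1) (hmix : MixedAt P p (ε / 2) t) (hN : walkerBound ε σ ≤ N) :
    μ.real {ω | ε ≤ ‖walkerAverage (fun k => X k t ω) - vec2 p‖} ≤ σ := by
  have hA := measureReal_eq_iidExp μ (h.measurable t) (h.law_eq t)
    {x | ε ≤ ‖walkerAverage x - vec2 p‖}
  simp only [Set.mem_ofPred_eq] at hA
  rw [hA]
  exact iidExp_walkers_le (vecMul_pow_mem_stdSimplex hP hν t) p hε hσ hσ1 (hmix.norm_sub_le hν) hN

end Walks

/-! ### Spectral bounds for reversible chains -/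

section Spectral

open Matrix

variable {n : ℕ}

/-- A symmetric matrix is bounded in norm by its numerical radius. -/
lemma mulVec_sq_le_of_abs_quadForm_le {B : Matrix (Fin n) (Fin n) ℝ} (hB : B.IsSymm) {z : ℝ}
    (hz : 0 ≤ z) (h : ∀ x, |x ⬝ᵥ B *ᵥ x| ≤ z * (x ⬝ᵥ x)) (x : Fin n → ℝ) :
    B *ᵥ x ⬝ᵥ B *ᵥ x ≤ z ^ 2 * (x ⬝ᵥ x) := by
  have hsym : ∀ x y, x ⬝ᵥ B *ᵥ y = y ⬝ᵥ B *ᵥ x := fun x y => by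
    rw [dotProduct_mulVec, ← mulVec_transpose, hB.eq, dotProduct_comm]
  -- polarization
  have h1 : ∀ y, 2 * (y ⬝ᵥ B *ᵥ x) ≤ z * (x ⬝ᵥ x + y ⬝ᵥ y) := fun y => by
    have h2 := (abs_le.1 (h (x + y))).2
    have h3 := (abs_le.1 (h (x - y))).1
    simp only [mulVec_add, mulVec_sub, add_dotProduct, sub_dotProduct, dotProduct_add,
      dotProduct_sub] at h2 h3
    rw [hsym x y, dotProduct_comm x y] at h2 h3
    linarith
  have h0 : 0 ≤ x ⬝ᵥ x := by simpa using dotProduct_star_self_nonneg x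
  rcases hz.eq_or_lt with rfl | hz
  · have := h1 (B *ᵥ x)
    simp only [zero_mul] at this
    nlinarith
  · have h4 := h1 (z⁻¹ • B *ᵥ x)
    simp only [smul_dotProduct, dotProduct_smul, smul_eq_mul] at h4
    have h5 : 2 * (z⁻¹ * (B *ᵥ x ⬝ᵥ B *ᵥ x)) * z = 2 * (B *ᵥ x ⬝ᵥ B *ᵥ x) := by
      field_simp
    have h6 : z * (x ⬝ᵥ x + z⁻¹ * (z⁻¹ * (B *ᵥ x ⬝ᵥ B *ᵥ x))) * z =
        z ^ 2 * (x ⬝ᵥ x) + B *ᵥ x ⬝ᵥ B *ᵥ x := by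
      field_simp
    have h7 := mul_le_mul_of_nonneg_right h4 hz.le
    rw [h5, h6] at h7
    linarith

lemma pow_mulVec_sq_le {B : Matrix (Fin n) (Fin n) ℝ} {z : ℝ}
    (h : ∀ x, B *ᵥ x ⬝ᵥ B *ᵥ x ≤ z ^ 2 * (x ⬝ᵥ x)) (m : ℕ) (x : Fin n → ℝ) :
    (B ^ m) *ᵥ x ⬝ᵥ (B ^ m) *ᵥ x ≤ (z ^ m) ^ 2 * (x ⬝ᵥ x) := by
  induction m with
  | zero => simp
  | succ m ih =>
    rw [pow_succ', ← mulVec_mulVec]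
    refine (h _).trans ?_
    calc _ ≤ z ^ 2 * ((z ^ m) ^ 2 * (x ⬝ᵥ x)) := by gcongr
      _ = _ := by ring

/-- If all eigenvalues of a symmetric matrix except one eigenvalue `1` are at most `1 - α` in
modulus, then the quadratic form is, up to `1 - α`, the projection on the fixed vector. -/
lemma abs_quadForm_sub_le {A : Matrix (Fin n) (Fin n) ℝ} (hA : A.IsHermitian) {α : ℝ}
    (hα : 0 < α) {u : Fin n → ℝ} (hu : u ⬝ᵥ u = 1) (hAu : A *ᵥ u = u) (i₀ : Fin n)
    (hev : ∀ i, i ≠ i₀ → |hA.eigenvalues i| ≤ 1 - α) (h₀ : hA.eigenvalues i₀ = 1)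
    (x : Fin n → ℝ) :
    |x ⬝ᵥ A *ᵥ x - (u ⬝ᵥ x) ^ 2| ≤ (1 - α) * (x ⬝ᵥ x - (u ⬝ᵥ x) ^ 2) := by
  let v : Fin n → Fin n → ℝ := fun i => ⇑(hA.eigenvectorBasis i)
  have hpars : ∀ y z : Fin n → ℝ, y ⬝ᵥ z = ∑ i, (v i ⬝ᵥ y) * (v i ⬝ᵥ z) := fun y z => by
    have := hA.eigenvectorBasis.sum_inner_mul_inner (WithLp.toLp 2 y) (WithLp.toLp 2 z)
    simp only [EuclideanSpace.inner_eq_star_dotProduct, star_trivial] at this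
    rw [dotProduct_comm, ← this]
    refine Finset.sum_congr rfl fun i _ => ?_
    rw [dotProduct_comm z]
  have hAc : ∀ i y, v i ⬝ᵥ A *ᵥ y = hA.eigenvalues i * (v i ⬝ᵥ y) := fun i y => by
    rw [dotProduct_mulVec, ← mulVec_transpose]
    have : Aᵀ = A := by simpa using hA.eq
    rw [this, hA.mulVec_eigenvectorBasis i, smul_dotProduct, smul_eq_mul]
  have huc : ∀ i, i ≠ i₀ → v i ⬝ᵥ u = 0 := fun i hi => by
    have h1 := hAc i u
    rw [hAu] at h1
    have h2 : (1 - hA.eigenvalues i) * (v i ⬝ᵥ u) = 0 := by linarith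
    rcases mul_eq_zero.1 h2 with h | h
    · linarith [le_abs_self (hA.eigenvalues i), hev i hi]
    · exact h
  have hproj : ∀ y, u ⬝ᵥ y = (v i₀ ⬝ᵥ u) * (v i₀ ⬝ᵥ y) := fun y => by
    rw [hpars, Finset.sum_eq_single i₀]
    · intro i _ hi
      rw [huc i hi, zero_mul]
    · simp
  have hsq : (u ⬝ᵥ x) ^ 2 = (v i₀ ⬝ᵥ x) * (v i₀ ⬝ᵥ x) := by
    have := hproj u
    rw [hu] at this
    rw [hproj, mul_pow, sq, ← this, one_mul, sq]
  have h1 : x ⬝ᵥ A *ᵥ x - (u ⬝ᵥ x) ^ 2 =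
      ∑ i ∈ Finset.univ.erase i₀, hA.eigenvalues i * (v i ⬝ᵥ x) ^ 2 := by
    rw [hpars, hsq, ← Finset.add_sum_erase _ _ (Finset.mem_univ i₀), hAc, h₀, one_mul,
      add_sub_cancel_left]
    refine Finset.sum_congr rfl fun i _ => ?_
    rw [hAc]
    ring
  have h2 : x ⬝ᵥ x - (u ⬝ᵥ x) ^ 2 = ∑ i ∈ Finset.univ.erase i₀, (v i ⬝ᵥ x) ^ 2 := by
    rw [hpars, hsq, ← Finset.add_sum_erase _ _ (Finset.mem_univ i₀), add_sub_cancel_left]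
    exact Finset.sum_congr rfl fun i _ => (sq _).symm
  rw [h1, h2, Finset.mul_sum]
  refine (Finset.abs_sum_le_sum_abs _ _).trans (Finset.sum_le_sum fun i hi => ?_)
  rw [abs_mul, abs_of_nonneg (sq_nonneg (v i ⬝ᵥ x))]
  exact mul_le_mul_of_nonneg_right (hev i (Finset.ne_of_mem_erase hi)) (sq_nonneg _)

/-- The symmetric matrix similar to a reversible transition matrix. -/
noncomputable def symMat (P : Matrix (Fin n) (Fin n) ℝ) (p : Fin n → ℝ) :
    Matrix (Fin n) (Fin n) ℝ :=
  diagonal (fun i => Real.sqrt (p i)) * P * diagonal (fun i => (Real.sqrt (p i))⁻¹)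

variable {P : Matrix (Fin n) (Fin n) ℝ} {p : Fin n → ℝ} {α : ℝ}

lemma symMat_apply (i j : Fin n) :
    symMat P p i j = Real.sqrt (p i) * P i j * (Real.sqrt (p j))⁻¹ := by
  simp [symMat]

lemma charpoly_symMat (hpos : ∀ i, 0 < p i) : (symMat P p).charpoly = P.charpoly := by
  rw [symMat, charpoly_mul_comm, ← mul_assoc, diagonal_mul_diagonal]
  have : ∀ i, (Real.sqrt (p i))⁻¹ * Real.sqrt (p i) = 1 := fun i =>
    inv_mul_cancel₀ (Real.sqrt_pos.2 (hpos i)).ne'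
  simp [this]

lemma isSymm_symMat (hpos : ∀ i, 0 < p i) (hrev : IsReversible P p) : (symMat P p).IsSymm := by
  ext i j
  rw [transpose_apply, symMat_apply, symMat_apply]
  have hi := Real.sqrt_pos.2 (hpos i)
  have hj := Real.sqrt_pos.2 (hpos j)
  have h := hrev i j
  rw [← Real.mul_self_sqrt (hpos i).le, ← Real.mul_self_sqrt (hpos j).le] at h
  field_simp
  linarith

lemma spectralGap_le_one (P : Matrix (Fin n) (Fin n) ℝ) : spectralGap P ≤ 1 := by
  unfold spectralGap
  linarith [NNReal.coe_nonneg
    ((((P.map (algebraMap ℝ ℂ)).charpoly.roots.erase 1).map (fun z => ‖z‖₊)).sup)]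

lemma symMat_mulVec_sqrt (hP : P ∈ rowStochastic ℝ (Fin n)) (hpos : ∀ i, 0 < p i) :
    symMat P p *ᵥ (fun i => Real.sqrt (p i)) = fun i => Real.sqrt (p i) := by
  funext i
  simp only [mulVec, dotProduct, symMat_apply]
  have : ∀ j, Real.sqrt (p i) * P i j * (Real.sqrt (p j))⁻¹ * Real.sqrt (p j) =
      Real.sqrt (p i) * P i j := fun j => by
    rw [mul_assoc, inv_mul_cancel₀ (Real.sqrt_pos.2 (hpos j)).ne', mul_one]
  simp only [this, ← Finset.mul_sum, sum_row_of_mem_rowStochastic hP, mul_one]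

lemma sqrt_dotProduct_sqrt (hp : p ∈ stdSimplex ℝ (Fin n)) :
    (fun i => Real.sqrt (p i)) ⬝ᵥ (fun i => Real.sqrt (p i)) = 1 := by
  simp only [dotProduct, Real.mul_self_sqrt (hp.1 _), hp.2]

/-- The spectral gap as a bound for the quadratic form of the symmetrized transition matrix. -/
lemma abs_quadForm_symMat_le (hPR : IsPageRank P p) (hrev : IsReversible P p)
    (hpos : ∀ i, 0 < p i) (hα : 0 < α) (hgap : α ≤ spectralGap P) (x : Fin n → ℝ) :
    |x ⬝ᵥ symMat P p *ᵥ x - ((fun i => Real.sqrt (p i)) ⬝ᵥ x) ^ 2| ≤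
      (1 - α) * (x ⬝ᵥ x - ((fun i => Real.sqrt (p i)) ⬝ᵥ x) ^ 2) := by
  have hH : (symMat P p).IsHermitian := by
    ext i j
    simpa using congrFun (congrFun (isSymm_symMat hpos hrev).eq i) j
  set u : Fin n → ℝ := fun i => Real.sqrt (p i) with hu
  have huu : u ⬝ᵥ u = 1 := sqrt_dotProduct_sqrt hPR.prob
  have hSu := symMat_mulVec_sqrt (p := p) hPR.stochastic hpos
  have hcp : (P.map (algebraMap ℝ ℂ)).charpoly.roots =
      Multiset.map (fun i => ((hH.eigenvalues i : ℝ) : ℂ)) Finset.univ.val := by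
    rw [charpoly_map, ← charpoly_symMat hpos, hH.charpoly_eq, Polynomial.map_prod,
      Polynomial.roots_prod]
    · simp
    · simp [Finset.prod_ne_zero_iff, Polynomial.X_sub_C_ne_zero]
  -- `1` is an eigenvalue, since the fixed vector has a nonzero component in the eigenbasis
  obtain ⟨i₀, h₀⟩ : ∃ i, hH.eigenvalues i = 1 := by
    by_contra! hne
    have h1 : ∀ i, ⇑(hH.eigenvectorBasis i) ⬝ᵥ u = 0 := fun i => by
      have h2 : ⇑(hH.eigenvectorBasis i) ⬝ᵥ symMat P p *ᵥ u =
          hH.eigenvalues i * (⇑(hH.eigenvectorBasis i) ⬝ᵥ u) := by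
        rw [dotProduct_mulVec, ← mulVec_transpose, (isSymm_symMat hpos hrev).eq,
          hH.mulVec_eigenvectorBasis i, smul_dotProduct, smul_eq_mul]
      rw [hSu] at h2
      have h3 : (1 - hH.eigenvalues i) * (⇑(hH.eigenvectorBasis i) ⬝ᵥ u) = 0 := by
        rw [sub_mul, one_mul, sub_eq_zero]
        exact h2
      exact (mul_eq_zero.1 h3).resolve_left (sub_ne_zero.2 (hne i).symm)
    have h4 := hH.eigenvectorBasis.sum_inner_mul_inner (WithLp.toLp 2 u) (WithLp.toLp 2 u)
    simp only [EuclideanSpace.inner_eq_star_dotProduct, star_trivial] at h4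
    rw [huu, Finset.sum_eq_zero fun i _ => by rw [h1 i, zero_mul]] at h4
    exact zero_ne_one h4
  refine abs_quadForm_sub_le hH hα huu hSu i₀ (fun i hi => ?_) h₀ x
  have hmem : ((hH.eigenvalues i : ℝ) : ℂ) ∈ (P.map (algebraMap ℝ ℂ)).charpoly.roots.erase 1 := by
    have h5 : (Finset.univ : Finset (Fin n)).val = i₀ ::ₘ (Finset.univ.erase i₀).val := by
      rw [Finset.erase_val, Multiset.cons_erase (Finset.mem_univ_val i₀)]
    rw [hcp, h5, Multiset.map_cons, h₀, Complex.ofReal_one, Multiset.erase_cons_head]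
    exact Multiset.mem_map_of_mem (fun i => ((hH.eigenvalues i : ℝ) : ℂ))
      (Finset.mem_erase.2 ⟨hi, Finset.mem_univ i⟩)
  have h6 := Multiset.le_sup (Multiset.mem_map_of_mem (fun z : ℂ => ‖z‖₊) hmem)
  have h7 : |hH.eigenvalues i| ≤
      ((((P.map (algebraMap ℝ ℂ)).charpoly.roots.erase 1).map (fun z => ‖z‖₊)).sup : NNReal) := by
    have := NNReal.coe_le_coe.2 h6
    simpa using this
  unfold spectralGap at hgap
  linarith

lemma symMat_pow_apply (hpos : ∀ i, 0 < p i) (t : ℕ) (i j : Fin n) :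
    (symMat P p ^ t) i j = Real.sqrt (p i) * (P ^ t) i j * (Real.sqrt (p j))⁻¹ := by
  induction t generalizing j with
  | zero =>
    rcases eq_or_ne i j with rfl | hij
    · simp [(Real.sqrt_pos.2 (hpos i)).ne']
    · simp [hij]
  | succ t ih =>
    rw [pow_succ, pow_succ, mul_apply, mul_apply, Finset.mul_sum, Finset.sum_mul]
    refine Finset.sum_congr rfl fun k _ => ?_
    rw [ih, symMat_apply]
    have := (Real.sqrt_pos.2 (hpos k)).ne'
    field_simp

/-- Powers of a symmetric matrix after removal of the projection on a fixed unit vector. -/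
lemma sub_vecMulVec_pow {S : Matrix (Fin n) (Fin n) ℝ} (hS : S.IsSymm) {u : Fin n → ℝ}
    (hu : u ⬝ᵥ u = 1) (hSu : S *ᵥ u = u) (t : ℕ) :
    (S - vecMulVec u u) ^ (t + 1) = S ^ (t + 1) - vecMulVec u u := by
  have h1 : S * vecMulVec u u = vecMulVec u u := by rw [mul_vecMulVec, hSu]
  have h2 : vecMulVec u u * S = vecMulVec u u := by
    rw [vecMulVec_mul, ← mulVec_transpose, hS.eq, hSu]
  have h3 : vecMulVec u u * vecMulVec u u = vecMulVec u u := by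
    rw [vecMulVec_mul_vecMulVec, hu, one_smul]
  induction t with
  | zero => simp
  | succ t ih =>
    have h4 : S ^ (t + 1) * vecMulVec u u = vecMulVec u u := by
      clear ih
      induction t with
      | zero => simpa using h1
      | succ t ih => rw [pow_succ, mul_assoc, h1, ih]
    rw [pow_succ, ih, sub_mul, mul_sub, mul_sub, h2, h3, h4, ← pow_succ]
    abel

/-- Mixing of a reversible chain: the distance decreases like `(1 - α)ᵗ`. With `S = symMat P p` and
`u = √p`, the rows of `(S - u uᵀ)ᵗ = Sᵗ - u uᵀ` have norm at most `(1 - α)ᵗ`, and the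
Cauchy–Schwarz inequality with the unit vector `u` passes to the sum of the absolute values. -/
lemma sum_abs_pow_sub_le (hPR : IsPageRank P p) (hrev : IsReversible P p)
    (hpos : ∀ i, 0 < p i) (hα : 0 < α) (hgap : α ≤ spectralGap P) {t : ℕ} (ht : 1 ≤ t)
    (i : Fin n) :
    ∑ j, |(P ^ t) i j - p j| ≤ (Real.sqrt (p i))⁻¹ * (1 - α) ^ t := by
  obtain ⟨t, rfl⟩ : ∃ s, t = s + 1 := ⟨t - 1, by omega⟩
  have hα1 : 0 ≤ 1 - α := by linarith [spectralGap_le_one P]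
  set u : Fin n → ℝ := fun i => Real.sqrt (p i) with hu
  have hupos : ∀ i, 0 < u i := fun i => Real.sqrt_pos.2 (hpos i)
  set R := symMat P p - vecMulVec u u with hR
  have hSs := isSymm_symMat hpos hrev
  have hRs : R.IsSymm := by
    refine hSs.sub ?_
    ext a b
    simp [vecMulVec_apply, mul_comm]
  have hRq : ∀ x, |x ⬝ᵥ R *ᵥ x| ≤ (1 - α) * (x ⬝ᵥ x) := fun x => by
    have h1 := abs_quadForm_symMat_le hPR hrev hpos hα hgap x
    have h2 : x ⬝ᵥ R *ᵥ x = x ⬝ᵥ symMat P p *ᵥ x - (u ⬝ᵥ x) ^ 2 := by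
      rw [hR, sub_mulVec, dotProduct_sub, vecMulVec_mulVec, dotProduct_smul, dotProduct_comm x u]
      simp [sq]
    rw [h2]
    refine h1.trans (mul_le_mul_of_nonneg_left ?_ hα1)
    linarith [sq_nonneg (u ⬝ᵥ x)]
  have hRp : ∀ j, (R ^ (t + 1)) j i = (R ^ (t + 1)) i j := fun j =>
    congrFun (congrFun (hRs.pow (t + 1)).eq i) j
  have h3 := pow_mulVec_sq_le (mulVec_sq_le_of_abs_quadForm_le hRs hα1 hRq) (t + 1) (Pi.single i 1)
  simp only [mulVec_single_one, single_dotProduct, Pi.single_eq_same, mul_one] at h3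
  have h4 : ∑ j, (R ^ (t + 1)) i j ^ 2 ≤ ((1 - α) ^ (t + 1)) ^ 2 := by
    refine le_trans (le_of_eq ?_) h3
    simp only [dotProduct, col_apply, hRp, sq]
  have h5 : ∀ j, |(P ^ (t + 1)) i j - p j| = (u i)⁻¹ * (u j * |(R ^ (t + 1)) i j|) := fun j => by
    rw [hR, sub_vecMulVec_pow hSs (sqrt_dotProduct_sqrt hPR.prob)
      (symMat_mulVec_sqrt hPR.stochastic hpos), Matrix.sub_apply, symMat_pow_apply hpos,
      vecMulVec_apply]
    have hi := hupos i
    have hj := hupos j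
    have habs : ∀ r, (u i)⁻¹ * (u j * |r|) = |(u i)⁻¹ * (u j * r)| := fun r => by
      rw [abs_mul, abs_mul, abs_of_pos hj, abs_of_pos (inv_pos.2 hi)]
    rw [habs]
    congr 1
    have h6 : p j = u j * u j := (Real.mul_self_sqrt (hpos j).le).symm
    change (P ^ (t + 1)) i j - p j =
      (u i)⁻¹ * (u j * (u i * (P ^ (t + 1)) i j * (u j)⁻¹ - u i * u j))
    rw [h6]
    field_simp
  simp only [h5, ← Finset.mul_sum]
  refine mul_le_mul_of_nonneg_left ?_ (inv_pos.2 (hupos i)).le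
  refine abs_le_of_sq_le_sq' ?_ (pow_nonneg hα1 _) |>.2
  refine (Finset.sum_mul_sq_le_sq_mul_sq _ _ _).trans ?_
  have h7 : ∑ j, u j ^ 2 = 1 := by
    have := sqrt_dotProduct_sqrt hPR.prob
    simpa only [dotProduct, sq, hu] using this
  rw [h7, one_mul]
  simpa only [sq_abs] using h4

/-- A bound `z` for the norm of the symmetrized transition matrix weighted by `w`. The unweighted
matrix is at most `α u uᵀ + (1 - α) I` with `u = √p`; for this rank-one perturbation of a diagonal
matrix, `hz` is the secular equation, as an inequality. -/
lemma abs_quadForm_weighted_le (hPR : IsPageRank P p) (hrev : IsReversible P p)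
    (hpos : ∀ i, 0 < p i) (hα : 0 < α) (hgap : α ≤ spectralGap P) {w : Fin n → ℝ}
    (hw : ∀ i, 0 < w i) {z : ℝ} (hzw : ∀ i, (1 - α) * w i < z)
    (hz : α * ∑ i, p i * w i / (z - (1 - α) * w i) ≤ 1) (x : Fin n → ℝ) :
    |x ⬝ᵥ (diagonal (fun i => Real.sqrt (w i)) * symMat P p *
      diagonal (fun i => Real.sqrt (w i))) *ᵥ x| ≤ z * (x ⬝ᵥ x) := by
  have hα1 : 0 ≤ 1 - α := by linarith [spectralGap_le_one P]
  set u : Fin n → ℝ := fun i => Real.sqrt (p i) with hu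
  set y : Fin n → ℝ := fun i => Real.sqrt (w i) * x i with hy
  have hD : ∀ v : Fin n → ℝ, diagonal (fun i => Real.sqrt (w i)) *ᵥ v =
      fun i => Real.sqrt (w i) * v i := fun v => by
    funext i
    rw [mulVec_diagonal]
  have h1 : x ⬝ᵥ (diagonal (fun i => Real.sqrt (w i)) * symMat P p *
      diagonal (fun i => Real.sqrt (w i))) *ᵥ x = y ⬝ᵥ symMat P p *ᵥ y := by
    rw [← mulVec_mulVec, ← mulVec_mulVec, hD x, hD]
    simp only [dotProduct]
    exact Finset.sum_congr rfl fun i _ => by rw [hy]; ring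
  have hyy : y ⬝ᵥ y = ∑ i, w i * x i ^ 2 := by
    refine Finset.sum_congr rfl fun i _ => ?_
    have := Real.mul_self_sqrt (hw i).le
    simp only [hy]
    linear_combination (x i ^ 2) * this
  have hb := abs_le.1 (abs_quadForm_symMat_le hPR hrev hpos hα hgap y)
  have hxx : ∑ i, (z - (1 - α) * w i) * x i ^ 2 = z * (x ⬝ᵥ x) - (1 - α) * (y ⬝ᵥ y) := by
    rw [hyy, dotProduct, Finset.mul_sum, Finset.mul_sum, ← Finset.sum_sub_distrib]
    exact Finset.sum_congr rfl fun i _ => by ring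
  have hpos' : 0 ≤ ∑ i, (z - (1 - α) * w i) * x i ^ 2 := Finset.sum_nonneg fun i _ =>
    mul_nonneg (by linarith [hzw i]) (sq_nonneg _)
  have hcs : (u ⬝ᵥ y) ^ 2 ≤ (∑ i, p i * w i / (z - (1 - α) * w i)) *
      ∑ i, (z - (1 - α) * w i) * x i ^ 2 := by
    refine Finset.sum_sq_le_sum_mul_sum_of_sq_le_mul _ (fun i _ => ?_) (fun i _ => ?_)
      (fun i _ => ?_)
    · exact div_nonneg (mul_nonneg (hpos i).le (hw i).le) (by linarith [hzw i])
    · exact mul_nonneg (by linarith [hzw i]) (sq_nonneg _)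
    · have h2 : z - (1 - α) * w i ≠ 0 := by linarith [hzw i]
      have h3 := Real.sq_sqrt (hw i).le
      have h4 := Real.sq_sqrt (hpos i).le
      simp only [hu, hy, mul_pow, h3, h4]
      rw [div_mul_eq_mul_div, le_div_iff₀ (by linarith [hzw i])]
      exact le_of_eq (by ring)
  have hcs' : α * (u ⬝ᵥ y) ^ 2 ≤ ∑ i, (z - (1 - α) * w i) * x i ^ 2 := by
    calc _ ≤ α * ((∑ i, p i * w i / (z - (1 - α) * w i)) *
          ∑ i, (z - (1 - α) * w i) * x i ^ 2) := mul_le_mul_of_nonneg_left hcs hα.le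
      _ = (α * ∑ i, p i * w i / (z - (1 - α) * w i)) *
          ∑ i, (z - (1 - α) * w i) * x i ^ 2 := by ring
      _ ≤ _ := mul_le_of_le_one_left hpos' hz
  have h0 : 0 ≤ (u ⬝ᵥ y) ^ 2 := sq_nonneg _
  rw [h1, abs_le]
  have h5 : 0 ≤ (1 - α) * (u ⬝ᵥ y) ^ 2 := mul_nonneg hα1 h0
  have h6 := hb.1
  have h7 := hb.2
  constructor <;> nlinarith

/-- A bound for the expectation of a product of weights along a reversible chain, in the form given
by the Feynman–Kac formula. The factor `Q` bounds the density of the starting law `ν` with respect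
to the stationary law, in the mean square. -/
lemma sum_mul_weighted_pow_le (hPR : IsPageRank P p) (hrev : IsReversible P p)
    (hpos : ∀ i, 0 < p i) (hα : 0 < α) (hgap : α ≤ spectralGap P) {w : Fin n → ℝ}
    (hw : ∀ i, 0 < w i) {z : ℝ} (hz0 : 0 ≤ z) (hzw : ∀ i, (1 - α) * w i < z)
    (hz : α * ∑ i, p i * w i / (z - (1 - α) * w i) ≤ 1) {W Q : ℝ} (hW0 : 0 ≤ W)
    (hW : ∀ i, w i ≤ W)
    (hQ : ∀ i, (p i)⁻¹ ≤ Q ^ 2) (hQ0 : 0 ≤ Q) {ν : Fin n → ℝ} (hν : ν ∈ stdSimplex ℝ (Fin n))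
    (m : ℕ) :
    ∑ i, ν i * (((diagonal w * P) ^ m) *ᵥ w) i ≤ Q * W * z ^ m := by
  set D : Matrix (Fin n) (Fin n) ℝ := diagonal (fun i => Real.sqrt (w i)) with hD
  set B := D * symMat P p * D with hB
  set E : Matrix (Fin n) (Fin n) ℝ := diagonal (fun i => Real.sqrt (w i) * (Real.sqrt (p i))⁻¹)
    with hE
  have hBs : B.IsSymm := by
    have h1 := (isSymm_symMat (P := P) hpos hrev).eq
    rw [Matrix.IsSymm, hB, transpose_mul, transpose_mul, h1, hD, diagonal_transpose, mul_assoc]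
  -- the weighted transition matrix is similar to the symmetric matrix `B`
  have hAE : (diagonal w * P) * E = E * B := by
    ext i j
    simp only [hE, hB, hD, mul_diagonal, diagonal_mul, symMat_apply]
    have h1 := inv_mul_cancel₀ (Real.sqrt_pos.2 (hpos i)).ne'
    have h2 := Real.mul_self_sqrt (hw i).le
    linear_combination (-(P i j * Real.sqrt (w j) * (Real.sqrt (p j))⁻¹)) * h2 -
      Real.sqrt (w i) ^ 2 * P i j * (Real.sqrt (p j))⁻¹ * Real.sqrt (w j) * h1
  have hAEm : (diagonal w * P) ^ m * E = E * B ^ m := by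
    induction m with
    | zero => simp
    | succ m ih => rw [pow_succ, mul_assoc, hAE, ← mul_assoc, ih, mul_assoc, ← pow_succ]
  set h₀ : Fin n → ℝ := fun i => Real.sqrt (w i) * Real.sqrt (p i) with hh₀
  have hwE : w = E *ᵥ h₀ := by
    funext i
    rw [hE, mulVec_diagonal, hh₀]
    have h1 := (Real.sqrt_pos.2 (hpos i)).ne'
    have h2 := Real.mul_self_sqrt (hw i).le
    field_simp
    linarith
  have h3 : ((diagonal w * P) ^ m) *ᵥ w = E *ᵥ (B ^ m *ᵥ h₀) := by
    conv_lhs => rw [hwE]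
    rw [mulVec_mulVec, ← hwE, hAEm, ← mulVec_mulVec]
  have h4 := pow_mulVec_sq_le (mulVec_sq_le_of_abs_quadForm_le hBs hz0
    (abs_quadForm_weighted_le hPR hrev hpos hα hgap hw hzw hz)) m h₀
  have h5 : h₀ ⬝ᵥ h₀ ≤ W := by
    calc h₀ ⬝ᵥ h₀ = ∑ i, w i * p i := by
          refine Finset.sum_congr rfl fun i _ => ?_
          rw [hh₀, mul_mul_mul_comm, Real.mul_self_sqrt (hw i).le, Real.mul_self_sqrt (hpos i).le]
      _ ≤ ∑ i, W * p i := Finset.sum_le_sum fun i _ =>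
          mul_le_mul_of_nonneg_right (hW i) (hpos i).le
      _ = W := by rw [← Finset.mul_sum, hPR.prob.2, mul_one]
  have h6 : ∑ i, (ν i * (Real.sqrt (w i) * (Real.sqrt (p i))⁻¹)) ^ 2 ≤ Q ^ 2 * W := by
    calc _ ≤ ∑ i, ν i * (Q ^ 2 * W) := Finset.sum_le_sum fun i _ => by
          rw [mul_pow, mul_pow, Real.sq_sqrt (hw i).le, inv_pow, Real.sq_sqrt (hpos i).le, sq,
            mul_assoc, mul_comm (w i)]
          have h7 : ν i ≤ 1 := by
            rw [← hν.2]
            exact Finset.single_le_sum (fun j _ => hν.1 j) (Finset.mem_univ i)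
          refine mul_le_mul_of_nonneg_left ?_ (hν.1 i)
          have h8 : (p i)⁻¹ * w i ≤ Q ^ 2 * W :=
            mul_le_mul (hQ i) (hW i) (hw i).le (sq_nonneg _)
          have h9 : 0 ≤ (p i)⁻¹ * w i := mul_nonneg (inv_pos.2 (hpos i)).le (hw i).le
          nlinarith [hν.1 i]
      _ = Q ^ 2 * W := by rw [← Finset.sum_mul, hν.2, one_mul]
  have h7 : ∑ i, ν i * (((diagonal w * P) ^ m) *ᵥ w) i =
      ∑ i, (ν i * (Real.sqrt (w i) * (Real.sqrt (p i))⁻¹)) * (B ^ m *ᵥ h₀) i := by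
    rw [h3]
    refine Finset.sum_congr rfl fun i _ => ?_
    rw [hE, mulVec_diagonal]
    ring
  rw [h7]
  refine abs_le_of_sq_le_sq' ?_ (by positivity) |>.2
  refine (Finset.sum_mul_sq_le_sq_mul_sq _ _ _).trans ?_
  have h8 : ∑ i, (B ^ m *ᵥ h₀) i ^ 2 ≤ (z ^ m) ^ 2 * W := by
    refine le_trans (le_of_eq ?_) (h4.trans (mul_le_mul_of_nonneg_left h5 (sq_nonneg _)))
    simp only [dotProduct, sq]
  calc _ ≤ (Q ^ 2 * W) * ((z ^ m) ^ 2 * W) :=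
        mul_le_mul h6 h8 (Finset.sum_nonneg fun i _ => sq_nonneg _) (by positivity)
    _ = _ := by ring

end Spectral

/-! ### Deviation bounds for a single walk -/

section SingleWalk

open Matrix

variable {n : ℕ} {Ω : Type*} [MeasurableSpace Ω] {μ : Measure Ω}
  {P : Matrix (Fin n) (Fin n) ℝ} {p ν : Fin n → ℝ} {α : ℝ} {X : ℕ → Ω → Fin n}

/-- The equation for the norm of the weighted transition matrix when a single vertex of
probability `r` has the weight `1 + a` and the others have the weight `1`. -/
lemma leon_perron_root {α r a : ℝ} (hα : 0 < α) (hα1 : α ≤ 1) (hr : 0 < r) (hr1 : r ≤ 1)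
    (ha : |a| ≤ α / 2) :
    1 - α < 1 + r * a + 2 * r * a ^ 2 / α ∧
    (1 - α) * (1 + a) < 1 + r * a + 2 * r * a ^ 2 / α ∧
    α * (r * (1 + a) / (1 + r * a + 2 * r * a ^ 2 / α - (1 - α) * (1 + a)) +
      (1 - r) / (1 + r * a + 2 * r * a ^ 2 / α - (1 - α))) ≤ 1 := by
  obtain ⟨b, hb⟩ : ∃ b, b = a / α := ⟨_, rfl⟩
  have hab : a = α * b := by rw [hb]; field_simp
  have hb2 : |b| ≤ 1 / 2 := by
    rw [hb, abs_div, abs_of_pos hα, div_le_iff₀ hα]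
    linarith
  have hb3 := abs_le.1 hb2
  have hz : 1 + r * a + 2 * r * a ^ 2 / α = 1 + α * (r * (b + 2 * b ^ 2)) := by
    rw [hab]; field_simp; ring
  rw [hz, hab]
  have h1 : -(1 / 8) ≤ r * (b + 2 * b ^ 2) := by
    nlinarith [mul_nonneg hr.le (sq_nonneg (4 * b + 1))]
  have h2 : 0 < 1 + r * (b + 2 * b ^ 2) := by linarith
  have h3 : 0 < r * (b + 2 * b ^ 2) + 1 - (1 - α) * b := by
    nlinarith [mul_nonneg (sub_nonneg.2 hα1) (by linarith : 0 ≤ 1 / 2 - b),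
      mul_nonneg hα.le (by linarith : (0:ℝ) ≤ 1 / 2)]
  refine ⟨by nlinarith, by nlinarith, ?_⟩
  have e1 : 1 + α * (r * (b + 2 * b ^ 2)) - (1 - α) * (1 + α * b) =
      α * (r * (b + 2 * b ^ 2) + 1 - (1 - α) * b) := by ring
  have e2 : 1 + α * (r * (b + 2 * b ^ 2)) - (1 - α) = α * (1 + r * (b + 2 * b ^ 2)) := by ring
  rw [e1, e2, mul_add, ← mul_div_assoc, ← mul_div_assoc, mul_div_mul_left _ _ hα.ne',
    mul_div_mul_left _ _ hα.ne', div_add_div _ _ h3.ne' h2.ne', div_le_one (mul_pos h3 h2)]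
  -- after clearing denominators the inequality is `y b (1 - α + α r) ≤ 2 r b² + y²`
  have h4 : b * (b + 2 * b ^ 2) ≤ 2 * b ^ 2 := by nlinarith [sq_nonneg b]
  have h5 : 0 ≤ b * (b + 2 * b ^ 2) := by nlinarith [sq_nonneg b]
  have h6 : r * (b * (b + 2 * b ^ 2)) * (1 - α + α * r) ≤ r * (2 * b ^ 2) := by
    have : 1 - α + α * r ≤ 1 := by nlinarith
    calc _ ≤ r * (b * (b + 2 * b ^ 2)) * 1 := by gcongr
      _ ≤ _ := by rw [mul_one]; gcongr
  nlinarith [sq_nonneg (r * (b + 2 * b ^ 2))]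

/-- The number of visits to `j` up to time `m`. -/
noncomputable def visits (X : ℕ → Ω → Fin n) (m : ℕ) (j : Fin n) (ω : Ω) : ℝ :=
  ∑ s ∈ Finset.range (m + 1), if X s ω = j then 1 else 0

/-- A Chernoff bound for the number of visits: `1 + a` is the weight of a visit. -/
lemma IsRandomWalk.measure_visits_le [IsProbabilityMeasure μ] (h : IsRandomWalk μ P ν X)
    (hν : ν ∈ stdSimplex ℝ (Fin n)) (hPR : IsPageRank P p) (hrev : IsReversible P p)
    (hpos : ∀ i, 0 < p i) (hα : 0 < α) (hgap : α ≤ spectralGap P) {Q : ℝ}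
    (hQ : ∀ i, (p i)⁻¹ ≤ Q ^ 2) (hQ0 : 0 ≤ Q) (m : ℕ) (j : Fin n) {a c e : ℝ} (ha : |a| ≤ α / 2)
    (hc : Real.exp c ≤ 1 + a) :
    μ.real {ω | e ≤ c * visits X m j ω} ≤
      2 * Q * Real.exp (m * (p j * a + 2 * p j * a ^ 2 / α) - e) := by
  have hα1 := hgap.trans (spectralGap_le_one P)
  have hp1 : p j ≤ 1 := by
    rw [← hPR.prob.2]
    exact Finset.single_le_sum (fun i _ => hPR.prob.1 i) (Finset.mem_univ j)
  obtain ⟨hz1, hz2, hz3⟩ := leon_perron_root hα hα1 (hpos j) hp1 ha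
  set z := 1 + p j * a + 2 * p j * a ^ 2 / α with hz
  have hab := abs_le.1 ha
  let w : Fin n → ℝ := fun i => if i = j then 1 + a else 1
  have hw : ∀ i, 0 < w i := fun i => by
    simp only [w]; split_ifs <;> linarith
  have hw2 : ∀ i, w i ≤ 2 := fun i => by
    simp only [w]; split_ifs <;> linarith
  have hzw : ∀ i, (1 - α) * w i < z := fun i => by
    simp only [w]; split_ifs
    · exact hz2
    · rwa [mul_one]
  have hsum : α * ∑ i, p i * w i / (z - (1 - α) * w i) ≤ 1 := by
    refine le_trans (le_of_eq ?_) hz3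
    rw [← Finset.add_sum_erase _ _ (Finset.mem_univ j)]
    have h1 : ∑ i ∈ Finset.univ.erase j, p i * w i / (z - (1 - α) * w i) =
        (1 - p j) / (z - (1 - α)) := by
      have h2 : ∀ i ∈ Finset.univ.erase j, p i * w i / (z - (1 - α) * w i) =
          p i / (z - (1 - α)) := fun i hi => by
        simp [w, Finset.ne_of_mem_erase hi]
      rw [Finset.sum_congr rfl h2, ← Finset.sum_div]
      congr 1
      have h3 := Finset.add_sum_erase _ p (Finset.mem_univ j)
      rw [hPR.prob.2] at h3
      linarith
    rw [h1]
    simp [w]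
  have hz0 : 0 ≤ z := by linarith
  have hE := sum_mul_weighted_pow_le hPR hrev hpos hα hgap hw hz0 hzw hsum (by norm_num) hw2
    hQ hQ0 hν m
  rw [← h.integral_prod] at hE
  have hint : Integrable (fun ω => ∏ s ∈ Finset.range (m + 1), w (X s ω)) μ := by
    refine Integrable.of_bound (C := 2 ^ (m + 1)) ?_ (Filter.Eventually.of_forall fun ω => ?_)
    · exact (Finset.measurable_prod _ fun s _ =>
        (measurable_of_finite w).comp (h.measurable s)).aestronglyMeasurable
    · rw [Real.norm_eq_abs, Finset.abs_prod]
      refine (Finset.prod_le_prod (fun _ _ => abs_nonneg _)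
        fun s _ => (abs_of_pos (hw _)).le.trans (hw2 _)).trans ?_
      simp
  have hmk := mul_meas_ge_le_integral_of_nonneg (μ := μ)
    (f := fun ω => ∏ s ∈ Finset.range (m + 1), w (X s ω))
    (Filter.Eventually.of_forall fun ω => Finset.prod_nonneg fun s _ => (hw _).le) hint
    (Real.exp e)
  have hsub : {ω | e ≤ c * visits X m j ω} ⊆
      {ω | Real.exp e ≤ ∏ s ∈ Finset.range (m + 1), w (X s ω)} := fun ω hω => by
    refine (Real.exp_le_exp.2 hω).trans ?_
    rw [visits, Finset.mul_sum, Real.exp_sum]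
    refine Finset.prod_le_prod (fun _ _ => (Real.exp_pos _).le) fun s _ => ?_
    simp only [w]
    split_ifs
    · simpa using hc
    · simp
  have hzm : z ^ m ≤ Real.exp (m * (p j * a + 2 * p j * a ^ 2 / α)) := by
    rw [Real.exp_nat_mul]
    refine pow_le_pow_left₀ hz0 ?_ m
    have := Real.add_one_le_exp (p j * a + 2 * p j * a ^ 2 / α)
    rw [hz]
    linarith
  calc μ.real {ω | e ≤ c * visits X m j ω} ≤ _ := measureReal_mono hsub
    _ ≤ (Q * 2 * z ^ m) / Real.exp e := by
        rw [le_div_iff₀ (Real.exp_pos _), mul_comm]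
        exact hmk.trans hE
    _ ≤ _ := by
        rw [Real.exp_sub, ← mul_div_assoc]
        gcongr ?_ / _
        calc _ ≤ Q * 2 * Real.exp (m * (p j * a + 2 * p j * a ^ 2 / α)) := by gcongr
          _ = _ := by ring

/-- The choice of the weight in the Chernoff bound: `a` is proportional to the deviation `γ` over
the variance proxy `r`, but not larger than `α / 2`. -/
lemma exists_tilt {α r γ η : ℝ} (hα : 0 < α) (hr : 0 < r) (hη : 0 < η)
    (h1 : η ≤ γ) (h2 : η * r ≤ γ ^ 2) :
    ∃ a, 0 < a ∧ a ≤ α / 2 ∧ 8 * r * a ^ 2 / α ≤ γ * a ∧ α * η / 8 ≤ γ * a := by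
  have hγ : 0 < γ := hη.trans_le h1
  refine ⟨α * min (1 / 2) (γ / (8 * r)), by positivity, ?_, ?_, ?_⟩
  · have := min_le_left (1 / 2) (γ / (8 * r))
    nlinarith
  · set b := min (1 / 2) (γ / (8 * r)) with hb
    have hb0 : 0 < b := by positivity
    have : b ≤ γ / (8 * r) := min_le_right _ _
    rw [le_div_iff₀ (by positivity)] at this
    have e : 8 * r * (α * b) ^ 2 / α = b * (8 * r) * (α * b) := by field_simp
    rw [e]
    gcongr
  · rcases min_choice (1 / 2) (γ / (8 * r)) with h | h <;> rw [h]
    · nlinarith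
    · have e : γ * (α * (γ / (8 * r))) = α * (γ ^ 2 / r) / 8 := by field_simp
      rw [e]
      gcongr
      rwa [le_div_iff₀ hr]

/-- Two-sided deviation bound of Bernstein type for the number of visits to a vertex. -/
lemma IsRandomWalk.measure_abs_visits_sub_ge_le [IsProbabilityMeasure μ] (h : IsRandomWalk μ P ν X)
    (hν : ν ∈ stdSimplex ℝ (Fin n)) (hPR : IsPageRank P p) (hrev : IsReversible P p)
    (hpos : ∀ i, 0 < p i) (hα : 0 < α) (hgap : α ≤ spectralGap P) {Q : ℝ}
    (hQ : ∀ i, (p i)⁻¹ ≤ Q ^ 2) (hQ0 : 0 ≤ Q) (m : ℕ) (j : Fin n) {γ η : ℝ} (hη : 0 < η)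
    (h1 : η ≤ γ) (h2 : η * p j ≤ γ ^ 2) :
    μ.real {ω | m * γ ≤ |visits X m j ω - m * p j|} ≤ 4 * Q * Real.exp (-(m * (α * η / 64))) := by
  have hα1 := hgap.trans (spectralGap_le_one P)
  have hγ : 0 < γ := hη.trans_le h1
  have hp := hpos j
  obtain ⟨a, ha0, ha1, ha2, ha3⟩ := exists_tilt hα hp hη h1 h2
  have hpa : p j * a ^ 2 ≤ p j * a ^ 2 / α := by
    rw [le_div_iff₀ hα]
    exact mul_le_of_le_one_right (by positivity) hα1
  have ha2' : 8 * (p j * a ^ 2 / α) ≤ γ * a := by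
    refine le_trans (le_of_eq ?_) ha2
    ring
  have e2 : 2 * p j * a ^ 2 / α = 2 * (p j * a ^ 2 / α) := by ring
  have hup : μ.real {ω | (a - a ^ 2) * (m * (p j + γ)) ≤ (a - a ^ 2) * visits X m j ω} ≤
      2 * Q * Real.exp (-(m * (α * η / 64))) := by
    refine (h.measure_visits_le hν hPR hrev hpos hα hgap hQ hQ0 m j (a := a)
      (by rwa [abs_of_pos ha0]) ?_).trans ?_
    · -- `a - a² ≤ ln (1 + a)`
      rw [← Real.le_log_iff_exp_le (by linarith)]
      refine le_trans ?_ (Real.one_sub_inv_le_log_of_pos (by linarith))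
      have : 0 < 1 + a := by linarith
      have e : 1 - (1 + a)⁻¹ = a / (1 + a) := by field_simp; ring
      rw [e, le_div_iff₀ this]
      nlinarith [pow_pos ha0 3]
    · gcongr
      rw [e2]
      have h3 : γ * a ^ 2 ≤ γ * a / 2 := by nlinarith [mul_pos hγ ha0]
      have h4 : p j * a + 2 * (p j * a ^ 2 / α) - (a - a ^ 2) * (p j + γ) ≤ -(α * η / 64) := by
        nlinarith
      calc _ = m * (p j * a + 2 * (p j * a ^ 2 / α) - (a - a ^ 2) * (p j + γ)) := by ring
        _ ≤ m * (-(α * η / 64)) := by gcongr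
        _ = _ := by ring
  have hlow : μ.real {ω | (-a - 2 * a ^ 2) * (m * (p j - γ)) ≤
      (-a - 2 * a ^ 2) * visits X m j ω} ≤ 2 * Q * Real.exp (-(m * (α * η / 64))) := by
    refine (h.measure_visits_le hν hPR hrev hpos hα hgap hQ hQ0 m j (a := -a)
      (by rwa [abs_neg, abs_of_pos ha0]) ?_).trans ?_
    · -- `-a - 2 a² ≤ ln (1 - a)`
      rw [← Real.le_log_iff_exp_le (by linarith)]
      refine le_trans ?_ (Real.one_sub_inv_le_log_of_pos (by linarith))
      have : 0 < 1 + -a := by linarith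
      have e : 1 - (1 + -a)⁻¹ = -a / (1 + -a) := by field_simp; ring
      rw [e, le_div_iff₀ this]
      nlinarith [mul_nonneg (sq_nonneg a) (by linarith : 0 ≤ 1 - 2 * a)]
    · gcongr
      rw [neg_sq, e2]
      have h4 : p j * -a + 2 * (p j * a ^ 2 / α) - (-a - 2 * a ^ 2) * (p j - γ) ≤
          -(α * η / 64) := by
        nlinarith [mul_pos hγ (pow_pos ha0 2)]
      calc _ = m * (p j * -a + 2 * (p j * a ^ 2 / α) - (-a - 2 * a ^ 2) * (p j - γ)) := by ring
        _ ≤ m * (-(α * η / 64)) := by gcongr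
        _ = _ := by ring
  have hsub : {ω | m * γ ≤ |visits X m j ω - m * p j|} ⊆
      {ω | (a - a ^ 2) * (m * (p j + γ)) ≤ (a - a ^ 2) * visits X m j ω} ∪
      {ω | (-a - 2 * a ^ 2) * (m * (p j - γ)) ≤ (-a - 2 * a ^ 2) * visits X m j ω} := by
    intro ω hω
    rcases le_abs'.1 (show m * γ ≤ |visits X m j ω - m * p j| from hω) with h5 | h5
    · right
      have : visits X m j ω ≤ m * (p j - γ) := by linarith
      exact mul_le_mul_of_nonpos_left this (by nlinarith)
    · left
      have : m * (p j + γ) ≤ visits X m j ω := by linarith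
      exact mul_le_mul_of_nonneg_left this (by nlinarith)
  refine (measureReal_mono hsub).trans ((measureReal_union_le _ _).trans ?_)
  linarith

/-- Deviations of size `√(η pⱼ) + η` in each coordinate, for nonnegative vectors of mass at most
`2` and `1`, give a Euclidean distance of order `√η`, with no dependence on the dimension. -/
lemma norm_vec2_sub_sq_le {x p : Fin n → ℝ} {η : ℝ} (hη : 0 < η) (hx : ∀ j, 0 ≤ x j)
    (hx1 : ∑ j, x j ≤ 2) (hp : p ∈ stdSimplex ℝ (Fin n))
    (h : ∀ j, |x j - p j| ≤ Real.sqrt (η * p j) + η) : ‖vec2 x - vec2 p‖ ^ 2 ≤ 7 * η := by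
  have h1 : ∀ j, (x j - p j) ^ 2 ≤ η * p j + 2 * η * (x j + p j) := fun j => by
    have h2 := Real.sq_sqrt (mul_nonneg hη.le (hp.1 j))
    have h3 : |x j - p j| ≤ x j + p j := by
      rw [abs_le]
      constructor <;> linarith [hx j, hp.1 j]
    have h4 := h j
    rw [← sq_abs]
    nlinarith [sq_nonneg (|x j - p j| - Real.sqrt (η * p j)), abs_nonneg (x j - p j)]
  rw [EuclideanSpace.norm_sq_eq]
  calc _ ≤ ∑ j, (η * p j + 2 * η * (x j + p j)) := Finset.sum_le_sum fun j _ => by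
        rw [Real.norm_eq_abs, sq_abs]
        exact h1 j
    _ = η + 2 * η * (∑ j, x j + 1) := by
        rw [Finset.sum_add_distrib, ← Finset.mul_sum, ← Finset.mul_sum, Finset.sum_add_distrib,
          hp.2, mul_one]
    _ ≤ 7 * η := by nlinarith

lemma sum_posVec_eq_vec2 (s : Finset ℕ) (x : ℕ → Fin n) :
    ∑ t ∈ s, posVec (x t) = vec2 (fun j => ∑ t ∈ s, if x t = j then 1 else 0) := by
  ext j
  simp only [WithLp.ofLp_sum, Finset.sum_apply, vec2_apply, posVec_apply]
  exact Finset.sum_congr rfl fun t _ => by simp only [eq_comm]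

/-- The visits counted by the estimator are those of the walk from time `b` on; there is one more
of them than the number `m` by which the counts are divided. -/
lemma visitAverage_eq {Ω' : Type*} (b m : ℕ) (X : ℕ → Ω' → Fin n) (ω : Ω') :
    visitAverage (b + 1) (b + 1 + m) (fun t => X t ω) =
      vec2 (fun j => (m : ℝ)⁻¹ * visits (fun s => X (b + s)) m j ω) := by
  have h1 : (Finset.range (b + 1 + m)).filter (fun t => b + 1 ≤ t + 1) =
      (Finset.range (m + 1)).map (addLeftEmbedding b) := by
    ext t
    simp only [Finset.mem_filter, Finset.mem_range, Finset.mem_map, addLeftEmbedding_apply]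
    constructor
    · rintro ⟨h1, h2⟩
      exact ⟨t - b, by omega, by omega⟩
    · rintro ⟨s, hs, rfl⟩
      omega
  rw [visitAverage, h1, Finset.sum_map, sum_posVec_eq_vec2 (Finset.range (m + 1))
    (fun s => X (addLeftEmbedding b s) ω)]
  ext j
  simp [vec2_apply, visits]

/-- Accuracy of the single-walk estimator. The Markov property moves the starting time to the end of
the burn-in; a union bound over the vertices then combines the deviations of the visits. -/
lemma IsRandomWalk.measure_visitAverage_ge [IsProbabilityMeasure μ] (h : IsRandomWalk μ P ν X)
    (hν : ν ∈ stdSimplex ℝ (Fin n)) (hPR : IsPageRank P p) (hrev : IsReversible P p)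
    (hpos : ∀ i, 0 < p i) (hα : 0 < α) (hgap : α ≤ spectralGap P) {Q : ℝ}
    (hQ : ∀ i, (p i)⁻¹ ≤ Q ^ 2) (hQ0 : 0 ≤ Q) {T₀ T : ℕ} (hT₀ : 1 ≤ T₀) (hT : T₀ < T) {ε σ : ℝ}
    (hε : 0 < ε) (hσ : n * (4 * Q * Real.exp (-(((T : ℝ) - T₀) * (α * ε ^ 2 / 448)))) ≤ σ) :
    1 - σ ≤ μ.real {ω | ‖visitAverage T₀ T (fun t => X t ω) - vec2 p‖ ≤ ε} := by
  obtain ⟨b, rfl⟩ : ∃ b, T₀ = b + 1 := ⟨T₀ - 1, by omega⟩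
  obtain ⟨m, rfl⟩ : ∃ m, T = b + 1 + m := ⟨T - (b + 1), by omega⟩
  have hm : 1 ≤ m := by omega
  have hm' : (1 : ℝ) ≤ m := by exact_mod_cast hm
  have e1 : ((b + 1 + m : ℕ) : ℝ) - (b + 1 : ℕ) = m := by push_cast; ring
  rw [e1] at hσ
  -- `7 * η` bounds the squared error when all coordinates deviate by at most `√(η pⱼ) + η`
  set η := ε ^ 2 / 7 with hη
  have hη0 : 0 < η := by positivity
  have hY := h.shift b
  have hν' := vecMul_pow_mem_stdSimplex hPR.stochastic hν b
  set Y : ℕ → Ω → Fin n := fun s => X (b + s) with hYdef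
  set γ : Fin n → ℝ := fun j => Real.sqrt (η * p j) + η with hγ
  have hbad : ∀ j, μ.real {ω | m * γ j ≤ |visits Y m j ω - m * p j|} ≤
      4 * Q * Real.exp (-(m * (α * ε ^ 2 / 448))) := fun j => by
    have hs := Real.sqrt_nonneg (η * p j)
    have e2 : α * ε ^ 2 / 448 = α * η / 64 := by rw [hη]; ring
    rw [e2]
    refine hY.measure_abs_visits_sub_ge_le hν' hPR hrev hpos hα hgap hQ hQ0 m j hη0
      (by simp only [hγ]; linarith) ?_
    rw [← Real.sq_sqrt (mul_nonneg hη0.le (hpos j).le)]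
    simp only [hγ]
    gcongr
    linarith
  have hcov : (Set.univ : Set Ω) ⊆
      {ω | ‖visitAverage (b + 1) (b + 1 + m) (fun t => X t ω) - vec2 p‖ ≤ ε} ∪
      ⋃ j, {ω | m * γ j ≤ |visits Y m j ω - m * p j|} := by
    intro ω _
    by_cases hω : ∃ j, m * γ j ≤ |visits Y m j ω - m * p j|
    · right
      simpa using hω
    · left
      push Not at hω
      have hm0 : (0 : ℝ) < m := by linarith
      have h1 : ‖visitAverage (b + 1) (b + 1 + m) (fun t => X t ω) - vec2 p‖ ^ 2 ≤ 7 * η := by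
        rw [visitAverage_eq]
        refine norm_vec2_sub_sq_le hη0 (fun j => ?_) ?_ hPR.prob fun j => ?_
        · exact mul_nonneg (by positivity) (Finset.sum_nonneg fun s _ => by
            split_ifs <;> norm_num)
        · rw [← Finset.mul_sum]
          have : ∑ j, visits Y m j ω = m + 1 := by
            simp only [visits]
            rw [Finset.sum_comm]
            simp
          rw [this, inv_mul_le_iff₀ hm0]
          linarith
        · have e3 : (m : ℝ)⁻¹ * visits Y m j ω - p j = (m : ℝ)⁻¹ * (visits Y m j ω - m * p j) := by
            field_simp
          rw [e3, abs_mul, abs_of_pos (inv_pos.2 hm0), inv_mul_le_iff₀ hm0]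
          exact (hω j).le
      have h2 : ‖visitAverage (b + 1) (b + 1 + m) (fun t => X t ω) - vec2 p‖ ^ 2 ≤ ε ^ 2 := by
        refine h1.trans (le_of_eq ?_)
        rw [hη]; ring
      exact le_of_sq_le_sq h2 hε.le
  have h3 := (measureReal_mono hcov (measure_ne_top μ _)).trans (measureReal_union_le _ _)
  rw [probReal_univ] at h3
  have h4 : μ.real (⋃ j, {ω | m * γ j ≤ |visits Y m j ω - m * p j|}) ≤ σ := by
    refine (measureReal_iUnion_fintype_le _).trans ((Finset.sum_le_sum fun j _ => hbad j).trans ?_)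
    simpa using hσ
  linarith

end SingleWalk

/-! ### Sampling from a stored row -/

section RowTables

variable {n : ℕ} {s : State} {i : ℕ} {q : Fin n → ℝ}

/-- The first cell of row `i` whose cumulative probability exceeds `x`, or the last cell if there
is none. -/
noncomputable def rowCell (s : State) (i : ℕ) (x : ℝ) : ℕ :=
  sInf {a | s.iarr .first i ≤ a ∧ (s.iarr .last i ≤ a + 1 ∨ x < s.rarr .cum a)}

lemma StoresRow.first_lt_last (h : StoresRow s i q) (hq : q ∈ stdSimplex ℝ (Fin n)) :
    s.iarr .first i < s.iarr .last i := by
  by_contra hcon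
  have hne : ∃ j, 0 < q j := by
    by_contra! hneg
    have : ∑ j, q j ≤ 0 := Finset.sum_nonpos fun j _ => hneg j
    linarith [hq.2]
  obtain ⟨j, hj⟩ := hne
  obtain ⟨a, ha, -⟩ := h.bij.surjOn ⟨j.2, hj⟩
  simp only [Set.mem_Ico] at ha
  omega

/-- Probability of the vertex listed in a cell. -/
noncomputable def cellProb (s : State) (q : Fin n → ℝ) (b : ℕ) : ℝ :=
  if h : s.iarr .nbr b < n then q ⟨s.iarr .nbr b, h⟩ else 0

lemma StoresRow.cellProb_pos (h : StoresRow s i q) {b : ℕ}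
    (hb : b ∈ Set.Ico (s.iarr .first i) (s.iarr .last i)) : 0 < cellProb s q b := by
  obtain ⟨h1, h2⟩ := h.bij.mapsTo hb
  simpa [cellProb, h1] using h2

lemma StoresRow.cum_mono (h : StoresRow s i q) {a b : ℕ} (ha : s.iarr .first i ≤ a)
    (hab : a ≤ b) (hb : b < s.iarr .last i) : s.rarr .cum a ≤ s.rarr .cum b := by
  rw [h.cumulative a ⟨ha, by omega⟩, h.cumulative b ⟨by omega, hb⟩]
  refine Finset.sum_le_sum_of_subset_of_nonneg (Finset.Icc_subset_Icc_right hab) fun c hc _ => ?_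
  rw [Finset.mem_Icc] at hc
  exact (h.cellProb_pos ⟨hc.1, by omega⟩).le

lemma StoresRow.cum_eq (h : StoresRow s i q) {a : ℕ}
    (ha : a ∈ Set.Ico (s.iarr .first i) (s.iarr .last i)) :
    s.rarr .cum a = (∑ b ∈ Finset.Ico (s.iarr .first i) a, cellProb s q b) + cellProb s q a := by
  rw [h.cumulative a ha, ← Finset.Ico_add_one_right_eq_Icc, Finset.sum_Ico_succ_top ha.1]
  rfl

lemma StoresRow.sum_cellProb (h : StoresRow s i q) (hq : q ∈ stdSimplex ℝ (Fin n)) :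
    ∑ b ∈ Finset.Ico (s.iarr .first i) (s.iarr .last i), cellProb s q b = 1 := by
  rw [← hq.2, ← Finset.sum_filter_of_ne (p := fun j => 0 < q j)
    fun j _ hj => lt_of_le_of_ne (hq.1 j) hj.symm]
  refine Finset.sum_bij (fun b hb => ⟨s.iarr .nbr b, ?_⟩) (fun b hb => ?_) (fun b hb c hc hbc => ?_)
    (fun j hj => ?_) (fun b hb => ?_)
  · exact (h.bij.mapsTo (by simpa using hb)).1
  · obtain ⟨h1, h2⟩ := h.bij.mapsTo (by simpa using hb)
    simpa using h2
  · exact h.bij.injOn (by simpa using hb) (by simpa using hc) (by simpa using hbc)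
  · have hj' : (j : ℕ) ∈ {j | ∃ h : j < n, 0 < q ⟨j, h⟩} := ⟨j.2, (Finset.mem_filter.1 hj).2⟩
    obtain ⟨a, ha, haj⟩ := h.bij.surjOn hj'
    exact ⟨a, Finset.mem_Ico.2 ha, Fin.ext haj⟩
  · obtain ⟨h1, h2⟩ := h.bij.mapsTo (by simpa using hb)
    simp [cellProb, h1]

/-- A cell in which the binary search may stop is the cell `rowCell`. -/
lemma StoresRow.eq_rowCell (h : StoresRow s i q) {x : ℝ} {a : ℕ}
    (ha : a ∈ Set.Ico (s.iarr .first i) (s.iarr .last i))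
    (h1 : a = s.iarr .first i ∨ s.rarr .cum (a - 1) ≤ x)
    (h2 : a + 1 = s.iarr .last i ∨ x < s.rarr .cum a) : a = rowCell s i x := by
  have hmem : a ∈ {a | s.iarr .first i ≤ a ∧ (s.iarr .last i ≤ a + 1 ∨ x < s.rarr .cum a)} :=
    ⟨ha.1, h2.imp_left Eq.ge⟩
  refine le_antisymm (le_csInf ⟨a, hmem⟩ fun b hb => ?_) (Nat.sInf_le hmem)
  by_contra hcon
  have hlt : b < a := by omega
  have hb1 := hb.1
  have ha2 := ha.2
  rcases h1 with h1 | h1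
  · omega
  rcases hb.2 with h3 | h3
  · omega
  · have := h.cum_mono hb1 (show b ≤ a - 1 by omega) (by omega)
    linarith

lemma StoresRow.rowCell_mem (h : StoresRow s i q) (hq : q ∈ stdSimplex ℝ (Fin n)) (x : ℝ) :
    rowCell s i x ∈ Set.Ico (s.iarr .first i) (s.iarr .last i) ∧
    (rowCell s i x + 1 = s.iarr .last i ∨ x < s.rarr .cum (rowCell s i x)) ∧
    (∀ b, s.iarr .first i ≤ b → b < rowCell s i x → s.rarr .cum b ≤ x) := by
  have hfl := h.first_lt_last hq
  have hmem : s.iarr .last i - 1 ∈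
      {a | s.iarr .first i ≤ a ∧ (s.iarr .last i ≤ a + 1 ∨ x < s.rarr .cum a)} :=
    ⟨by omega, Or.inl (by omega)⟩
  have h1 := Nat.sInf_mem ⟨_, hmem⟩
  have h2 := Nat.sInf_le hmem
  change rowCell s i x ∈ _ at h1
  change rowCell s i x ≤ _ at h2
  refine ⟨⟨h1.1, by omega⟩, h1.2.imp_left fun h3 => by omega, fun b hb hlt => ?_⟩
  by_contra hcon
  have := Nat.sInf_le (s := {a | s.iarr .first i ≤ a ∧ (s.iarr .last i ≤ a + 1 ∨
    x < s.rarr .cum a)}) ⟨hb, Or.inr (not_le.1 hcon)⟩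
  change rowCell s i x ≤ b at this
  omega

/-- A table row together with a uniform random number realizes the stored law. -/
lemma StoresRow.exists_sampler (h : StoresRow s i q) (hq : q ∈ stdSimplex ℝ (Fin n)) :
    ∃ f : unitInterval → Fin n, (∀ x, (f x : ℕ) = s.iarr .nbr (rowCell s i x)) ∧
      (∀ j, MeasurableSet {x | f x = j}) ∧ ∀ j, volume.real {x | f x = j} = q j := by
  refine ⟨fun x => ⟨s.iarr .nbr (rowCell s i x), (h.bij.mapsTo (h.rowCell_mem hq x).1).1⟩,
    fun _ => rfl, ?_⟩
  rw [← forall_and]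
  intro j
  rcases (hq.1 j).eq_or_lt with hj | hj
  · have : {x : unitInterval | (⟨s.iarr .nbr (rowCell s i x),
        (h.bij.mapsTo (h.rowCell_mem hq x).1).1⟩ : Fin n) = j} = ∅ := by
      ext x
      simp only [Set.mem_ofPred_eq, Set.mem_empty_iff_false, iff_false]
      intro hx
      obtain ⟨h1, h2⟩ := h.bij.mapsTo (h.rowCell_mem hq x).1
      rw [hx] at h2
      exact h2.ne hj
    rw [this]
    simp [← hj]
  · obtain ⟨a, ha, haj⟩ := h.bij.surjOn ⟨j.2, hj⟩
    have hset : ∀ x : unitInterval, (⟨s.iarr .nbr (rowCell s i x),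
        (h.bij.mapsTo (h.rowCell_mem hq x).1).1⟩ : Fin n) = j ↔ rowCell s i x = a := fun x => by
      rw [Fin.ext_iff]
      constructor
      · intro hx
        exact h.bij.injOn (h.rowCell_mem hq x).1 ha (hx.trans haj.symm)
      · rintro hx
        simp only [hx, haj]
    simp only [hset]
    set lo := ∑ b ∈ Finset.Ico (s.iarr .first i) a, cellProb s q b with hlo
    have hcell : cellProb s q a = q j := by
      have h1 : s.iarr .nbr a < n := by rw [haj]; exact j.2
      rw [cellProb, dif_pos h1]
      congr 1
      exact Fin.ext haj
    have hcum : s.rarr .cum a = lo + q j := by rw [h.cum_eq ha, hcell]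
    have hlo0 : 0 ≤ lo := Finset.sum_nonneg fun b hb => by
      rw [Finset.mem_Ico] at hb
      exact (h.cellProb_pos ⟨hb.1, hb.2.trans ha.2⟩).le
    have hhi1 : lo + q j ≤ 1 := by
      rw [← h.sum_cellProb hq, hlo, ← hcell, ← Finset.sum_Ico_succ_top ha.1]
      refine Finset.sum_le_sum_of_subset_of_nonneg
        (Finset.Ico_subset_Ico_right (Nat.succ_le_of_lt ha.2)) fun b hb _ => ?_
      exact (h.cellProb_pos (by simpa using hb)).le
    let l : unitInterval := ⟨lo, hlo0, by linarith⟩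
    let r : unitInterval := ⟨lo + q j, by linarith, hhi1⟩
    have hprev : s.iarr .first i < a → s.rarr .cum (a - 1) = lo := fun hfa => by
      rw [h.cum_eq ⟨by omega, (by have := ha.2; omega)⟩, hlo,
        ← Finset.sum_Ico_succ_top (by omega : s.iarr .first i ≤ a - 1)]
      congr 2
      omega
    -- the set of numbers that lead to the cell `a` is an interval up to its right end point
    have hsub1 : Set.Ico l r ⊆ {x : unitInterval | rowCell s i x = a} := fun x hx => by
      refine (h.eq_rowCell ha ?_ (Or.inr ?_)).symm
      · rcases ha.1.eq_or_lt with hfa | hfa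
        · exact Or.inl hfa.symm
        · right
          rw [hprev hfa]
          exact hx.1
      · rw [hcum]
        exact hx.2
    have hsub2 : {x : unitInterval | rowCell s i x = a} ⊆ Set.Icc l r := fun x hx => by
      have hx' : rowCell s i x = a := hx
      obtain ⟨h1, h2, h3⟩ := h.rowCell_mem hq x
      rw [hx'] at h2 h3
      constructor
      · change lo ≤ x
        rcases ha.1.eq_or_lt with hfa | hfa
        · rw [hlo, hfa]
          simpa using x.2.1
        · rw [← hprev hfa]
          exact h3 _ (by omega) (by omega)
      · change (x : ℝ) ≤ lo + q j
        rcases h2 with h2 | h2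
        · refine x.2.2.trans (le_of_eq ?_)
          rw [← h.sum_cellProb hq, ← h2, Finset.sum_Ico_succ_top ha.1, hcell]
        · rw [← hcum]
          exact h2.le
    have hae : {x : unitInterval | rowCell s i x = a} = Set.Ico l r ∪
        ({x : unitInterval | rowCell s i x = a} ∩ {r}) := by
      ext x
      constructor
      · intro hx
        rcases (hsub2 hx).2.eq_or_lt with h1 | h1
        · exact Or.inr ⟨hx, h1⟩
        · exact Or.inl ⟨(hsub2 hx).1, h1⟩
      · rintro (hx | hx)
        · exact hsub1 hx
        · exact hx.1
    have hm : MeasurableSet {x : unitInterval | rowCell s i x = a} := by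
      rw [hae]
      refine measurableSet_Ico.union (Set.Finite.measurableSet ?_)
      exact (Set.finite_singleton r).subset Set.inter_subset_right
    refine ⟨hm, le_antisymm ?_ ?_⟩
    · refine (measureReal_mono hsub2).trans (le_of_eq ?_)
      rw [measureReal_def, unitInterval.volume_Icc, ENNReal.toReal_ofReal]
      · simp [l, r]
      · simp [l, r, hj.le]
    · refine le_trans (le_of_eq ?_) (measureReal_mono hsub1)
      rw [measureReal_def, unitInterval.volume_Ico, ENNReal.toReal_ofReal]
      · simp [l, r]
      · simp [l, r, hj.le]

end RowTables

/-! ### Random walks driven by the tape -/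

section TapeWalks

variable {n : ℕ} {P : Matrix (Fin n) (Fin n) ℝ} {ν : Fin n → ℝ}

instance : IsProbabilityMeasure tapeMeasure := by
  unfold tapeMeasure; infer_instance

lemma tapeMeasure_real_box (A : ℕ → Set unitInterval) (hA : ∀ s, MeasurableSet (A s)) (t : ℕ) :
    tapeMeasure.real {u | ∀ s < t, u s ∈ A s} = ∏ s ∈ Finset.range t, volume.real (A s) := by
  have h := Measure.infinitePi_pi (μ := fun _ : ℕ => (volume : Measure unitInterval))
    (s := Finset.range t) (t := A) (fun s _ => hA s)
  have h2 : {u : Tape | ∀ s < t, u s ∈ A s} = Set.pi (Finset.range t) A := by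
    ext u
    simp
  rw [h2, tapeMeasure, measureReal_def, h, ENNReal.toReal_prod]
  rfl

/-- The walk from `i` in which step `t` is made with the random number `u t`. -/
def tapeWalk (step : Fin n → unitInterval → Fin n) (i : Fin n) (u : Tape) : ℕ → Fin n
  | 0 => i
  | t + 1 => step (tapeWalk step i u t) (u t)

lemma tapeWalk_congr (step : Fin n → unitInterval → Fin n) (i : Fin n) {u v : Tape} {t : ℕ}
    (h : ∀ s < t, u s = v s) : tapeWalk step i u t = tapeWalk step i v t := by
  induction t with
  | zero => rfl
  | succ t ih => rw [tapeWalk, tapeWalk, ih fun s hs => h s (by omega), h t (by omega)]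

lemma tapeWalk_eq_iff (step : Fin n → unitInterval → Fin n) (i : Fin n) (u : Tape) (t : ℕ)
    (x : ℕ → Fin n) : (∀ s ≤ t, tapeWalk step i u s = x s) ↔
      i = x 0 ∧ ∀ s < t, step (x s) (u s) = x (s + 1) := by
  constructor
  · intro h
    refine ⟨h 0 (by omega), fun s hs => ?_⟩
    rw [← h (s + 1) (by omega), ← h s (by omega)]
    rfl
  · rintro ⟨h0, h⟩ s hs
    induction s with
    | zero => exact h0
    | succ s ih => rw [tapeWalk, ih (by omega), h s (by omega)]

lemma measurable_of_forall_measurableSet_eq {α : Type*} [MeasurableSpace α] {f : α → Fin n}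
    (h : ∀ j, MeasurableSet {x | f x = j}) : Measurable f :=
  measurable_to_countable' h

lemma measurable_tapeWalk {α : Type*} [MeasurableSpace α] {step : Fin n → unitInterval → Fin n}
    (hm : ∀ i j, MeasurableSet {x | step i x = j})
    {f : α → Fin n} (hf : Measurable f) {v : α → Tape} (hv : Measurable v) (t : ℕ) :
    Measurable fun u => tapeWalk step (f u) (v u) t := by
  induction t with
  | zero => exact hf
  | succ t ih =>
    have h1 : Measurable fun z : Fin n × unitInterval => step z.1 z.2 :=
      measurable_from_prod_countable_right fun i => measurable_of_forall_measurableSet_eq (hm i)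
    exact h1.comp (ih.prodMk ((measurable_pi_apply t).comp hv))

/-- The tape without its first `p` numbers is again a sequence of independent random numbers. -/
lemma map_shift_tapeMeasure (p : ℕ) :
    tapeMeasure.map (fun u s => u (p + s)) = tapeMeasure :=
  Measure.map_infinitePi_infinitePi_of_inj
    (P := fun _ : ℕ => (volume : Measure unitInterval)) (f := fun s => p + s)
    (add_right_injective p)

lemma measurable_shift_tape (p : ℕ) : Measurable (fun (u : Tape) s => u (p + s) : Tape → Tape) :=
  measurable_pi_lambda _ fun s => measurable_pi_apply (p + s)

lemma isRandomWalk_tapeWalk {step : Fin n → unitInterval → Fin n}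
    (hm : ∀ i j, MeasurableSet {x | step i x = j})
    (hP : ∀ i j, volume.real {x | step i x = j} = P i j)
    (i : Fin n) :
    IsRandomWalk tapeMeasure P (Pi.single i 1) (fun t u => tapeWalk step i u t) := by
  refine ⟨fun t => measurable_tapeWalk hm measurable_const measurable_id t, fun t x => ?_⟩
  simp only [tapeWalk_eq_iff]
  by_cases h : i = x 0
  · have := tapeMeasure_real_box (fun s => {y | step (x s) y = x (s + 1)}) (fun s => hm _ _) t
    simp only [Set.mem_ofPred_eq, hP] at this
    simp only [← h, true_and, Pi.single_eq_same, one_mul]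
    exact this
  · simp [h, Ne.symm h]

/-- A walk whose starting vertex is drawn with the first number of the tape. -/
lemma isRandomWalk_tapeWalk_start {step : Fin n → unitInterval → Fin n}
    (hm : ∀ i j, MeasurableSet {x | step i x = j})
    (hP : ∀ i j, volume.real {x | step i x = j} = P i j)
    {start : unitInterval → Fin n} (hms : ∀ j, MeasurableSet {x | start x = j})
    (hν : ∀ j, volume.real {x | start x = j} = ν j) :
    IsRandomWalk tapeMeasure P ν
      (fun t u => tapeWalk step (start (u 0)) (fun s => u (1 + s)) t) := by
  refine ⟨fun t => measurable_tapeWalk hm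
    ((measurable_of_forall_measurableSet_eq hms).comp (measurable_pi_apply 0))
    (measurable_shift_tape 1) t, fun t x => ?_⟩
  simp only [tapeWalk_eq_iff]
  have := tapeMeasure_real_box (fun s => Nat.casesOn s {y | start y = x 0}
    fun s => {y | step (x s) y = x (s + 1)}) (fun s => by cases s; exacts [hms _, hm _ _]) (t + 1)
  rw [Finset.prod_range_succ'] at this
  simp only [hP] at this
  rw [mul_comm] at this
  change _ = volume.real {y | start y = x 0} * _ at this
  rw [hν] at this
  refine Eq.trans (congrArg _ ?_) this
  ext u
  constructor
  · rintro ⟨h0, h⟩ s hs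
    cases s with
    | zero => exact h0
    | succ s =>
      have := h s (by omega)
      rwa [add_comm] at this
  · intro h
    refine ⟨h 0 (by omega), fun s hs => ?_⟩
    have := h (s + 1) (by omega)
    rw [add_comm 1 s]
    exact this

/-- The final positions of walks that use disjoint blocks of `m + 1` random numbers are an
independent sample. -/
lemma tapeMeasure_real_blocks {step : Fin n → unitInterval → Fin n}
    (hm : ∀ i j, MeasurableSet {x | step i x = j})
    (hP : ∀ i j, volume.real {x | step i x = j} = P i j)
    {start : unitInterval → Fin n} (hms : ∀ j, MeasurableSet {x | start x = j})
    (hν : ∀ j, volume.real {x | start x = j} = ν j) (p m N : ℕ) (y : Fin N → Fin n) :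
    tapeMeasure.real {u | (fun k : Fin N => tapeWalk step (start (u (p + k * (m + 1))))
      (fun s => u (p + k * (m + 1) + (1 + s))) m) = y} =
      ∏ k, Matrix.vecMul ν (P ^ m) (y k) := by
  -- the final position as a function of a block of the tape
  let g : (Fin (m + 1) → unitInterval) → Fin n := fun b =>
    tapeWalk step (start (b 0)) (fun s => b (Fin.ofNat (m + 1) (1 + s))) m
  have hg : Measurable g := measurable_tapeWalk hm
    (f := fun b : Fin (m + 1) → unitInterval => start (b 0))
    (v := fun b s => b (Fin.ofNat (m + 1) (1 + s)))
    ((measurable_of_forall_measurableSet_eq hms).comp (measurable_pi_apply 0))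
    (measurable_pi_lambda _ fun s => measurable_pi_apply _) m
  have hgw : ∀ (u : Tape) (a : ℕ), g (fun s => u (a + s)) =
      tapeWalk step (start (u a)) (fun s => u (a + (1 + s))) m := fun u a => by
    refine (tapeWalk_congr step _ fun s hs => ?_)
    simp only [Fin.val_ofNat]
    rw [Nat.mod_eq_of_lt (by omega)]
  let e : Fin N × Fin (m + 1) → ℕ := fun z => p + z.1 * (m + 1) + z.2
  have he : Function.Injective e := by
    rintro ⟨k, s⟩ ⟨k', s'⟩ h
    have h1 : (k : ℕ) * (m + 1) + s = k' * (m + 1) + s' := by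
      simp only [e] at h
      omega
    have hs := s.2
    have hs' := s'.2
    have hk : (k : ℕ) = k' := by
      rcases lt_trichotomy (k : ℕ) k' with hlt | heq | hgt
      · nlinarith
      · exact heq
      · nlinarith
    rw [hk, add_right_inj] at h1
    exact Prod.ext (Fin.ext hk) (Fin.ext h1)
  let B : Tape → Fin N → Fin (m + 1) → unitInterval := fun u k s => u (e (k, s))
  have hB : Measurable B := by
    refine measurable_pi_lambda _ fun k => measurable_pi_lambda _ fun s => measurable_pi_apply _
  have hBmap : tapeMeasure.map B = Measure.infinitePi fun _ : Fin N =>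
      Measure.infinitePi fun _ : Fin (m + 1) => (volume : Measure unitInterval) := by
    have h1 := Measure.map_infinitePi_infinitePi_of_inj
      (P := fun _ : ℕ => (volume : Measure unitInterval)) he
    have h2 := Measure.infinitePi_map_curry (ι := Fin N) (κ := Fin (m + 1))
      fun _ _ => (volume : Measure unitInterval)
    have hE : Measurable fun (u : Tape) (z : Fin N × Fin (m + 1)) => u (e z) :=
      measurable_pi_lambda _ fun z => measurable_pi_apply _
    rw [← h2, ← h1, Measure.map_map (MeasurableEquiv.measurable _) hE]
    rfl
  have hone : ∀ j, (Measure.infinitePi fun _ : Fin (m + 1) => (volume : Measure unitInterval)).real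
      {b | g b = j} = Matrix.vecMul ν (P ^ m) j := fun j => by
    rw [← (isRandomWalk_tapeWalk_start hm hP hms hν).law_eq m j]
    have h1 := Measure.map_infinitePi_infinitePi_of_inj
      (P := fun _ : ℕ => (volume : Measure unitInterval))
      (f := fun s : Fin (m + 1) => 0 + (s : ℕ))
      (fun a b hab => Fin.ext (by simpa using hab))
    have hE : Measurable fun (u : Tape) (s : Fin (m + 1)) => u (0 + (s : ℕ)) :=
      measurable_pi_lambda _ fun z => measurable_pi_apply _
    have hgj : MeasurableSet {b | g b = j} := hg (measurableSet_singleton j)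
    rw [← h1, map_measureReal_apply hE hgj]
    unfold tapeMeasure
    congr 1
    ext u
    have := hgw u 0
    simp only [zero_add] at this
    simp only [Set.preimage_ofPred_eq, Set.mem_ofPred_eq, zero_add, this]
  have hset : {u : Tape | (fun k : Fin N => tapeWalk step (start (u (p + k * (m + 1))))
      (fun s => u (p + k * (m + 1) + (1 + s))) m) = y} =
      B ⁻¹' Set.pi (Finset.univ : Finset (Fin N)) (fun k => {b | g b = y k}) := by
    ext u
    simp only [Set.mem_ofPred_eq, funext_iff, Set.mem_preimage, Set.mem_pi, Finset.coe_univ,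
      Set.mem_univ, true_imp_iff]
    refine forall_congr' fun k => ?_
    rw [← hgw]
  have hgj : ∀ j, MeasurableSet {b | g b = j} := fun j => hg (measurableSet_singleton j)
  rw [hset, ← map_measureReal_apply hB (MeasurableSet.pi (Finset.countable_toSet _)
    fun k _ => hgj _), hBmap, measureReal_def,
    Measure.infinitePi_pi _ (fun k _ => hgj _), ENNReal.toReal_prod]
  exact Finset.prod_congr rfl fun k _ => hone (y k)

end TapeWalks

/-! ### Runs of the elementary parts of the programs -/

section Machine

variable {n : ℕ} {P : Matrix (Fin n) (Fin n) ℝ} {q : Fin n → ℝ} {u : Tape} {s s' s'' : State}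

lemma Runs.congr_cost {p : Prog} {c c' : ℕ} (h : Runs u p s s' c) (hc : c = c') :
    Runs u p s s' c' := hc ▸ h

/-- `s'` arises from `s` without changes of the arrays, except possibly the answer array. -/
structure SameTables (s s' : State) : Prop where
  iarr : s'.iarr = s.iarr
  cum : s'.rarr .cum = s.rarr .cum

lemma SameTables.refl (s : State) : SameTables s s := ⟨rfl, rfl⟩

lemma SameTables.trans (h : SameTables s s') (h' : SameTables s' s'') : SameTables s s'' :=
  ⟨h'.iarr.trans h.iarr, h'.cum.trans h.cum⟩

lemma StoresRow.congr {i : ℕ} (h : StoresRow s i q) (hs : SameTables s s') : StoresRow s' i q := by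
  refine ⟨?_, ?_⟩
  · rw [hs.iarr]; exact h.bij
  · rw [hs.iarr, hs.cum]; exact h.cumulative

lemma SameTables.rowCell_eq (hs : SameTables s s') (i : ℕ) (x : ℝ) :
    rowCell s' i x = rowCell s i x := by
  unfold rowCell
  rw [hs.iarr, hs.cum]

/-- The part of the memory that a random transition leaves unchanged. -/
structure MoveFrame (s s' : State) : Prop where
  iarr : s'.iarr = s.iarr
  rarr : s'.rarr = s.rarr
  ireg : ∀ r, r ≠ .v → r ≠ .lo → r ≠ .hi → r ≠ .mid → s'.ireg r = s.ireg r
  rreg : ∀ r, r ≠ .u → r ≠ .c → s'.rreg r = s.rreg r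

lemma MoveFrame.sameTables (h : MoveFrame s s') : SameTables s s' :=
  ⟨h.iarr, by rw [h.rarr]⟩

lemma MoveFrame.trans (h : MoveFrame s s') (h' : MoveFrame s' s'') : MoveFrame s s'' :=
  ⟨h'.iarr.trans h.iarr, h'.rarr.trans h.rarr,
    fun r h1 h2 h3 h4 => (h'.ireg r h1 h2 h3 h4).trans (h.ireg r h1 h2 h3 h4),
    fun r h1 h2 => (h'.rreg r h1 h2).trans (h.rreg r h1 h2)⟩

/-- The loop of the binary search. -/
def searchProg : Prog :=
  .whileLt .lo .hi (.block
    [ .op (.iadd .mid .lo .hi),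
      .op (.ihalf .mid .mid),
      .op (.rload .c .cum .mid),
      .ifRLt .u .c
        (.op (.icopy .hi .mid))
        (.op (.iadd .lo .mid .one)) ])

/-- Binary search among at most `2 ^ L` cells: at most `L` rounds. The search stops in a cell whose
predecessor has cumulative probability at most `u`, unless it is the first cell, and whose own
cumulative probability exceeds `u`, unless it is the last cell. -/
lemma runs_searchProg (u : Tape) (L : ℕ) (s : State) (h1 : s.ireg .one = 1)
    (hle : s.ireg .lo ≤ s.ireg .hi) (hlt : s.ireg .hi - s.ireg .lo < 2 ^ L) :
    ∃ s' c, Runs u searchProg s s' c ∧ c ≤ 6 * L + 1 ∧ MoveFrame s s' ∧ s'.pos = s.pos ∧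
      s'.ireg .v = s.ireg .v ∧ s'.rreg .u = s.rreg .u ∧
      s.ireg .lo ≤ s'.ireg .lo ∧ s'.ireg .lo ≤ s.ireg .hi ∧
      (s'.ireg .lo = s.ireg .lo ∨ s.rarr .cum (s'.ireg .lo - 1) ≤ s.rreg .u) ∧
      (s'.ireg .lo = s.ireg .hi ∨ s.rreg .u < s.rarr .cum (s'.ireg .lo)) := by
  induction L generalizing s with
  | zero =>
    exact ⟨s, 1, .while_done (by omega), by omega,
      ⟨rfl, rfl, fun _ _ _ _ _ => rfl, fun _ _ _ => rfl⟩, rfl, rfl, rfl, le_rfl, hle, Or.inl rfl,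
      Or.inl (by omega)⟩
  | succ L ih =>
    by_cases hlh : s.ireg .lo < s.ireg .hi
    swap
    · exact ⟨s, 1, .while_done hlh, by omega,
        ⟨rfl, rfl, fun _ _ _ _ _ => rfl, fun _ _ _ => rfl⟩, rfl, rfl, rfl, le_rfl, hle, Or.inl rfl,
        Or.inl (by omega)⟩
    set mid := (s.ireg .lo + s.ireg .hi) / 2 with hmid
    let s₁ := (((s.setI .mid (s.ireg .lo + s.ireg .hi)).setI .mid mid).setR .c (s.rarr .cum mid))
    have hfr₁ : MoveFrame s s₁ := by
      refine ⟨rfl, rfl, fun r _ _ _ h4 => ?_, fun r _ h2 => ?_⟩ <;>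
        simp_all [s₁, State.setI, State.setR, Function.update]
    have hu₁ : s₁.rreg .u = s.rreg .u := by simp [s₁, State.setI, State.setR, Function.update]
    have hv₁ : s₁.ireg .v = s.ireg .v := by simp [s₁, State.setI, State.setR, Function.update]
    have hc₁ : s₁.rreg .c = s.rarr .cum mid := by simp [s₁, State.setI, State.setR, Function.update]
    have hrun₁ : ∀ {s₂ : State}, Runs u (.ifRLt .u .c (.op (.icopy .hi .mid))
        (.op (.iadd .lo .mid .one))) s₁ s₂ 2 → Runs u (.block
        [ .op (.iadd .mid .lo .hi), .op (.ihalf .mid .mid), .op (.rload .c .cum .mid),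
          .ifRLt .u .c (.op (.icopy .hi .mid)) (.op (.iadd .lo .mid .one)) ]) s s₂ 5 := by
      intro s₂ h
      have e : (((Instr.rload .c .cum .mid).exec u ((Instr.ihalf .mid .mid).exec u
          ((Instr.iadd .mid .lo .hi).exec u s)))) = s₁ := by
        simp [Instr.exec, s₁, State.setI, State.setR, Function.update, hmid]
      have h' : Runs u (.block [.ifRLt .u .c (.op (.icopy .hi .mid)) (.op (.iadd .lo .mid .one))])
          ((Instr.rload .c .cum .mid).exec u ((Instr.ihalf .mid .mid).exec u
          ((Instr.iadd .mid .lo .hi).exec u s))) s₂ (2 + 0) := by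
        rw [e]
        exact .seq h (.skip _)
      exact .seq (.op _ _) (.seq (.op _ _) (.seq (.op _ _) h'))
    by_cases hcmp : s.rreg .u < s.rarr .cum mid
    · let s₂ := s₁.setI .hi mid
      have hrun₂ : Runs u (.ifRLt .u .c (.op (.icopy .hi .mid)) (.op (.iadd .lo .mid .one)))
          s₁ s₂ 2 := by
        refine .ifRLt_pos (by rwa [hu₁, hc₁]) ?_
        have := Runs.op (u := u) (.icopy .hi .mid) s₁
        simpa [Instr.exec, s₂, s₁, State.setI, State.setR, Function.update] using this
      have hfr₂ : MoveFrame s s₂ := hfr₁.trans (by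
        refine ⟨rfl, rfl, fun r _ _ h3 _ => ?_, fun r _ _ => rfl⟩
        simp_all [s₂, State.setI, Function.update])
      have hlo₂ : s₂.ireg .lo = s.ireg .lo := by
        simp [s₂, s₁, State.setI, State.setR, Function.update]
      have hhi₂ : s₂.ireg .hi = mid := by
        simp [s₂, State.setI, Function.update]
      have hone₂ : s₂.ireg .one = 1 := by
        simpa [s₂, s₁, State.setI, State.setR, Function.update] using h1
      have hv₂ : s₂.ireg .v = s.ireg .v := by
        simp [s₂, s₁, State.setI, State.setR, Function.update]
      have hu₂ : s₂.rreg .u = s.rreg .u := hu₁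
      obtain ⟨s', c, hr, hc, hf, hpos, hv, hu, ha1, ha2, ha3, ha4⟩ :=
        ih s₂ hone₂ (by omega) (by rw [pow_succ] at hlt; omega)
      rw [hlo₂] at ha1 ha3
      rw [hhi₂] at ha2 ha4
      rw [hfr₂.rarr, hu₂] at ha3 ha4
      refine ⟨s', 5 + c + 1, .while_step hlh (hrun₁ hrun₂) hr, by omega, hfr₂.trans hf, hpos,
        hv.trans hv₂, hu.trans hu₂, ha1, by omega, ha3, Or.inr ?_⟩
      rcases ha4 with ha4 | ha4
      · rwa [ha4]
      · exact ha4
    · let s₂ := s₁.setI .lo (mid + 1)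
      have hrun₂ : Runs u (.ifRLt .u .c (.op (.icopy .hi .mid)) (.op (.iadd .lo .mid .one)))
          s₁ s₂ 2 := by
        refine .ifRLt_neg (by rwa [hu₁, hc₁]) ?_
        have := Runs.op (u := u) (.iadd .lo .mid .one) s₁
        simpa [Instr.exec, s₂, s₁, State.setI, State.setR, Function.update, h1] using this
      have hfr₂ : MoveFrame s s₂ := hfr₁.trans (by
        refine ⟨rfl, rfl, fun r _ h2 _ _ => ?_, fun r _ _ => rfl⟩
        simp_all [s₂, State.setI, Function.update])
      have hhi₂ : s₂.ireg .hi = s.ireg .hi := by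
        simp [s₂, s₁, State.setI, State.setR, Function.update]
      have hlo₂ : s₂.ireg .lo = mid + 1 := by
        simp [s₂, State.setI, Function.update]
      have hone₂ : s₂.ireg .one = 1 := by
        simpa [s₂, s₁, State.setI, State.setR, Function.update] using h1
      have hv₂ : s₂.ireg .v = s.ireg .v := by
        simp [s₂, s₁, State.setI, State.setR, Function.update]
      have hu₂ : s₂.rreg .u = s.rreg .u := hu₁
      obtain ⟨s', c, hr, hc, hf, hpos, hv, hu, ha1, ha2, ha3, ha4⟩ :=
        ih s₂ hone₂ (by omega) (by rw [pow_succ] at hlt; omega)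
      rw [hlo₂] at ha1 ha3
      rw [hhi₂] at ha2 ha4
      rw [hfr₂.rarr, hu₂] at ha3 ha4
      refine ⟨s', 5 + c + 1, .while_step hlh (hrun₁ hrun₂) hr, by omega, hfr₂.trans hf, hpos,
        hv.trans hv₂, hu.trans hu₂, by omega, ha2, Or.inr ?_, ha4⟩
      rcases ha3 with ha3 | ha3
      · rw [ha3, Nat.add_sub_cancel]
        exact not_lt.1 hcmp
      · exact ha3

/-- A row of a table lists at most `n` cells. -/
lemma StoresRow.card_le {i : ℕ} (h : StoresRow s i q) :
    s.iarr .last i - s.iarr .first i ≤ n := by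
  have h1 : Set.MapsTo (s.iarr .nbr) (Finset.Ico (s.iarr .first i) (s.iarr .last i))
      (Finset.range n) := fun a ha => by
    obtain ⟨h2, -⟩ := h.bij.mapsTo (by simpa using ha)
    simpa using h2
  have h2 := Finset.card_le_card_of_injOn _ h1 (by simpa using h.bij.injOn)
  simpa using h2

/-- A random transition: the next vertex is that of the cell of the next random number. -/
lemma runs_moveProg (u : Tape) (s : State) (L : ℕ) (hL : n ≤ 2 ^ L) (h1 : s.ireg .one = 1)
    (hq : q ∈ stdSimplex ℝ (Fin n)) (hrow : StoresRow s (s.ireg .v) q) :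
    ∃ s' c, Runs u moveProg s s' c ∧ c ≤ 6 * L + 6 ∧ MoveFrame s s' ∧ s'.pos = s.pos + 1 ∧
      s'.ireg .v = s.iarr .nbr (rowCell s (s.ireg .v) (u s.pos)) := by
  have hfl := hrow.first_lt_last hq
  have hcard := hrow.card_le
  set v := s.ireg .v with hv
  set a := s.iarr .first v with ha
  set b := s.iarr .last v with hb
  let s₀ : State := { s.setR .u (u s.pos) with pos := s.pos + 1 }
  let s₁ := ((s₀.setI .lo a).setI .hi b).setI .hi (b - 1)
  have hone : s₁.ireg .one = 1 := by
    simpa [s₁, s₀, State.setI, State.setR, Function.update] using h1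
  have hlo : s₁.ireg .lo = a := by simp [s₁, State.setI, Function.update]
  have hhi : s₁.ireg .hi = b - 1 := by simp [s₁, State.setI, Function.update]
  have hu : s₁.rreg .u = u s.pos := by simp [s₁, s₀, State.setI, State.setR, Function.update]
  have hv₁ : s₁.ireg .v = v := by
    simp [s₁, s₀, State.setI, State.setR, Function.update, hv]
  have hfr₁ : MoveFrame s s₁ := by
    refine ⟨rfl, rfl, fun r _ h2 h3 _ => ?_, fun r h1 _ => ?_⟩ <;>
      simp_all [s₁, s₀, State.setI, State.setR, Function.update]
  obtain ⟨s₂, c, hr, hc, hf, hpos, -, -, ha1, ha2, ha3, ha4⟩ :=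
    runs_searchProg u L s₁ hone (by omega) (by omega)
  rw [hlo, hu, hfr₁.rarr] at ha3
  rw [hhi, hu, hfr₁.rarr] at ha4
  rw [hlo] at ha1
  rw [hhi] at ha2
  have hcell : s₂.ireg .lo = rowCell s v (u s.pos) := by
    refine hrow.eq_rowCell ⟨ha1, by omega⟩ ha3 (ha4.imp_left fun h => ?_)
    rw [h]
    omega
  have e : (Instr.isub .hi .hi .one).exec u ((Instr.iload .hi .last .v).exec u
      ((Instr.iload .lo .first .v).exec u ((Instr.rand .u).exec u s))) = s₁ := by
    simp [Instr.exec, s₁, s₀, State.setI, State.setR, Function.update, h1, ha, hb, hv]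
  have hrun : Runs u (.block [searchProg, .op (.iload .v .nbr .lo)])
      ((Instr.isub .hi .hi .one).exec u ((Instr.iload .hi .last .v).exec u
      ((Instr.iload .lo .first .v).exec u ((Instr.rand .u).exec u s))))
      ((Instr.iload .v .nbr .lo).exec u s₂) (c + (1 + 0)) := by
    rw [e]
    exact .seq hr (.seq (.op _ _) (.skip _))
  refine ⟨_, _, .seq (.op _ _) (.seq (.op _ _) (.seq (.op _ _) (.seq (.op _ _) hrun))), by omega,
    (hfr₁.trans hf).trans ?_, hpos, ?_⟩
  · refine ⟨rfl, rfl, fun r h1 _ _ _ => ?_, fun r _ _ => rfl⟩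
    simp_all [Instr.exec, State.setI, Function.update]
  · simp only [Instr.exec, State.setI, Function.update_self]
    rw [hcell, hf.iarr, hfr₁.iarr]

/-- The initialization clears the cells of the answer array from `k` on; `m` is the number of cells
still to be cleared. -/
lemma runs_clear_loop (u : Tape) (m : ℕ) (s : State) (h1 : s.ireg .one = 1)
    (hm : s.ireg .n = s.ireg .k + m) :
    ∃ s', Runs u (.whileLt .k .n (.block [.op (.rstore .X .k .zero), .op (.iadd .k .k .one)]))
        s s' (3 * m + 1) ∧ SameTables s s' ∧ s'.pos = s.pos ∧
      (∀ r, r ≠ .k → s'.ireg r = s.ireg r) ∧ s'.rreg = s.rreg ∧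
      (∀ j, j < s.ireg .k → s'.rarr .X j = s.rarr .X j) ∧
      ∀ j, s.ireg .k ≤ j → j < s.ireg .n → s'.rarr .X j = s.rreg .zero := by
  induction m generalizing s with
  | zero =>
    exact ⟨s, .while_done (by omega), SameTables.refl s, rfl, fun _ _ => rfl, rfl, fun _ _ => rfl,
      fun j _ _ => by omega⟩
  | succ m ih =>
    let s₁ := (s.store .X (s.ireg .k) (s.rreg .zero)).setI .k (s.ireg .k + 1)
    have hk₁ : s₁.ireg .k = s.ireg .k + 1 := by simp [s₁, State.setI]
    have hr₁ : ∀ r, r ≠ .k → s₁.ireg r = s.ireg r := fun r hr => by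
      simp [s₁, State.setI, State.store, Function.update_of_ne hr]
    have hX₁ : s₁.rarr .X = Function.update (s.rarr .X) (s.ireg .k) (s.rreg .zero) := by
      simp [s₁, State.setI, State.store]
    obtain ⟨s', hr, ht, hpos, hi, hrr, hX, hX'⟩ := ih s₁ (by rw [hr₁ _ (by simp), h1])
      (by rw [hr₁ _ (by simp), hk₁]; omega)
    refine ⟨s', ?_, SameTables.trans (s' := s₁) ⟨rfl, ?_⟩ ht, hpos,
      fun r h => (hi r h).trans (hr₁ r h), hrr, fun j hj => ?_, fun j hj hjn => ?_⟩
    · have e : (Instr.iadd .k .k .one).exec u ((Instr.rstore .X .k .zero).exec u s) = s₁ := by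
        simp [Instr.exec, s₁, State.setI, State.store, h1]
      have h2 : Runs u (.block [.op (.rstore .X .k .zero), .op (.iadd .k .k .one)]) s s₁ 2 := by
        rw [← e]
        exact .seq (.op _ _) (.seq (.op _ _) (.skip _))
      have h3 := Runs.while_step (by omega) h2 hr
      exact h3.congr_cost (by ring)
    · simp [s₁, State.setI, State.store, Function.update]
    · rw [hX j (by omega), hX₁, Function.update_of_ne (by omega)]
    · rcases hj.eq_or_lt with rfl | hj
      · rw [hX _ (by omega), hX₁, Function.update_self]
      · exact hX' j (by omega) (by rw [hr₁ _ (by simp)]; exact hjn)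

/-- The state after the initialization. -/
structure Initialized (n : ℕ) (s s' : State) : Prop where
  tables : SameTables s s'
  pos : s'.pos = s.pos
  one : s'.ireg .one = 1
  rone : s'.rreg .one = 1
  ireg : ∀ r, r ≠ .one → r ≠ .zero → r ≠ .k → s'.ireg r = s.ireg r
  clear : ∀ j < n, s'.rarr .X j = 0

lemma runs_initProg (u : Tape) (s : State) (hn : s.ireg .n = n) :
    ∃ s', Runs u initProg s s' (3 * n + 6) ∧ Initialized n s s' := by
  let s₁ := ((((s.setI .one 1).setI .zero 0).setR .one 1).setR .zero 0).setI .k 0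
  obtain ⟨s', hr, ht, hpos, hi, hrr, hX, hX'⟩ := runs_clear_loop u n s₁
    (by simp [s₁, State.setI, State.setR, Function.update])
    (by simp [s₁, State.setI, State.setR, Function.update, hn])
  refine ⟨s', ?_, SameTables.trans (s' := s₁) ⟨rfl, rfl⟩ ht, hpos, ?_, ?_, fun r h1 h2 h3 => ?_,
    fun j hj => ?_⟩
  · have e : (Instr.iconst .k 0).exec u ((Instr.cast .zero .zero).exec u
        ((Instr.cast .one .one).exec u ((Instr.iconst .zero 0).exec u
        ((Instr.iconst .one 1).exec u s)))) = s₁ := by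
      simp [Instr.exec, s₁, State.setI, State.setR, Function.update]
    rw [← e] at hr
    have := Runs.seq (.op _ _) (.seq (.op _ _) (.seq (.op _ _) (.seq (.op _ _)
      (.seq (.op _ _) (.seq hr (.skip _))))))
    exact this.congr_cost (by ring)
  · rw [hi _ (by simp)]
    simp [s₁, State.setI, State.setR, Function.update]
  · rw [hrr]
    simp [s₁, State.setI, State.setR, Function.update]
  · rw [hi r h3]
    simp [s₁, State.setI, State.setR, Function.update, h1, h2, h3]
  · rw [hX' j (by simp [s₁, State.setI])
      (by simpa [s₁, State.setI, State.setR, Function.update, hn] using hj)]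
    simp [s₁, State.setI, State.setR, Function.update]

/-- The division of the counts in the cells from `k` on; `m` is the number of cells still to be
divided. -/
lemma runs_scale_loop (u : Tape) (m : ℕ) (s : State) (h1 : s.ireg .one = 1)
    (hm : s.ireg .n = s.ireg .k + m) :
    ∃ s', Runs u (.whileLt .k .n (.block [.op (.rload .w .X .k), .op (.rdiv .w .w .d),
        .op (.rstore .X .k .w), .op (.iadd .k .k .one)])) s s' (5 * m + 1) ∧
      (∀ j, j < s.ireg .k → s'.rarr .X j = s.rarr .X j) ∧
      ∀ j, s.ireg .k ≤ j → j < s.ireg .n → s'.rarr .X j = s.rarr .X j / s.rreg .d := by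
  induction m generalizing s with
  | zero => exact ⟨s, .while_done (by omega), fun _ _ => rfl, fun j _ _ => by omega⟩
  | succ m ih =>
    set x := s.rarr .X (s.ireg .k) / s.rreg .d with hx
    let s₁ := (((s.setR .w (s.rarr .X (s.ireg .k))).setR .w x).store .X (s.ireg .k) x).setI .k
      (s.ireg .k + 1)
    have hk₁ : s₁.ireg .k = s.ireg .k + 1 := by simp [s₁, State.setI]
    have hr₁ : ∀ r, r ≠ .k → s₁.ireg r = s.ireg r := fun r hr => by
      simp [s₁, State.setI, State.setR, State.store, Function.update_of_ne hr]
    have hd₁ : s₁.rreg .d = s.rreg .d := by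
      simp [s₁, State.setI, State.setR, State.store, Function.update]
    have hX₁ : s₁.rarr .X = Function.update (s.rarr .X) (s.ireg .k) x := by
      simp [s₁, State.setI, State.setR, State.store]
    obtain ⟨s', hr, hX, hX'⟩ := ih s₁ (by rw [hr₁ _ (by simp), h1])
      (by rw [hr₁ _ (by simp), hk₁]; omega)
    refine ⟨s', ?_, fun j hj => ?_, fun j hj hjn => ?_⟩
    · have e : (Instr.iadd .k .k .one).exec u ((Instr.rstore .X .k .w).exec u
          ((Instr.rdiv .w .w .d).exec u ((Instr.rload .w .X .k).exec u s))) = s₁ := by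
        simp [Instr.exec, s₁, State.setI, State.setR, State.store, h1, hx]
      have h2 : Runs u (.block [.op (.rload .w .X .k), .op (.rdiv .w .w .d),
          .op (.rstore .X .k .w), .op (.iadd .k .k .one)]) s s₁ 4 := by
        rw [← e]
        exact .seq (.op _ _) (.seq (.op _ _) (.seq (.op _ _) (.seq (.op _ _) (.skip _))))
      have h3 := Runs.while_step (by omega) h2 hr
      exact h3.congr_cost (by ring)
    · rw [hX j (by omega), hX₁, Function.update_of_ne (by omega)]
    · rcases hj.eq_or_lt with rfl | hj
      · rw [hX _ (by omega), hX₁, Function.update_self]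
      · rw [hX' j (by omega) (by rw [hr₁ _ (by simp)]; exact hjn), hX₁, hd₁,
          Function.update_of_ne (by omega)]

lemma runs_scaleProg (u : Tape) (s : State) (hn : s.ireg .n = n) (h1 : s.ireg .one = 1) :
    ∃ s', Runs u scaleProg s s' (5 * n + 2) ∧
      ∀ j < n, s'.rarr .X j = s.rarr .X j / s.rreg .d := by
  obtain ⟨s', hr, -, hX'⟩ := runs_scale_loop u n (s.setI .k 0)
    (by simpa [State.setI, Function.update] using h1)
    (by simpa [State.setI, Function.update] using hn)
  refine ⟨s', ?_, fun j hj => ?_⟩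
  · have := Runs.seq (.op (.iconst .k 0) s) (.seq hr (.skip _))
    exact this.congr_cost (by ring)
  · exact hX' j (by simp [State.setI]) (by simpa [State.setI, Function.update, hn] using hj)

lemma runs_countProg (u : Tape) (s : State) (h1 : s.rreg .one = 1) :
    ∃ s', Runs u countProg s s' 3 ∧ SameTables s s' ∧ s'.pos = s.pos ∧ s'.ireg = s.ireg ∧
      s'.rreg .one = 1 ∧
      ∀ j, s'.rarr .X j = s.rarr .X j + if s.ireg .v = j then 1 else 0 := by
  refine ⟨_, .seq (.op _ _) (.seq (.op _ _) (.seq (.op _ _) (.skip _))), ⟨rfl, ?_⟩, rfl, rfl, ?_,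
    fun j => ?_⟩
  · simp [Instr.exec, State.setR, State.store, Function.update]
  · simp [Instr.exec, State.setR, State.store, Function.update, h1]
  · by_cases hj : s.ireg .v = j
    · subst hj
      simp [Instr.exec, State.setR, State.store, h1]
    · simp [Instr.exec, State.setR, State.store, Function.update_of_ne (Ne.symm hj), hj]

end Machine

/-! ### Runs of the two programs -/

section MachineWalks

variable {n : ℕ} {P : Matrix (Fin n) (Fin n) ℝ} {s₀ : State}

/-- A transition of the chain as a function of the current vertex and a uniform random number. -/
lemma StoresMatrix.exists_step (h : StoresMatrix s₀ P) (hP : P ∈ Matrix.rowStochastic ℝ (Fin n)) :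
    ∃ step : Fin n → unitInterval → Fin n,
      (∀ i x, (step i x : ℕ) = s₀.iarr .nbr (rowCell s₀ i x)) ∧
      (∀ i j, MeasurableSet {x | step i x = j}) ∧
      ∀ i j, volume.real {x | step i x = j} = P i j := by
  have h1 := fun i : Fin n => (h.row i).exists_sampler
    ⟨fun j => Matrix.nonneg_of_mem_rowStochastic hP, Matrix.sum_row_of_mem_rowStochastic hP i⟩
  choose step h2 h3 h4 using h1
  exact ⟨step, h2, h3, h4⟩

/-- The first step of a tape walk split off. -/
lemma tapeWalk_shift (step : Fin n → unitInterval → Fin n) (i : Fin n) (u : Tape) (p t : ℕ) :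
    tapeWalk step (step i (u p)) (fun x => u (p + 1 + x)) t =
      tapeWalk step i (fun x => u (p + x)) (t + 1) := by
  induction t with
  | zero => rfl
  | succ t ih =>
    rw [tapeWalk, ih]
    conv_rhs => rw [tapeWalk]
    simp only [add_assoc, add_comm 1 t]

/-- The visit of the current vertex is counted unless the burn-in is still going on. -/
lemma runs_burn_count (u : Tape) (s : State) (h1 : s.rreg .one = 1) :
    ∃ s' c, Runs u (.ifLt .t .burn .skip countProg) s s' c ∧ c ≤ 4 ∧ SameTables s s' ∧
      s'.pos = s.pos ∧ s'.ireg = s.ireg ∧ s'.rreg .one = 1 ∧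
      ∀ j, s'.rarr .X j = s.rarr .X j +
        if s.ireg .burn ≤ s.ireg .t ∧ s.ireg .v = j then 1 else 0 := by
  by_cases h : s.ireg .t < s.ireg .burn
  · refine ⟨s, 1, .ifLt_pos h (.skip _), by omega, SameTables.refl s, rfl, rfl, h1, fun j => ?_⟩
    rw [if_neg (by omega), add_zero]
  · obtain ⟨s', hr, ht, hpos, hi, hone, hX⟩ := runs_countProg u s h1
    refine ⟨s', 4, .ifLt_neg h hr, le_rfl, ht, hpos, hi, hone, fun j => ?_⟩
    rw [hX]
    congr 1
    exact if_congr ⟨fun hv => ⟨by omega, hv⟩, fun hv => hv.2⟩ rfl rfl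

section Loops

variable (hP : P ∈ Matrix.rowStochastic ℝ (Fin n)) (hM : StoresMatrix s₀ P)
  {step : Fin n → unitInterval → Fin n}
  (hstep : ∀ i x, (step i x : ℕ) = s₀.iarr .nbr (rowCell s₀ i x)) {L : ℕ} (hL : n ≤ 2 ^ L)

include hP hM hstep hL

/-- A random transition from a vertex `i`, according to the matrix stored initially. -/
lemma runs_moveProg_step (u : Tape) (s : State) (hs : SameTables s₀ s) (h1 : s.ireg .one = 1)
    (i : Fin n) (hv : s.ireg .v = i) :
    ∃ s' c, Runs u moveProg s s' c ∧ c ≤ 6 * L + 6 ∧ MoveFrame s s' ∧ s'.pos = s.pos + 1 ∧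
      s'.ireg .v = step i (u s.pos) := by
  have hrow : StoresRow s (s.ireg .v) (P i) := by
    rw [hv]
    exact (hM.row i).congr hs
  obtain ⟨s', c, hr, hc, hf, hpos, hv'⟩ := runs_moveProg u s L hL h1
    ⟨fun j => Matrix.nonneg_of_mem_rowStochastic hP, Matrix.sum_row_of_mem_rowStochastic hP i⟩ hrow
  refine ⟨s', c, hr, hc, hf, hpos, ?_⟩
  rw [hv', hv, hs.rowCell_eq, hs.iarr, hstep]

/-- The main loop of the single-walk algorithm counts the visits of the tape walk; `r` is the
number of iterations still to be made. -/
lemma runs_mcmc_loop (u : Tape) (r : ℕ) (s : State) (hs : SameTables s₀ s)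
    (h1 : s.ireg .one = 1) (hr1 : s.rreg .one = 1) (i : Fin n) (hv : s.ireg .v = i)
    (hlen : s.ireg .len = s.ireg .t + r) :
    ∃ s' c, Runs u (.whileLt .t .len (.block
        [ .op (.iadd .t .t .one), .ifLt .t .burn .skip countProg, moveProg ])) s s' c ∧
      c ≤ (6 * L + 12) * r + 1 ∧ s'.ireg .one = 1 ∧ s'.ireg .n = s.ireg .n ∧
      s'.ireg .burn = s.ireg .burn ∧ s'.ireg .len = s.ireg .len ∧
      ∀ j : Fin n, s'.rarr .X j = s.rarr .X j + ∑ k ∈ Finset.range r,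
        if s.ireg .burn ≤ s.ireg .t + k + 1 ∧ tapeWalk step i (fun x => u (s.pos + x)) k = j
        then 1 else 0 := by
  induction r generalizing s i with
  | zero =>
    exact ⟨s, 1, .while_done (by omega), by omega, h1, rfl, rfl, rfl, fun j => by simp⟩
  | succ r ih =>
    let s₁ := s.setI .t (s.ireg .t + 1)
    have hi₁ : ∀ x, x ≠ .t → s₁.ireg x = s.ireg x := fun x hx => by
      simp [s₁, State.setI, Function.update_of_ne hx]
    have ht₁ : s₁.ireg .t = s.ireg .t + 1 := by simp [s₁, State.setI]
    obtain ⟨s₂, c₂, hr₂, hc₂, hT₂, hpos₂, hi₂, hone₂, hX₂⟩ := runs_burn_count u s₁ hr1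
    have hsT : SameTables s s₁ := ⟨rfl, rfl⟩
    have hT : SameTables s₀ s₂ := (hs.trans hsT).trans hT₂
    obtain ⟨s₃, c₃, hr₃, hc₃, hf₃, hpos₃, hv₃⟩ := runs_moveProg_step hP hM hstep hL u s₂ hT
      (by rw [hi₂, hi₁ _ (by simp), h1]) i (by rw [hi₂, hi₁ _ (by simp), hv])
    have hi₃ : ∀ x, x ≠ .t → x ≠ .v → x ≠ .lo → x ≠ .hi → x ≠ .mid → s₃.ireg x = s.ireg x :=
      fun x h2 h3 h4 h5 h6 => by rw [hf₃.ireg x h3 h4 h5 h6, hi₂, hi₁ x h2]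
    have ht₃ : s₃.ireg .t = s.ireg .t + 1 := by
      rw [hf₃.ireg _ (by simp) (by simp) (by simp) (by simp), hi₂, ht₁]
    have hpos₂' : s₂.pos = s.pos := hpos₂
    obtain ⟨s', c, hr, hc, hone, hn, hburn, hlen', hX⟩ := ih s₃ (hT.trans hf₃.sameTables)
      (by rw [hi₃ _ (by simp) (by simp) (by simp) (by simp) (by simp), h1])
      (by rw [hf₃.rreg _ (by simp) (by simp), hone₂]) (step i (u s₂.pos)) hv₃
      (by rw [hi₃ _ (by simp) (by simp) (by simp) (by simp) (by simp), ht₃]; omega)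
    refine ⟨s', (1 + (c₂ + (c₃ + 0))) + c + 1, .while_step (by omega) ?_ hr, ?_, hone, ?_, ?_, ?_,
      fun j => ?_⟩
    · have e : (Instr.iadd .t .t .one).exec u s = s₁ := by
        simp [Instr.exec, s₁, h1]
      have h2 := Runs.op (u := u) (.iadd .t .t .one) s
      rw [e] at h2
      exact .seq h2 (.seq hr₂ (.seq hr₃ (.skip _)))
    · have : (6 * L + 12) * (r + 1) = (6 * L + 12) * r + (6 * L + 12) := by ring
      omega
    · rw [hn, hi₃ _ (by simp) (by simp) (by simp) (by simp) (by simp)]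
    · rw [hburn, hi₃ _ (by simp) (by simp) (by simp) (by simp) (by simp)]
    · rw [hlen', hi₃ _ (by simp) (by simp) (by simp) (by simp) (by simp)]
    · rw [hX, Finset.sum_range_succ', hf₃.rarr, hX₂, hpos₃, hpos₂', ht₃,
        hi₃ .burn (by simp) (by simp) (by simp) (by simp) (by simp), ht₁, hi₁ .burn (by simp),
        hi₁ .v (by simp), hv]
      have hX₁ : s₁.rarr = s.rarr := rfl
      rw [hX₁, add_assoc, add_comm (ite _ _ _)]
      congr 2
      · refine Finset.sum_congr rfl fun k _ => ?_
        rw [tapeWalk_shift]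
        refine if_congr (and_congr_left fun _ => ?_) rfl rfl
        omega
      · refine if_congr (and_congr_right fun _ => ?_) rfl rfl
        rw [tapeWalk, Fin.ext_iff]

/-- On every tape the single-walk program stops within the stated number of operations, and its
answer is the estimator applied to the tape walk. -/
lemma runs_mcmcProg (u : Tape) (hn : 0 < n) :
    ∃ s' c, Runs u mcmcProg s₀ s' c ∧ c ≤ 8 * n + (6 * L + 12) * s₀.ireg .len + 13 ∧
      (s₀.ireg .burn ≤ s₀.ireg .len → s'.answer n = visitAverage (s₀.ireg .burn) (s₀.ireg .len)
        (tapeWalk step ⟨0, hn⟩ (fun x => u (s₀.pos + x)))) := by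
  obtain ⟨s₁, hr₁, hI⟩ := runs_initProg u s₀ hM.size
  let s₂ := (s₁.setI .v 0).setI .t 0
  have hi₂ : ∀ x, x ≠ .v → x ≠ .t → s₂.ireg x = s₁.ireg x := fun x hx hx' => by
    simp [s₂, State.setI, Function.update_of_ne hx, Function.update_of_ne hx']
  have hi₂' : ∀ x, x ≠ .v → x ≠ .t → x ≠ .one → x ≠ .zero → x ≠ .k →
      s₂.ireg x = s₀.ireg x := fun x h1 h2 h3 h4 h5 => by rw [hi₂ x h1 h2, hI.ireg x h3 h4 h5]
  have ht₂ : s₂.ireg .t = 0 := by simp [s₂, State.setI]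
  have hlen₂ := hi₂' .len (by simp) (by simp) (by simp) (by simp) (by simp)
  have hburn₂ := hi₂' .burn (by simp) (by simp) (by simp) (by simp) (by simp)
  have hsT : SameTables s₁ s₂ := ⟨rfl, rfl⟩
  obtain ⟨s₃, c₃, hr₃, hc₃, hone₃, hn₃, hburn₃, hlen₃, hX₃⟩ := runs_mcmc_loop hP hM hstep hL u
    (s₀.ireg .len) s₂ (hI.tables.trans hsT) (by rw [hi₂ _ (by simp) (by simp), hI.one]) hI.rone
    ⟨0, hn⟩ (by simp [s₂, State.setI, Function.update]) (by rw [hlen₂, ht₂, zero_add])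
  let s₄ := (s₃.setI .m (s₃.ireg .len - s₃.ireg .burn)).setR .d
    ((s₃.ireg .len - s₃.ireg .burn : ℕ) : ℝ)
  have hn₄ : s₄.ireg .n = n := by
    have h1 : s₄.ireg .n = s₃.ireg .n := by simp [s₄, State.setI, State.setR, Function.update]
    rw [h1, hn₃, hi₂' _ (by simp) (by simp) (by simp) (by simp) (by simp), hM.size]
  obtain ⟨s₅, hr₅, hX₅⟩ := runs_scaleProg u s₄ hn₄
    (by simpa [s₄, State.setI, State.setR, Function.update] using hone₃)
  refine ⟨s₅, (3 * n + 6) + (1 + (1 + (c₃ + (1 + (1 + ((5 * n + 2) + 0)))))), ?_, ?_, ?_⟩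
  · have e : (Instr.cast .d .m).exec u ((Instr.isub .m .len .burn).exec u s₃) = s₄ := by
      simp [Instr.exec, s₄, State.setI, State.setR]
    have h4 : Runs u (.block [.op (.isub .m .len .burn), .op (.cast .d .m), scaleProg]) s₃ s₅
        (1 + (1 + ((5 * n + 2) + 0))) := by
      rw [← e] at hr₅
      exact .seq (.op _ _) (.seq (.op _ _) (.seq hr₅ (.skip _)))
    exact .seq hr₁ (.seq (.op _ _) (.seq (.op _ _) (.seq hr₃ h4)))
  · omega
  · intro hbl
    have hd : s₄.rreg .d = (s₀.ireg .len : ℝ) - s₀.ireg .burn := by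
      simp only [s₄, State.setR, Function.update_self]
      rw [hlen₃, hburn₃, hlen₂, hburn₂, Nat.cast_sub hbl]
    have hX₄ : s₄.rarr = s₃.rarr := rfl
    have hX₂ : s₂.rarr = s₁.rarr := rfl
    have hp₂ : s₂.pos = s₀.pos := hI.pos
    rw [visitAverage, sum_posVec_eq_vec2, State.answer]
    ext j
    simp only [vec2_apply, PiLp.smul_apply, smul_eq_mul]
    rw [hX₅ j j.2, hd, hX₄, hX₃, hX₂, hI.clear j j.2, zero_add, hburn₂, ht₂, hp₂,
      div_eq_inv_mul, Finset.sum_filter]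
    congr 1
    refine Finset.sum_congr rfl fun k _ => ?_
    rw [zero_add]
    by_cases hk : s₀.ireg .burn ≤ k + 1 <;> simp [hk]

/-- The remaining `r` steps of one walk of the parallel version. -/
lemma runs_walk_loop (u : Tape) (r : ℕ) (s : State) (hs : SameTables s₀ s)
    (h1 : s.ireg .one = 1) (i : Fin n) (hv : s.ireg .v = i)
    (hlen : s.ireg .len = s.ireg .t + r) :
    ∃ s' c, Runs u (.whileLt .t .len (.block [ .op (.iadd .t .t .one), moveProg ])) s s' c ∧
      c ≤ (6 * L + 8) * r + 1 ∧ SameTables s s' ∧ s'.rarr = s.rarr ∧ s'.pos = s.pos + r ∧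
      (∀ x, x ≠ .t → x ≠ .v → x ≠ .lo → x ≠ .hi → x ≠ .mid → s'.ireg x = s.ireg x) ∧
      s'.rreg .one = s.rreg .one ∧
      s'.ireg .v = tapeWalk step i (fun x => u (s.pos + x)) r := by
  induction r generalizing s i with
  | zero =>
    exact ⟨s, 1, .while_done (by omega), by omega, SameTables.refl s, rfl, rfl,
      fun _ _ _ _ _ _ => rfl, rfl, hv⟩
  | succ r ih =>
    let s₁ := s.setI .t (s.ireg .t + 1)
    have hi₁ : ∀ x, x ≠ .t → s₁.ireg x = s.ireg x := fun x hx => by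
      simp [s₁, State.setI, Function.update_of_ne hx]
    have ht₁ : s₁.ireg .t = s.ireg .t + 1 := by simp [s₁, State.setI]
    have hsT : SameTables s s₁ := ⟨rfl, rfl⟩
    obtain ⟨s₃, c₃, hr₃, hc₃, hf₃, hpos₃, hv₃⟩ := runs_moveProg_step hP hM hstep hL u s₁
      (hs.trans hsT) (by rw [hi₁ _ (by simp), h1]) i (by rw [hi₁ _ (by simp), hv])
    have hi₃ : ∀ x, x ≠ .t → x ≠ .v → x ≠ .lo → x ≠ .hi → x ≠ .mid → s₃.ireg x = s.ireg x :=
      fun x h2 h3 h4 h5 h6 => by rw [hf₃.ireg x h3 h4 h5 h6, hi₁ x h2]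
    have ht₃ : s₃.ireg .t = s.ireg .t + 1 := by
      rw [hf₃.ireg _ (by simp) (by simp) (by simp) (by simp), ht₁]
    have hp₁ : s₁.pos = s.pos := rfl
    obtain ⟨s', c, hr, hc, hT, hX, hpos, hi, hone, hv'⟩ := ih s₃
      ((hs.trans hsT).trans hf₃.sameTables)
      (by rw [hi₃ _ (by simp) (by simp) (by simp) (by simp) (by simp), h1])
      (step i (u s₁.pos)) hv₃
      (by rw [hi₃ _ (by simp) (by simp) (by simp) (by simp) (by simp), ht₃]; omega)
    refine ⟨s', (1 + (c₃ + 0)) + c + 1, .while_step (by omega) ?_ hr, ?_,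
      (hsT.trans hf₃.sameTables).trans hT, hX.trans hf₃.rarr, by rw [hpos, hpos₃, hp₁]; ring,
      fun x h2 h3 h4 h5 h6 => by rw [hi x h2 h3 h4 h5 h6, hi₃ x h2 h3 h4 h5 h6],
      hone.trans (hf₃.rreg _ (by simp) (by simp)), ?_⟩
    · have e : (Instr.iadd .t .t .one).exec u s = s₁ := by
        simp [Instr.exec, s₁, h1]
      have h2 := Runs.op (u := u) (.iadd .t .t .one) s
      rw [e] at h2
      exact .seq h2 (.seq hr₃ (.skip _))
    · have : (6 * L + 8) * (r + 1) = (6 * L + 8) * r + (6 * L + 8) := by ring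
      omega
    · rw [hv', hpos₃, hp₁, tapeWalk_shift]

variable {ν : Fin n → ℝ} (hν : ν ∈ stdSimplex ℝ (Fin n)) (hS : StoresRow s₀ n ν)
  {start : unitInterval → Fin n} (hstart : ∀ x, (start x : ℕ) = s₀.iarr .nbr (rowCell s₀ n x))

include hν hS hstart

/-- The loop over the remaining `r` walks counts their final positions. Each walk uses a block of
`len + 1` random numbers, the first of them for the starting vertex. -/
lemma runs_walkers_loop (u : Tape) (r : ℕ) (s : State) (hs : SameTables s₀ s)
    (h1 : s.ireg .one = 1) (hr1 : s.rreg .one = 1) (hn : s.ireg .n = n)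
    (hw : s.ireg .walkers = s.ireg .m + r) :
    ∃ s' c, Runs u (.whileLt .m .walkers (.block
      [ .op (.icopy .v .n),
        moveProg,
        .op (.iconst .t 0),
        .whileLt .t .len (.block [ .op (.iadd .t .t .one), moveProg ]),
        countProg,
        .op (.iadd .m .m .one) ])) s s' c ∧
      c ≤ ((6 * L + 8) * s.ireg .len + 6 * L + 14) * r + 1 ∧
      s'.ireg .one = 1 ∧ s'.ireg .n = n ∧ s'.ireg .walkers = s.ireg .walkers ∧
      ∀ j : Fin n, s'.rarr .X j = s.rarr .X j + ∑ k ∈ Finset.range r,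
        if tapeWalk step (start (u (s.pos + k * (s.ireg .len + 1))))
          (fun x => u (s.pos + k * (s.ireg .len + 1) + (1 + x))) (s.ireg .len) = j
        then 1 else 0 := by
  induction r generalizing s with
  | zero => exact ⟨s, 1, .while_done (by omega), by omega, h1, hn, rfl, fun j => by simp⟩
  | succ r ih =>
    let s₁ := s.setI .v n
    have hi₁ : ∀ x, x ≠ .v → s₁.ireg x = s.ireg x := fun x hx => by
      simp [s₁, State.setI, Function.update_of_ne hx]
    have hv₁ : s₁.ireg .v = n := by simp [s₁, State.setI]
    have hsT : SameTables s s₁ := ⟨rfl, rfl⟩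
    obtain ⟨s₂, c₂, hr₂, hc₂, hf₂, hpos₂, hv₂⟩ := runs_moveProg u s₁ L hL
      (by rw [hi₁ _ (by simp), h1]) hν (by rw [hv₁]; exact hS.congr (hs.trans hsT))
    rw [hv₁, (hs.trans hsT).rowCell_eq, (hs.trans hsT).iarr, ← hstart] at hv₂
    have hT₂ : SameTables s s₂ := hsT.trans hf₂.sameTables
    let s₃ := s₂.setI .t 0
    have hsT₃ : SameTables s₂ s₃ := ⟨rfl, rfl⟩
    have hi₃ : ∀ x, x ≠ .t → s₃.ireg x = s₂.ireg x := fun x hx => by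
      simp [s₃, State.setI, Function.update_of_ne hx]
    have ht₃ : s₃.ireg .t = 0 := by simp [s₃, State.setI]
    have hi₃' : ∀ x, x ≠ .t → x ≠ .v → x ≠ .lo → x ≠ .hi → x ≠ .mid → s₃.ireg x = s.ireg x :=
      fun x h2 h3 h4 h5 h6 => by rw [hi₃ x h2, hf₂.ireg x h3 h4 h5 h6, hi₁ x h3]
    have hlen₃ := hi₃' .len (by simp) (by simp) (by simp) (by simp) (by simp)
    obtain ⟨s₄, c₄, hr₄, hc₄, hT₄, hX₄, hpos₄, hi₄, hone₄, hv₄⟩ :=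
      runs_walk_loop hP hM hstep hL u (s.ireg .len) s₃ (hs.trans (hT₂.trans hsT₃))
      (by rw [hi₃' _ (by simp) (by simp) (by simp) (by simp) (by simp), h1]) _
      (by rw [hi₃ _ (by simp), hv₂]) (by rw [hlen₃, ht₃, zero_add])
    have hone₄' : s₄.rreg .one = 1 := by
      rw [hone₄]
      change s₂.rreg .one = 1
      rw [hf₂.rreg _ (by simp) (by simp)]
      exact hr1
    obtain ⟨s₅, hr₅, hT₅, hpos₅, hi₅, hone₅, hX₅⟩ := runs_countProg u s₄ hone₄'
    let s₆ := s₅.setI .m (s₅.ireg .m + s₅.ireg .one)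
    have hsT₆ : SameTables s₅ s₆ := ⟨rfl, rfl⟩
    have hi₆ : ∀ x, x ≠ .m → s₆.ireg x = s₅.ireg x := fun x hx => by
      simp [s₆, State.setI, Function.update_of_ne hx]
    have hi₅' : ∀ x, x ≠ .t → x ≠ .v → x ≠ .lo → x ≠ .hi → x ≠ .mid → s₅.ireg x = s.ireg x :=
      fun x h2 h3 h4 h5 h6 => by rw [hi₅, hi₄ x h2 h3 h4 h5 h6, hi₃' x h2 h3 h4 h5 h6]
    have hone₅' := hi₅' .one (by simp) (by simp) (by simp) (by simp) (by simp)
    have hm₆ : s₆.ireg .m = s.ireg .m + 1 := by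
      simp only [s₆, State.setI, Function.update_self]
      rw [hi₅' .m (by simp) (by simp) (by simp) (by simp) (by simp), hone₅', h1]
    have hlen₆ : s₆.ireg .len = s.ireg .len := by
      rw [hi₆ _ (by simp), hi₅' _ (by simp) (by simp) (by simp) (by simp) (by simp)]
    have hwalk₆ : s₆.ireg .walkers = s.ireg .walkers := by
      rw [hi₆ _ (by simp), hi₅' _ (by simp) (by simp) (by simp) (by simp) (by simp)]
    have hp₁ : s₁.pos = s.pos := rfl
    have hp₃ : s₃.pos = s.pos + 1 := by
      rw [← hp₁, ← hpos₂]
      rfl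
    have hp₆ : s₆.pos = s.pos + 1 + s.ireg .len := by
      rw [← hp₃, ← hpos₄, ← hpos₅]
      rfl
    obtain ⟨s', c, hr, hc, hone, hn', hw', hX⟩ := ih s₆
      (hs.trans (((hT₂.trans hsT₃).trans hT₄).trans (hT₅.trans hsT₆)))
      (by rw [hi₆ _ (by simp), hone₅', h1]) hone₅
      (by rw [hi₆ _ (by simp), hi₅' _ (by simp) (by simp) (by simp) (by simp) (by simp), hn])
      (by rw [hwalk₆, hm₆]; omega)
    rw [hlen₆] at hc hX
    refine ⟨s', (1 + (c₂ + (1 + (c₄ + (3 + (1 + 0)))))) + c + 1,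
      .while_step (by omega) ?_ hr, ?_, hone, hn', hw'.trans hwalk₆, fun j => ?_⟩
    · have e : (Instr.icopy .v .n).exec u s = s₁ := by
        simp [Instr.exec, s₁, hn]
      have h2 := Runs.op (u := u) (.icopy .v .n) s
      rw [e] at h2
      exact .seq h2 (.seq hr₂ (.seq (.op _ _) (.seq hr₄ (.seq hr₅ (.seq (.op _ _) (.skip _))))))
    · have : ((6 * L + 8) * s.ireg .len + 6 * L + 14) * (r + 1) =
          ((6 * L + 8) * s.ireg .len + 6 * L + 14) * r +
          ((6 * L + 8) * s.ireg .len + 6 * L + 14) := by ring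
      omega
    · have hX₆ : s₆.rarr = s₅.rarr := rfl
      have hX₃ : s₃.rarr = s.rarr := hf₂.rarr
      rw [hX, Finset.sum_range_succ', hX₆, hX₅, hX₄, hX₃, hv₄, hp₃, hp₁, add_assoc,
        add_comm (ite _ _ _), hp₆]
      simp only [zero_mul, add_zero, Fin.val_inj]
      congr 2
      · refine Finset.sum_congr rfl fun k _ => ?_
        have e : s.pos + 1 + s.ireg .len + k * (s.ireg .len + 1) =
            s.pos + (k + 1) * (s.ireg .len + 1) := by ring
        rw [e]
      · simp only [add_assoc]

/-- On every tape the parallel program stops within the stated number of operations, and its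
answer is the average of the final positions of the tape walks. -/
lemma runs_parallelProg (u : Tape) :
    ∃ s' c, Runs u parallelProg s₀ s' c ∧
      c ≤ 8 * n + ((6 * L + 8) * s₀.ireg .len + 6 * L + 14) * s₀.ireg .walkers + 11 ∧
      s'.answer n = walkerAverage (N := s₀.ireg .walkers)
        (fun k => tapeWalk step (start (u (s₀.pos + k * (s₀.ireg .len + 1))))
          (fun x => u (s₀.pos + k * (s₀.ireg .len + 1) + (1 + x))) (s₀.ireg .len)) := by
  obtain ⟨s₁, hr₁, hI⟩ := runs_initProg u s₀ hM.size
  let s₂ := s₁.setI .m 0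
  have hi₂ : ∀ x, x ≠ .m → s₂.ireg x = s₁.ireg x := fun x hx => by
    simp [s₂, State.setI, Function.update_of_ne hx]
  have hi₂' : ∀ x, x ≠ .m → x ≠ .one → x ≠ .zero → x ≠ .k → s₂.ireg x = s₀.ireg x :=
    fun x h1 h3 h4 h5 => by rw [hi₂ x h1, hI.ireg x h3 h4 h5]
  have hm₂ : s₂.ireg .m = 0 := by simp [s₂, State.setI]
  have hlen₂ := hi₂' .len (by simp) (by simp) (by simp) (by simp)
  have hwalk₂ := hi₂' .walkers (by simp) (by simp) (by simp) (by simp)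
  have hsT : SameTables s₁ s₂ := ⟨rfl, rfl⟩
  obtain ⟨s₃, c₃, hr₃, hc₃, hone₃, hn₃, hw₃, hX₃⟩ := runs_walkers_loop hP hM hstep hL hν hS hstart u
    (s₀.ireg .walkers) s₂ (hI.tables.trans hsT) (by rw [hi₂ _ (by simp), hI.one]) hI.rone
    (by rw [hi₂' _ (by simp) (by simp) (by simp) (by simp), hM.size])
    (by rw [hwalk₂, hm₂, zero_add])
  rw [hlen₂] at hc₃ hX₃
  let s₄ := s₃.setR .d (s₃.ireg .walkers : ℝ)
  obtain ⟨s₅, hr₅, hX₅⟩ := runs_scaleProg u s₄ hn₃ hone₃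
  refine ⟨s₅, (3 * n + 6) + (1 + (c₃ + (1 + ((5 * n + 2) + 0)))), ?_, ?_, ?_⟩
  · exact .seq hr₁ (.seq (.op _ _) (.seq hr₃ (.seq (.op _ _) (.seq hr₅ (.skip _)))))
  · omega
  · have hd : s₄.rreg .d = (s₀.ireg .walkers : ℝ) := by
      simp only [s₄, State.setR, Function.update_self]
      rw [hw₃, hwalk₂]
    have hX₄ : s₄.rarr = s₃.rarr := rfl
    have hX₂ : s₂.rarr = s₁.rarr := rfl
    have hp₂ : s₂.pos = s₀.pos := hI.pos
    rw [walkerAverage, State.answer]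
    ext j
    simp only [vec2_apply, PiLp.smul_apply, smul_eq_mul, WithLp.ofLp_sum, Finset.sum_apply,
      posVec_apply]
    rw [hX₅ j j.2, hd, hX₄, hX₃, hX₂, hI.clear j j.2, zero_add, hp₂, div_eq_inv_mul,
      ← Fin.sum_univ_eq_sum_range (fun k => if tapeWalk step
        (start (u (s₀.pos + k * (s₀.ireg .len + 1))))
        (fun x => u (s₀.pos + k * (s₀.ireg .len + 1) + (1 + x))) (s₀.ireg .len) = j
        then (1 : ℝ) else 0)]
    congr 1
    exact Finset.sum_congr rfl fun k _ => by simp only [eq_comm]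

end Loops

end MachineWalks

/-! ### Lower bounds from chains with constant rows -/

section LowerBounds

variable {n N : ℕ} {q : Fin n → ℝ}

/-- A chain that forgets its position in one step: all rows are the same. -/
lemma const_rows_pow {p : Fin n → ℝ} (hp : ∑ j, p j = 1) {t : ℕ} (ht : 1 ≤ t) :
    (Matrix.of fun _ : Fin n => p) ^ t = Matrix.of fun _ => p := by
  induction t, ht using Nat.le_induction with
  | base => exact pow_one _
  | succ t _ ih =>
    rw [pow_succ, ih]
    ext i j
    simp [Matrix.mul_apply, ← Finset.sum_mul, hp]

lemma vecMul_const_rows {p ν : Fin n → ℝ} (hν : ν ∈ stdSimplex ℝ (Fin n)) :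
    Matrix.vecMul ν (Matrix.of fun _ : Fin n => p) = p := by
  ext j
  simp [Matrix.vecMul, dotProduct, ← Finset.sum_mul, hν.2]

lemma isPageRank_const_rows {p : Fin n → ℝ} (hp : p ∈ stdSimplex ℝ (Fin n)) :
    IsPageRank (Matrix.of fun _ : Fin n => p) p := by
  refine ⟨?_, hp, vecMul_const_rows hp⟩
  rw [Matrix.mem_rowStochastic_iff_sum]
  exact ⟨fun i j => hp.1 j, fun i => hp.2⟩

lemma spectralGap_const_rows {p : Fin n → ℝ} (hp : ∑ j, p j = 1) :
    spectralGap (Matrix.of fun _ : Fin n => p) = 1 := by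
  have hn : 0 < n := by
    rcases Nat.eq_zero_or_pos n with rfl | h
    · simp at hp
    · exact h
  have h1 : (Matrix.of fun _ : Fin n => p).map (algebraMap ℝ ℂ) =
      Matrix.vecMulVec (fun _ => 1) (fun j => (p j : ℂ)) := by
    ext i j
    simp [Matrix.vecMulVec_apply]
  have h2 : (fun _ : Fin n => (1 : ℂ)) ⬝ᵥ (fun j => (p j : ℂ)) = 1 := by
    simp only [dotProduct, one_mul]
    exact_mod_cast hp
  have h3 : ((Matrix.of fun _ : Fin n => p).map (algebraMap ℝ ℂ)).charpoly =
      Polynomial.X ^ (n - 1) * (Polynomial.X - Polynomial.C 1) := by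
    rw [h1, Matrix.charpoly_vecMulVec, h2, one_smul, Fintype.card_fin, mul_sub, ← pow_succ,
      Nat.sub_add_cancel hn, Polynomial.C_1, mul_one]
  have h4 : ((Matrix.of fun _ : Fin n => p).map (algebraMap ℝ ℂ)).charpoly.roots.erase 1 =
      Multiset.replicate (n - 1) 0 := by
    rw [h3, Polynomial.roots_mul (mul_ne_zero (pow_ne_zero _ Polynomial.X_ne_zero)
      (Polynomial.X_sub_C_ne_zero 1)), Polynomial.roots_X_sub_C, Polynomial.roots_X_pow,
      Multiset.nsmul_singleton, Multiset.erase_add_right_pos _ (Multiset.mem_singleton_self _)]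
    simp
  rw [spectralGap, h4, Multiset.map_replicate]
  have h5 : (Multiset.replicate (n - 1) ‖(0 : ℂ)‖₊).sup = 0 := by
    rw [← le_zero_iff, Multiset.sup_le]
    intro b hb
    rw [Multiset.eq_of_mem_replicate hb]
    simp
  rw [h5]
  simp

/-- The probability of an event for independent walks of a chain with constant rows. -/
lemma IndepWalks.measure_const_rows {Ω : Type*} [MeasurableSpace Ω] {μ : Measure Ω}
    [IsProbabilityMeasure μ] {p ν : Fin n → ℝ} {X : Fin N → ℕ → Ω → Fin n}
    (hp : ∑ j, p j = 1) (hν : ν ∈ stdSimplex ℝ (Fin n))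
    (h : IndepWalks μ (Matrix.of fun _ : Fin n => p) ν N X) {t : ℕ} (ht : 1 ≤ t)
    (A : Set (Fin N → Fin n)) :
    μ.real {ω | (fun k => X k t ω) ∈ A} = iidExp p N (A.indicator 1) := by
  have h1 := h.law_eq t
  rw [const_rows_pow hp ht, vecMul_const_rows hν] at h1
  exact measureReal_eq_iidExp μ (h.measurable t) h1 A

lemma exp_le_cosh {θ : ℝ} (h0 : 0 ≤ θ) (h1 : θ ≤ 1) : Real.exp (θ ^ 2 / 4) ≤ Real.cosh θ := by
  have h2 : Real.exp (θ ^ 2 / 4) ≤ 1 + θ ^ 2 / 2 := by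
    refine (Real.exp_bound_div_one_sub_of_interval (by positivity) (by nlinarith)).trans ?_
    rw [div_le_iff₀ (by nlinarith)]
    nlinarith [mul_nonneg (sq_nonneg θ) (by nlinarith : 0 ≤ 1 - θ ^ 2 / 2)]
  refine h2.trans ?_
  have h3 : θ = 2 * (θ / 2) := by ring
  have h4 : θ / 2 ≤ Real.sinh (θ / 2) := Real.self_le_sinh_iff.2 (by positivity)
  have h5 : (θ / 2) ^ 2 ≤ Real.sinh (θ / 2) ^ 2 := by gcongr
  rw [h3, Real.cosh_two_mul, Real.cosh_sq]
  nlinarith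

/-- A lower bound for the tail of a sum of independent signs, from the Cauchy–Schwarz inequality
for `cosh (θ S)` restricted to the tail, with `θ = 8 τ`: its mean is at least `exp (16 N τ²)`, its
second moment at most `exp (128 N τ²)`, and outside the tail it is at most half of the mean. The
hypothesis on `g` says that `g` is a random sign under `q`. -/
lemma le_iidExp_tail (hq : q ∈ stdSimplex ℝ (Fin n)) (g : Fin n → ℝ)
    (hg : ∀ θ, ∑ j, q j * Real.exp (θ * g j) = Real.cosh θ) {τ : ℝ} (hτ : 0 < τ) (hτ1 : τ ≤ 1 / 16)
    (hN : 1 ≤ N * τ ^ 2) :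
    Real.exp (-(96 * (N * τ ^ 2))) / 4 ≤
      iidExp q N ({x | N * τ ≤ |∑ k, g (x k)|}.indicator 1) := by
  set A : Set (Fin N → Fin n) := {x | N * τ ≤ |∑ k, g (x k)|} with hA
  set y := N * τ ^ 2 with hy
  have hmgf : ∀ θ, iidExp q N (fun x => Real.cosh (θ * ∑ k, g (x k))) = Real.cosh θ ^ N := by
    intro θ
    have h1 : ∀ θ, iidExp q N (fun x => Real.exp (θ * ∑ k, g (x k))) = Real.cosh θ ^ N := by
      intro θ
      simp only [Finset.mul_sum, Real.exp_sum]
      rw [iidExp_prod (fun j => Real.exp (θ * g j)), hg]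
    have h2 : ∀ x : Fin N → Fin n, Real.cosh (θ * ∑ k, g (x k)) =
        1 / 2 * Real.exp (θ * ∑ k, g (x k)) + 1 / 2 * Real.exp (-θ * ∑ k, g (x k)) := fun x => by
      rw [Real.cosh_eq, neg_mul]
      ring
    simp only [h2]
    rw [iidExp_add, iidExp_const_mul, iidExp_const_mul, h1, h1, Real.cosh_neg]
    ring
  have hlow : Real.exp (16 * y) ≤ Real.cosh (8 * τ) ^ N := by
    have h1 := exp_le_cosh (θ := 8 * τ) (by positivity) (by linarith)
    calc Real.exp (16 * y) = Real.exp ((8 * τ) ^ 2 / 4) ^ N := by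
          rw [← Real.exp_nat_mul, hy]
          congr 1
          ring
      _ ≤ _ := by gcongr
  have hup : Real.cosh (2 * (8 * τ)) ^ N ≤ Real.exp (128 * y) := by
    calc _ ≤ Real.exp ((2 * (8 * τ)) ^ 2 / 2) ^ N := by
          gcongr
          exact Real.cosh_le_exp_half_sq _
      _ = _ := by
          rw [← Real.exp_nat_mul, hy]
          congr 1
          ring
  -- outside the tail `cosh (θ S)` is at most half of its mean
  have hmid : Real.cosh (8 * y) ≤ Real.exp (16 * y) / 2 := by
    have h1 : Real.cosh (8 * y) ≤ Real.exp (8 * y) := by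
      rw [Real.cosh_eq]
      have := Real.exp_le_exp.2 (show -(8 * y) ≤ 8 * y by linarith)
      linarith
    have h2 : 2 ≤ Real.exp (8 * y) := by
      have := Real.add_one_le_exp (8 * y)
      linarith
    have h3 : Real.exp (16 * y) = Real.exp (8 * y) * Real.exp (8 * y) := by
      rw [← Real.exp_add]
      congr 1
      ring
    rw [h3]
    nlinarith [Real.exp_pos (8 * y)]
  set Z : (Fin N → Fin n) → ℝ := fun x => Real.cosh (8 * τ * ∑ k, g (x k)) with hZ
  have h1 : Real.cosh (8 * τ) ^ N ≤
      Real.cosh (8 * y) + iidExp q N (fun x => Z x * A.indicator 1 x) := by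
    rw [← hmgf, ← iidExp_const hq (N := N) (Real.cosh (8 * y)), ← iidExp_add]
    refine iidExp_mono hq fun x => ?_
    by_cases hx : x ∈ A
    · simp only [Set.indicator_of_mem hx, Pi.one_apply, mul_one]
      linarith [Real.cosh_pos (8 * y)]
    · simp only [Set.indicator_of_notMem hx, mul_zero, add_zero]
      have hx' : |∑ k, g (x k)| < N * τ := not_le.1 hx
      rw [Real.cosh_le_cosh, abs_mul, abs_of_pos (by positivity : 0 < 8 * τ),
        abs_of_nonneg (by linarith : 0 ≤ 8 * y)]
      have : 8 * y = 8 * τ * (N * τ) := by rw [hy]; ring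
      rw [this]
      gcongr
  have h2 := iidExp_mul_sq_le hq Z (A.indicator 1)
  have h3 : iidExp q N (fun x => Z x ^ 2) ≤ Real.exp (128 * y) := by
    refine le_trans ?_ hup
    rw [← hmgf]
    refine iidExp_mono hq fun x => ?_
    have e : 2 * (8 * τ) * ∑ k, g (x k) = 2 * (8 * τ * ∑ k, g (x k)) := by ring
    rw [e, Real.cosh_two_mul]
    linarith [sq_nonneg (Real.sinh (8 * τ * ∑ k, g (x k)))]
  have h4 : ∀ x, (A.indicator 1 x : ℝ) ^ 2 = A.indicator 1 x := fun x => by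
    by_cases hx : x ∈ A <;> simp [hx]
  simp only [h4] at h2
  set p := iidExp q N (A.indicator 1) with hp
  have h0 : 0 ≤ p := by
    have := iidExp_mono hq (F := fun _ => 0) (G := (A.indicator 1 : (Fin N → Fin n) → ℝ))
      fun x => Set.indicator_nonneg (fun _ _ => zero_le_one) x
    rwa [iidExp_const hq] at this
  have h5 : Real.exp (16 * y) / 2 ≤ iidExp q N (fun x => Z x * A.indicator 1 x) := by linarith
  have h6 : (Real.exp (16 * y) / 2) ^ 2 ≤ Real.exp (128 * y) * p :=
    (pow_le_pow_left₀ (by positivity) h5 2).trans (h2.trans (mul_le_mul_of_nonneg_right h3 h0))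
  have h7 : (Real.exp (16 * y) / 2) ^ 2 = Real.exp (128 * y) * (Real.exp (-(96 * y)) / 4) := by
    rw [div_pow, ← mul_div_assoc, ← Real.exp_add, ← Real.exp_nat_mul]
    norm_num
    ring
  rw [h7] at h6
  exact le_of_mul_le_mul_left h6 (Real.exp_pos _)

/-- Half of the mass at the first vertex, the rest uniform. -/
noncomputable def halfLaw (n : ℕ) (j : Fin n) : ℝ :=
  if (j : ℕ) = 0 then 1 / 2 else 1 / (2 * (n - 1))

lemma sum_halfLaw_mul (hn : 2 ≤ n) (a b : ℝ) :
    ∑ j : Fin n, halfLaw n j * (if (j : ℕ) = 0 then a else b) = (a + b) / 2 := by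
  obtain ⟨m, rfl⟩ : ∃ m, n = m + 2 := ⟨n - 2, by omega⟩
  rw [Fin.sum_univ_succ]
  have hm : (m : ℝ) + 1 ≠ 0 := by positivity
  simp [halfLaw]
  have e : (m : ℝ) + 2 - 1 = m + 1 := by ring
  rw [e]
  field_simp

lemma halfLaw_pos (hn : 2 ≤ n) (j : Fin n) : 0 < halfLaw n j := by
  have : (2 : ℝ) ≤ n := by exact_mod_cast hn
  rw [halfLaw]
  split_ifs
  · norm_num
  · exact div_pos one_pos (by linarith)

lemma halfLaw_mem (hn : 2 ≤ n) : halfLaw n ∈ stdSimplex ℝ (Fin n) := by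
  refine ⟨fun j => (halfLaw_pos hn j).le, ?_⟩
  have := sum_halfLaw_mul hn 1 1
  simp only [ite_self, mul_one] at this
  rw [this]
  norm_num

lemma log_halfLaw_inv_le (hn : 2 ≤ n) (j : Fin n) :
    Real.log (halfLaw n j)⁻¹ ≤ 2 * Real.log n := by
  have h2 : (2 : ℝ) ≤ n := by exact_mod_cast hn
  have h3 : (halfLaw n j)⁻¹ ≤ (n : ℝ) ^ 2 := by
    rw [halfLaw]
    split_ifs
    · norm_num
      nlinarith
    · rw [one_div, inv_inv]
      nlinarith [sq_nonneg ((n : ℝ) - 1)]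
  have h4 := Real.log_le_log (inv_pos.2 (halfLaw_pos hn j)) h3
  rwa [Real.log_pow, Nat.cast_ofNat] at h4

lemma norm_coord_le {n : ℕ} (v : EuclideanSpace ℝ (Fin n)) (i : Fin n) : |v i| ≤ ‖v‖ := by
  simpa using PiLp.norm_apply_le v i

/-- Too few walks with the law `halfLaw` have a large error with a noticeable probability: the
error at the first vertex is a random walk with steps `±1`. -/
lemma lt_iidExp_halfLaw (hn : 2 ≤ n) {ε σ : ℝ} (hε : 0 < ε) (hε1 : ε ≤ Real.exp (-200))
    (hσ : 0 < σ) (hσ1 : σ ≤ Real.exp (-200)) (hN : 0 < N)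
    (hNb : (N : ℝ) ≤ Real.exp (-200) * walkerBound ε σ) :
    σ < iidExp (halfLaw n) N
      ({x | ε ≤ ‖walkerAverage x - vec2 (halfLaw n)‖}.indicator 1) := by
  have hN' : (0 : ℝ) < N := by exact_mod_cast hN
  have hq := halfLaw_mem hn
  set L := Real.log σ⁻¹ with hL
  have hσL : σ = Real.exp (-L) := by rw [hL, Real.log_inv, neg_neg, Real.exp_log hσ]
  have hL200 : 200 ≤ L := by
    rw [hσL, Real.exp_le_exp] at hσ1
    linarith
  have hexp : Real.exp (-200) ≤ 1 / 40000 := by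
    have h1 := Real.add_one_le_exp 50
    have h2 : Real.exp 200 = Real.exp 50 ^ 4 := by rw [← Real.exp_nat_mul]; norm_num
    have h3 : (51 : ℝ) ^ 4 ≤ Real.exp 50 ^ 4 := by gcongr; linarith
    rw [Real.exp_neg, h2, ← one_div]
    exact one_div_le_one_div_of_le (by norm_num) (by linarith)
  let i₀ : Fin n := ⟨0, by omega⟩
  let g : Fin n → ℝ := fun j => if (j : ℕ) = 0 then 1 else -1
  have hcoord : ∀ x : Fin N → Fin n,
      (walkerAverage x - vec2 (halfLaw n)) i₀ = (∑ k, g (x k)) / (2 * N) := fun x => by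
    have h1 : ∀ j : Fin n, posVec j i₀ = (g j + 1) / 2 := fun j => by
      rw [posVec_apply]
      by_cases hj : (j : ℕ) = 0
      · rw [if_pos (Fin.ext hj.symm)]
        simp [g, hj]
      · rw [if_neg fun h => hj (by rw [← h])]
        simp [g, hj]
    simp only [walkerAverage, PiLp.sub_apply, PiLp.smul_apply, smul_eq_mul, WithLp.ofLp_sum,
      Finset.sum_apply, h1, vec2_apply]
    rw [← Finset.sum_div, Finset.sum_add_distrib]
    simp [halfLaw, i₀]
    field_simp
    ring
  have hevent : ∀ x : Fin N → Fin n, 2 * N * ε ≤ |∑ k, g (x k)| →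
      ε ≤ ‖walkerAverage x - vec2 (halfLaw n)‖ := fun x hx => by
    refine le_trans ?_ (norm_coord_le _ i₀)
    rw [hcoord, abs_div, abs_of_pos (by positivity : (0 : ℝ) < 2 * N), le_div_iff₀ (by positivity)]
    linarith
  have hmono : ∀ B : Set (Fin N → Fin n), (∀ x ∈ B, 2 * N * ε ≤ |∑ k, g (x k)|) →
      iidExp (halfLaw n) N (B.indicator 1) ≤ iidExp (halfLaw n) N
      ({x | ε ≤ ‖walkerAverage x - vec2 (halfLaw n)‖}.indicator 1) := fun B hB =>
    iidExp_mono hq fun x => Set.indicator_le_indicator_of_subset (fun x hx => hevent x (hB x hx))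
      (fun _ => zero_le_one) x
  -- the tail bound needs `τ ≤ 1 / 16` for some `τ ≥ 1 / √N`, hence `N ≥ 256`
  rcases lt_or_ge N 256 with hsmall | hlarge
  · -- all walks end at the first vertex
    refine lt_of_lt_of_le ?_ (hmono {fun _ => i₀} ?_)
    · have h1 : iidExp (halfLaw n) N (({fun _ => i₀} : Set (Fin N → Fin n)).indicator 1) =
          (1 / 2) ^ N := by
        rw [iidExp, Finset.sum_eq_single (fun _ => i₀)]
        · simp [halfLaw, i₀]
        · intro x _ hx
          simp [hx]
        · simp
      rw [h1]
      have h2 : (1 / 2 : ℝ) ^ 256 ≤ (1 / 2) ^ N :=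
        pow_le_pow_of_le_one (by norm_num) (by norm_num) hsmall.le
      refine lt_of_lt_of_le ?_ h2
      refine hσ1.trans_lt ?_
      have h3 : Real.log 2 < 0.7 := lt_trans Real.log_two_lt_d9 (by norm_num)
      have h4 : (1 / 2 : ℝ) ^ 256 = Real.exp (-(256 * Real.log 2)) := by
        rw [Real.exp_neg, mul_comm, Real.exp_mul, Real.exp_log (by norm_num)]
        norm_num
      rw [h4, Real.exp_lt_exp]
      linarith
    · rintro x rfl
      simp only [g, i₀, if_true, Finset.sum_const, Finset.card_univ, Fintype.card_fin,
        nsmul_eq_mul, mul_one, Nat.abs_cast]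
      nlinarith
  · set τ := max (2 * ε) (1 / Real.sqrt N) with hτ
    have hN256 : (256 : ℝ) ≤ N := by exact_mod_cast hlarge
    have hsq : Real.sqrt N ^ 2 = N := Real.sq_sqrt hN'.le
    have hs16 : 16 ≤ Real.sqrt N := Real.le_sqrt_of_sq_le (by norm_num; exact hlarge)
    have hτ0 : 0 < τ := lt_of_lt_of_le (by positivity) (le_max_left _ _)
    have hτ1 : τ ≤ 1 / 16 := by
      refine max_le (by linarith) ?_
      exact one_div_le_one_div_of_le (by norm_num) hs16
    have hNs : N * (1 / Real.sqrt N) ^ 2 = 1 := by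
      rw [div_pow, hsq, one_pow, mul_one_div_cancel hN'.ne']
    have hy1 : 1 ≤ N * τ ^ 2 := by
      rw [← hNs]
      gcongr
      exact le_max_right _ _
    have hNε : N * ε ^ 2 ≤ Real.exp (-200) * (4 + 6 * L) := by
      have h1 := mul_le_mul_of_nonneg_right hNb (sq_nonneg ε)
      rwa [walkerBound, mul_assoc, div_mul_cancel₀ _ (by positivity)] at h1
    have hy2 : N * τ ^ 2 ≤ 4 * (N * ε ^ 2) + 1 := by
      rcases max_choice (2 * ε) (1 / Real.sqrt N) with h | h
      · rw [hτ, h]; linarith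
      · rw [hτ, h, hNs]
        have : 0 ≤ N * ε ^ 2 := by positivity
        linarith
    -- the tail probability is at least `exp (-96 (4 N ε² + 1)) / 4`, and `N ε²` is at most `10⁻³ L`
    have htail := le_iidExp_tail hq g (fun θ => ?_) hτ0 hτ1 hy1
    · refine lt_of_lt_of_le ?_ (htail.trans (hmono _ fun x hx => le_trans ?_ hx))
      · rw [hσL, lt_div_iff₀ (by norm_num)]
        have h4 : (4 : ℝ) ≤ Real.exp 3 := by linarith [Real.add_one_le_exp 3]
        refine (mul_le_mul_of_nonneg_left h4 (Real.exp_nonneg _)).trans_lt ?_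
        rw [← Real.exp_add, Real.exp_lt_exp]
        have h5 : Real.exp (-200) * (4 + 6 * L) ≤ 1 / 40000 * (4 + 6 * L) := by gcongr
        nlinarith
      · have := mul_le_mul_of_nonneg_left (le_max_left (2 * ε) (1 / Real.sqrt N)) hN'.le
        linarith
    · have h1 : ∀ j : Fin n, Real.exp (θ * g j) =
          if (j : ℕ) = 0 then Real.exp θ else Real.exp (-θ) := fun j => by
        simp only [g]
        split_ifs <;> simp
      simp only [h1]
      rw [sum_halfLaw_mul hn, Real.cosh_eq]

/-- The variance of the squared norm of a sum of centred independent vectors of equal length. -/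
lemma iidExp_norm_sum_sq_variance {E : Type*} [NormedAddCommGroup E] [InnerProductSpace ℝ E]
    (hq : q ∈ stdSimplex ℝ (Fin n)) (g : Fin n → E) (hg : ∑ j, q j • g j = 0) {ρ β : ℝ}
    (hβ : 0 ≤ β) (hρ : ∀ j, ‖g j‖ ^ 2 = ρ)
    (h : ∀ v, ∑ j, q j * inner ℝ v (g j) ^ 2 ≤ β * ‖v‖ ^ 2) :
    iidExp q N (fun x => (‖∑ k, g (x k)‖ ^ 2 - N * ρ) ^ 2) ≤ 2 * β * ρ * N ^ 2 := by
  have hρ0 : 0 ≤ ρ := by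
    have hne : Nonempty (Fin n) := by
      by_contra hcon
      rw [not_nonempty_iff] at hcon
      simpa using hq.2
    obtain ⟨j⟩ := hne
    rw [← hρ j]
    positivity
  induction N with
  | zero => simp [iidExp_zero]
  | succ N ih =>
    rw [iidExp_succ]
    have h1 : ∀ x : Fin N → Fin n, ∑ j, q j *
        (‖∑ k, g ((Fin.cons j x : Fin (N + 1) → Fin n) k)‖ ^ 2 - (N + 1 : ℕ) * ρ) ^ 2 ≤
        (‖∑ k, g (x k)‖ ^ 2 - N * ρ) ^ 2 + 4 * β * ‖∑ k, g (x k)‖ ^ 2 := fun x => by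
      set S := ∑ k, g (x k) with hS
      have h2 : ∀ j, q j *
          (‖∑ k, g ((Fin.cons j x : Fin (N + 1) → Fin n) k)‖ ^ 2 - (N + 1 : ℕ) * ρ) ^ 2 =
          q j * (‖S‖ ^ 2 - N * ρ) ^ 2 + 4 * (‖S‖ ^ 2 - N * ρ) * inner ℝ S (q j • g j) +
            4 * (q j * inner ℝ S (g j) ^ 2) := fun j => by
        simp only [Fin.sum_univ_succ, Fin.cons_zero, Fin.cons_succ, norm_add_sq_real, hρ, ← hS]
        rw [real_inner_smul_right, real_inner_comm]
        push_cast
        ring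
      simp only [h2, Finset.sum_add_distrib]
      rw [← Finset.sum_mul, hq.2, ← Finset.mul_sum, ← inner_sum, hg, inner_zero_right,
        ← Finset.mul_sum]
      linarith [h S]
    refine (iidExp_mono hq h1).trans ?_
    rw [iidExp_add, iidExp_const_mul, iidExp_norm_sum_sq hq g, hg]
    simp only [hρ, ← Finset.sum_mul, hq.2, norm_zero]
    have h3 : 0 ≤ β * ρ := mul_nonneg hβ hρ0
    push_cast
    nlinarith

lemma uniform_mem (hn : 0 < n) : (fun _ : Fin n => (n : ℝ)⁻¹) ∈ stdSimplex ℝ (Fin n) := by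
  have : (n : ℝ) ≠ 0 := by positivity
  refine ⟨fun j => by positivity, by simp [this]⟩

/-- With the uniform law and at most `1 / (4 ε²)` walks, the error is at least `ε` except with
probability of the order `1 / n`, by Chebyshev's inequality for the squared error. -/
lemma le_iidExp_uniform (hn : 2 ≤ n) {ε : ℝ} (hε : 0 < ε) (hN : 0 < N)
    (hNε : (N : ℝ) ≤ 1 / 4 / ε ^ 2) :
    1 - 32 / n ≤ iidExp (fun _ => (n : ℝ)⁻¹) N
      ({x : Fin N → Fin n | ε ≤ ‖walkerAverage x - vec2 (fun _ => (n : ℝ)⁻¹)‖}.indicator 1) := by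
  have hn2 : (2 : ℝ) ≤ n := by exact_mod_cast hn
  have hn0 : (n : ℝ) ≠ 0 := by positivity
  have hN' : (0 : ℝ) < N := by exact_mod_cast hN
  have hq := uniform_mem (n := n) (by omega)
  set v := vec2 (fun _ : Fin n => (n : ℝ)⁻¹) with hv
  have hsum : ∑ j : Fin n, (n : ℝ)⁻¹ • (posVec j - v) = 0 := by
    have h1 := sum_smul_posVec (fun _ : Fin n => (n : ℝ)⁻¹)
    rw [← hv] at h1
    simp only [smul_sub, Finset.sum_sub_distrib, h1]
    simp [← Nat.cast_smul_eq_nsmul ℝ, smul_smul, hn0]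
  have hinner : ∀ (w : EuclideanSpace ℝ (Fin n)) j,
      inner ℝ w (posVec j - v) = w j - (n : ℝ)⁻¹ * ∑ i, w i := fun w j => by
    rw [inner_sub_right]
    congr 1
    · simp [posVec, EuclideanSpace.inner_single_right]
    · simp [hv, vec2, EuclideanSpace.inner_eq_star_dotProduct, dotProduct, Finset.mul_sum]
  have hρ : ∀ j : Fin n, ‖posVec j - v‖ ^ 2 = 1 - (n : ℝ)⁻¹ := fun j => by
    rw [← real_inner_self_eq_norm_sq, hinner]
    have : ∑ i, (posVec j - v) i = 0 := by
      simp [posVec_apply, hv, vec2_apply, hn0]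
    rw [this]
    simp [posVec_apply, hv, vec2_apply]
  have hβ : ∀ w : EuclideanSpace ℝ (Fin n), ∑ j, (n : ℝ)⁻¹ * inner ℝ w (posVec j - v) ^ 2 ≤
      (n : ℝ)⁻¹ * ‖w‖ ^ 2 := fun w => by
    rw [← Finset.mul_sum]
    refine mul_le_mul_of_nonneg_left ?_ (by positivity)
    set s := ∑ i, w i with hs
    have h1 : ∀ j, inner ℝ w (posVec j - v) ^ 2 = w j ^ 2 - 2 * (n : ℝ)⁻¹ * s * w j +
        ((n : ℝ)⁻¹ * s) ^ 2 := fun j => by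
      rw [hinner]
      ring
    simp only [h1, Finset.sum_add_distrib, Finset.sum_sub_distrib, ← Finset.mul_sum, ← hs,
      Finset.sum_const, Finset.card_univ, Fintype.card_fin, nsmul_eq_mul]
    rw [EuclideanSpace.norm_sq_eq]
    simp only [Real.norm_eq_abs, sq_abs]
    have h2 : (n : ℝ) * ((n : ℝ)⁻¹ * s) ^ 2 = (n : ℝ)⁻¹ * s ^ 2 := by field_simp
    have h3 : 0 ≤ (n : ℝ)⁻¹ * s ^ 2 := by positivity
    rw [h2]
    linarith
  have hvar := iidExp_norm_sum_sq_variance (N := N) hq (fun j => posVec j - v) hsum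
    (by positivity) hρ hβ
  set A : Set (Fin N → Fin n) := {x | ε ≤ ‖walkerAverage x - v‖} with hA
  have hdev : ∀ x, 1 - A.indicator 1 x ≤
      16 / (N : ℝ) ^ 2 * (‖∑ k, (posVec (x k) - v)‖ ^ 2 - N * (1 - (n : ℝ)⁻¹)) ^ 2 := fun x => by
    by_cases hx : x ∈ A
    · rw [Set.indicator_of_mem hx, Pi.one_apply, sub_self]
      positivity
    · rw [Set.indicator_of_notMem hx, sub_zero]
      have hx' : ‖walkerAverage x - v‖ < ε := not_le.1 hx
      have h1 : walkerAverage x - v = (N : ℝ)⁻¹ • ∑ k, (posVec (x k) - v) := by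
        rw [Finset.sum_sub_distrib, smul_sub, walkerAverage]
        simp [← Nat.cast_smul_eq_nsmul ℝ, smul_smul, hN'.ne']
      rw [h1, norm_smul, norm_inv, Real.norm_natCast, inv_mul_lt_iff₀ hN'] at hx'
      have h2 : ‖∑ k, (posVec (x k) - v)‖ ^ 2 ≤ (N * ε) ^ 2 := by gcongr
      have h3 : N * ε ^ 2 ≤ 1 / 4 := by rwa [le_div_iff₀ (by positivity)] at hNε
      have h4 : (n : ℝ)⁻¹ ≤ 1 / 2 := by
        rw [inv_le_comm₀ (by positivity) (by norm_num)]
        norm_num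
        exact hn
      have h5 : N / 4 ≤ N * (1 - (n : ℝ)⁻¹) - ‖∑ k, (posVec (x k) - v)‖ ^ 2 := by nlinarith
      have h6 : (N / 4 : ℝ) ^ 2 ≤
          (N * (1 - (n : ℝ)⁻¹) - ‖∑ k, (posVec (x k) - v)‖ ^ 2) ^ 2 := by gcongr
      have h7 : (1 : ℝ) = 16 / (N : ℝ) ^ 2 * (N / 4) ^ 2 := by field_simp; norm_num
      rw [← neg_sq (‖∑ k, (posVec (x k) - v)‖ ^ 2 - _), neg_sub]
      exact h7.trans_le (mul_le_mul_of_nonneg_left h6 (by positivity))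
  have h8 := iidExp_mono hq hdev
  have h9 : iidExp (fun _ : Fin n => (n : ℝ)⁻¹) N (fun x => 1 - A.indicator 1 x) =
      1 - iidExp (fun _ => (n : ℝ)⁻¹) N (A.indicator 1) := by
    have h10 : ∀ x : Fin N → Fin n, (1 : ℝ) - A.indicator 1 x = 1 + -1 * A.indicator 1 x :=
      fun x => by ring
    simp only [h10]
    rw [iidExp_add, iidExp_const hq, iidExp_const_mul]
    ring
  rw [h9, iidExp_const_mul] at h8
  have h11 : 16 / (N : ℝ) ^ 2 * (2 * (n : ℝ)⁻¹ * (1 - (n : ℝ)⁻¹) * N ^ 2) ≤ 32 / n := by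
    have e : 16 / (N : ℝ) ^ 2 * (2 * (n : ℝ)⁻¹ * (1 - (n : ℝ)⁻¹) * N ^ 2) =
        32 / n * (1 - (n : ℝ)⁻¹) := by field_simp; ring
    rw [e]
    refine mul_le_of_le_one_right (by positivity) ?_
    have : (0 : ℝ) ≤ (n : ℝ)⁻¹ := by positivity
    linarith
  have h12 := mul_le_mul_of_nonneg_left hvar (by positivity : 0 ≤ 16 / (N : ℝ) ^ 2)
  linarith

end LowerBounds

/-! ### Accuracy of the programs -/

section Programs

variable {n : ℕ} {P : Matrix (Fin n) (Fin n) ℝ} {ν : Fin n → ℝ} {s : State}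

lemma IsRandomWalk.comp_measurePreserving {Ω Ω' : Type*} [MeasurableSpace Ω] [MeasurableSpace Ω']
    {μ : Measure Ω} {μ' : Measure Ω'} {X : ℕ → Ω → Fin n} (h : IsRandomWalk μ P ν X)
    {f : Ω' → Ω} (hf : MeasurePreserving f μ' μ) :
    IsRandomWalk μ' P ν (fun t ω => X t (f ω)) := by
  refine ⟨fun t => (h.measurable t).comp hf.measurable, fun t x => ?_⟩
  rw [← h.law t x]
  have hm : MeasurableSet {ω | ∀ s ≤ t, X s ω = x s} := by
    have : {ω | ∀ s ≤ t, X s ω = x s} = ⋂ s, ⋂ (_ : s ≤ t), X s ⁻¹' {x s} := by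
      ext ω; simp
    rw [this]
    exact MeasurableSet.iInter fun s => MeasurableSet.iInter fun _ =>
      h.measurable s (measurableSet_singleton _)
  exact hf.measureReal_preimage hm.nullMeasurableSet

/-- A bound for the error of the estimator that holds for every random walk from the first vertex
holds for the output of the program. -/
lemma StoresMatrix.measure_mcmcProg_ge (hM : StoresMatrix s P)
    (hP : P ∈ Matrix.rowStochastic ℝ (Fin n)) (hn : 0 < n) (hle : s.ireg .burn ≤ s.ireg .len)
    {p : Fin n → ℝ} {ε a : ℝ}
    (hwalk : ∀ X : ℕ → Tape → Fin n, IsRandomWalk tapeMeasure P (Pi.single ⟨0, hn⟩ 1) X →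
      a ≤ tapeMeasure.real {u | ‖visitAverage (s.ireg .burn) (s.ireg .len) (fun t => X t u) -
        vec2 p‖ ≤ ε}) :
    a ≤ tapeMeasure.real {u | ∃ (s' : State) (c : ℕ), Runs u mcmcProg s s' c ∧
      ‖s'.answer n - vec2 p‖ ≤ ε} := by
  obtain ⟨step, hstep, hm, hv⟩ := hM.exists_step hP
  refine (hwalk _ ((isRandomWalk_tapeWalk hm hv ⟨0, hn⟩).comp_measurePreserving
    ⟨measurable_shift_tape s.pos, map_shift_tapeMeasure s.pos⟩)).trans (measureReal_mono ?_)
  intro u hu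
  obtain ⟨s', c, hr, -, hans⟩ := runs_mcmcProg hP hM hstep (Nat.le_pow_clog one_lt_two n) u hn
  refine ⟨s', c, hr, ?_⟩
  rw [hans hle]
  exact hu

/-- The parallel program is accurate: its walks use disjoint blocks of the tape, so their final
positions are an independent sample. -/
lemma StoresMatrix.measure_parallelProg_ge (hM : StoresMatrix s P)
    (hP : P ∈ Matrix.rowStochastic ℝ (Fin n)) (hν : ν ∈ stdSimplex ℝ (Fin n))
    (hS : StoresRow s n ν) {p : Fin n → ℝ} {ε σ : ℝ} (hε : 0 < ε) (hσ : 0 < σ) (hσ1 : σ < 1)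
    (hN : walkerBound ε σ ≤ s.ireg .walkers) (hmix : MixedAt P p (ε / 2) (s.ireg .len)) :
    1 - σ ≤ tapeMeasure.real {u | ∃ (s' : State) (c : ℕ), Runs u parallelProg s s' c ∧
      ‖s'.answer n - vec2 p‖ ≤ ε} := by
  obtain ⟨step, hstep, hm, hv⟩ := hM.exists_step hP
  obtain ⟨start, hstart, hms, hvs⟩ := hS.exists_sampler hν
  let Y : Tape → Fin (s.ireg .walkers) → Fin n := fun u k =>
    tapeWalk step (start (u (s.pos + k * (s.ireg .len + 1))))
      (fun x => u (s.pos + k * (s.ireg .len + 1) + (1 + x))) (s.ireg .len)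
  have hY : Measurable Y := measurable_pi_lambda _ fun k => measurable_tapeWalk hm
    ((measurable_of_forall_measurableSet_eq hms).comp
      (measurable_pi_apply (s.pos + k * (s.ireg .len + 1))))
    (measurable_pi_lambda _ fun x =>
      measurable_pi_apply (s.pos + k * (s.ireg .len + 1) + (1 + x))) (s.ireg .len)
  have hA := measureReal_eq_iidExp tapeMeasure hY
    (tapeMeasure_real_blocks hm hv hms hvs s.pos (s.ireg .len) (s.ireg .walkers))
    {x | ε ≤ ‖walkerAverage x - vec2 p‖}
  have hbad := iidExp_walkers_le (vecMul_pow_mem_stdSimplex hP hν (s.ireg .len)) p hε hσ hσ1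
    (hmix.norm_sub_le hν) hN
  rw [← hA] at hbad
  have hcov : (Set.univ : Set Tape) ⊆
      {u | ∃ (s' : State) (c : ℕ), Runs u parallelProg s s' c ∧ ‖s'.answer n - vec2 p‖ ≤ ε} ∪
      {u | Y u ∈ {x | ε ≤ ‖walkerAverage x - vec2 p‖}} := by
    intro u _
    by_cases hu : ε ≤ ‖walkerAverage (Y u) - vec2 p‖
    · exact Or.inr hu
    · left
      obtain ⟨s', c, hr, -, hans⟩ :=
        runs_parallelProg hP hM hstep (Nat.le_pow_clog one_lt_two n) hν hS hstart u
      refine ⟨s', c, hr, ?_⟩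
      rw [hans]
      exact (not_le.1 hu).le
  have h3 := (measureReal_mono hcov (measure_ne_top tapeMeasure _)).trans (measureReal_union_le _ _)
  rw [probReal_univ] at h3
  linarith

end Programs

/-! ### Burn-in time, number of steps and operation counts -/

section Constants

variable {n : ℕ}

lemma half_le_log (hn : 2 ≤ n) : 1 / 2 ≤ Real.log n := by
  have h1 : Real.log 2 ≤ Real.log n := Real.log_le_log two_pos (by exact_mod_cast hn)
  linarith [Real.log_two_gt_d9]

lemma clog_le_log (hn : 2 ≤ n) : (Nat.clog 2 n : ℝ) ≤ 4 * Real.log n := by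
  have h1 : ((Nat.clog 2 n : ℕ) : ℝ) ≤ Nat.log 2 n + 1 := by
    exact_mod_cast Nat.clog_le_of_le_pow (Nat.lt_pow_succ_log_self one_lt_two n).le
  have h2 : ((2 : ℝ) ^ Nat.log 2 n) ≤ n := by exact_mod_cast Nat.pow_log_le_self 2 (by omega)
  have h3 := Real.log_le_log (by positivity) h2
  rw [Real.log_pow] at h3
  have h4 := half_le_log hn
  nlinarith [Real.log_two_gt_d9, Nat.cast_nonneg (α := ℝ) (Nat.log 2 n)]

lemma log_natCast_div (hn : 2 ≤ n) {δ : ℝ} (hδ : 0 < δ) :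
    Real.log (n / δ) = Real.log n - Real.log δ :=
  Real.log_div (by positivity) hδ.ne'

/-- The lower bound `n ^ (-κ)` for the entries of the PageRank vector, with `n ^ (κ / 2)` written as
an exponential. -/
lemma inv_le_exp_sq {κ x : ℝ} (hx : 0 < x) (h : Real.log x⁻¹ ≤ κ * Real.log n) :
    x⁻¹ ≤ Real.exp (κ / 2 * Real.log n) ^ 2 := by
  rw [← Real.exp_nat_mul, ← Real.log_le_iff_le_exp (inv_pos.2 hx)]
  refine h.trans (le_of_eq ?_)
  push_cast
  ring

/-- A reversible chain with spectral gap at least `α` is mixed after the burn-in time. -/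
lemma mixedAt_of_burnIn_le {P : Matrix (Fin n) (Fin n) ℝ} {p : Fin n → ℝ} {α κ : ℝ} (hκ : 0 < κ)
    (hn : 2 ≤ n) (hPR : IsPageRank P p) (hrev : IsReversible P p)
    (hp : ∀ i, 0 < p i ∧ Real.log (p i)⁻¹ ≤ κ * Real.log n) (hα : 0 < α)
    (hgap : α ≤ spectralGap P) {δ : ℝ} (hδ : 0 < δ) (hδ1 : δ ≤ 1) {t : ℕ}
    (ht : burnIn (1 + κ) δ α n ≤ t) : MixedAt P p δ t := by
  intro i
  have hℓ := half_le_log hn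
  have hd := Real.log_nonpos hδ.le hδ1
  have hα1 : α ≤ 1 := hgap.trans (spectralGap_le_one P)
  have h1 : (1 + κ) * (Real.log n - Real.log δ) ≤ α * t := by
    have := Nat.ceil_le.1 ht
    rwa [log_natCast_div hn hδ, div_le_iff₀' hα] at this
  have ht1 : 1 ≤ t := by
    by_contra hcon
    have : t = 0 := by omega
    rw [this, Nat.cast_zero, mul_zero] at h1
    nlinarith
  refine (sum_abs_pow_sub_le hPR hrev (fun i => (hp i).1) hα hgap ht1 i).trans ?_
  have h2 : (Real.sqrt (p i))⁻¹ ≤ Real.exp (κ / 2 * Real.log n) := by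
    rw [← Real.sqrt_inv]
    exact Real.sqrt_le_iff.2 ⟨(Real.exp_pos _).le, inv_le_exp_sq (hp i).1 (hp i).2⟩
  have h3 : (1 - α) ^ t ≤ Real.exp (-(α * t)) := by
    have h4 : 1 - α ≤ Real.exp (-α) := by linarith [Real.add_one_le_exp (-α)]
    refine (pow_le_pow_left₀ (by linarith) h4 t).trans (le_of_eq ?_)
    rw [← Real.exp_nat_mul]
    congr 1
    ring
  calc _ ≤ Real.exp (κ / 2 * Real.log n) * Real.exp (-(α * t)) := by
        refine mul_le_mul h2 h3 (pow_nonneg (by linarith) _) (Real.exp_pos _).le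
    _ ≤ Real.exp (Real.log δ) := by
        rw [← Real.exp_add, Real.exp_le_exp]
        nlinarith
    _ = δ := Real.exp_log hδ

lemma burnIn_pos {C α : ℝ} (hC : 0 < C) (hα : 0 < α) (hn : 2 ≤ n) {ε : ℝ} (hε : 0 < ε)
    (hε1 : ε ≤ 1) : 1 ≤ burnIn C ε α n := by
  have h1 := half_le_log hn
  have h2 := Real.log_nonpos hε.le hε1
  rw [burnIn, log_natCast_div hn hε]
  exact Nat.one_le_ceil_iff.2 (div_pos (mul_pos hC (by linarith)) hα)

lemma burnIn_lt {C α : ℝ} (hC : 0 < C) (hα : 0 < α) (hn : 2 ≤ n) {ε : ℝ} (hε : 0 < ε)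
    (hε1 : ε ≤ 1) : (burnIn C ε α n : ℝ) < C * (Real.log n - Real.log ε) / α + 1 := by
  have h1 := half_le_log hn
  have h2 := Real.log_nonpos hε.le hε1
  rw [burnIn, log_natCast_div hn hε]
  exact Nat.ceil_lt_add_one (div_nonneg (mul_nonneg hC.le (by linarith)) hα.le)

/-- The burn-in time is at most of the order `ln n / (α ε²)`, whatever `ε` is, since
`ε² ln ε⁻¹ ≤ 1 / 2`. -/
lemma burnIn_mul_le {C α : ℝ} (hC : 0 < C) (hα : 0 < α) (hα1 : α ≤ 1) (hn : 2 ≤ n) {ε : ℝ}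
    (hε : 0 < ε) (hε1 : ε ≤ 1) :
    burnIn C ε α n * (α * ε ^ 2) ≤ (2 * C + 2) * Real.log n := by
  have h1 := half_le_log hn
  have hε2 : ε ^ 2 ≤ 1 := pow_le_one₀ hε.le hε1
  have h3 := mul_le_mul_of_nonneg_right (burnIn_lt hC hα hn hε hε1).le
    (by positivity : 0 ≤ α * ε ^ 2)
  have h4 : (C * (Real.log n - Real.log ε) / α + 1) * (α * ε ^ 2) =
      C * (ε ^ 2 * Real.log n + ε ^ 2 * -Real.log ε) + α * ε ^ 2 := by
    field_simp
    ring
  have h5 : ε ^ 2 * -Real.log ε ≤ 1 / 2 := by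
    have h6 := Real.log_le_sub_one_of_pos (x := (ε ^ 2)⁻¹) (by positivity)
    rw [Real.log_inv, Real.log_pow, Nat.cast_ofNat] at h6
    have h7 := mul_le_mul_of_nonneg_left h6 (sq_nonneg ε)
    rw [mul_sub, mul_inv_cancel₀ (by positivity)] at h7
    nlinarith [sq_nonneg ε]
  have h6 : ε ^ 2 * Real.log n ≤ 1 * Real.log n := by gcongr
  have h7 : α * ε ^ 2 ≤ 1 := mul_le_one₀ hα1 (by positivity) hε2
  have h8 : C * (ε ^ 2 * Real.log n + ε ^ 2 * -Real.log ε) ≤ C * (2 * Real.log n) := by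
    gcongr
    linarith
  linarith

variable {α ε σ : ℝ}

lemma runLength_mul_ge {C : ℝ} (hα : 0 < α) (hn : 2 ≤ n) (hε : 0 < ε) (hσ : 0 < σ) :
    C * (Real.log n - Real.log σ) ≤ runLength C ε σ α n * (α * ε ^ 2) := by
  rw [← div_le_iff₀ (by positivity), ← log_natCast_div hn hσ]
  exact Nat.le_ceil _

/-- The number of steps suffices for the error probability `σ` in the tail bound for a single walk.
In `C`, the term `2 (1 + κ) + 2` pays for the burn-in, and `3 + κ / 2` for the factors `n`,
`4 ≤ n ^ 2` and `n ^ (κ / 2)` in front of the exponential. -/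
lemma burnIn_lt_runLength_and_tail_le {κ : ℝ} (hκ : 0 < κ) (hα : 0 < α) (hα1 : α ≤ 1) (hn : 2 ≤ n)
    (hε : 0 < ε) (hε1 : ε ≤ 1) (hσ : 0 < σ) (hσ1 : σ < 1) {C : ℝ}
    (hC : C = 2 * (1 + κ) + 2 + 448 * (3 + κ / 2)) :
    burnIn (1 + κ) ε α n < runLength C ε σ α n ∧
      n * (4 * Real.exp (κ / 2 * Real.log n) * Real.exp
        (-(((runLength C ε σ α n : ℝ) - burnIn (1 + κ) ε α n) * (α * ε ^ 2 / 448)))) ≤ σ := by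
  set T := runLength C ε σ α n
  set T₀ := burnIn (1 + κ) ε α n
  have hℓ := half_le_log hn
  have hs := Real.log_neg hσ hσ1
  have h1 : T₀ * (α * ε ^ 2) ≤ (2 * (1 + κ) + 2) * Real.log n :=
    burnIn_mul_le (by linarith) hα hα1 hn hε hε1
  have h2 : C * (Real.log n - Real.log σ) ≤ T * (α * ε ^ 2) := runLength_mul_ge hα hn hε hσ
  have h3 : 448 * ((3 + κ / 2) * (Real.log n - Real.log σ)) ≤ ((T : ℝ) - T₀) * (α * ε ^ 2) := by
    have : (2 * (1 + κ) + 2) * Real.log n ≤ (2 * (1 + κ) + 2) * (Real.log n - Real.log σ) := by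
      gcongr
      linarith
    rw [hC] at h2
    linarith
  have h4 : 0 < (3 + κ / 2) * (Real.log n - Real.log σ) := mul_pos (by linarith) (by linarith)
  constructor
  · have h5 : 0 < (T : ℝ) - T₀ := by
      by_contra hcon
      have := mul_nonneg (by linarith : 0 ≤ -((T : ℝ) - T₀)) (by positivity : 0 ≤ α * ε ^ 2)
      linarith
    exact_mod_cast sub_pos.1 h5
  · have hn' : (n : ℝ) = Real.exp (Real.log n) := (Real.exp_log (by positivity)).symm
    have h4n : (4 : ℝ) ≤ Real.exp (2 * Real.log n) := by
      have h2n : (2 : ℝ) ≤ n := by exact_mod_cast hn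
      rw [mul_comm, Real.exp_mul, ← hn']
      norm_num
      nlinarith
    calc _ ≤ Real.exp (Real.log n) * (Real.exp (2 * Real.log n) * Real.exp (κ / 2 * Real.log n) *
          Real.exp (-((3 + κ / 2) * (Real.log n - Real.log σ)))) := by
          rw [← hn']
          have h5 : (3 + κ / 2) * (Real.log n - Real.log σ) ≤
              ((T : ℝ) - T₀) * (α * ε ^ 2 / 448) := by linarith
          exact mul_le_mul_of_nonneg_left (mul_le_mul
            (mul_le_mul_of_nonneg_right h4n (Real.exp_pos _).le)
            (Real.exp_le_exp.2 (neg_le_neg h5)) (Real.exp_pos _).le (by positivity))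
            (Nat.cast_nonneg n)
      _ ≤ Real.exp (Real.log σ) := by
          rw [← Real.exp_add, ← Real.exp_add, ← Real.exp_add, Real.exp_le_exp]
          nlinarith
      _ = σ := Real.exp_log hσ

/-- Accuracy of the single walk with the chosen burn-in time and number of steps. -/
lemma IsRandomWalk.measure_visitAverage_burnIn_ge {Ω : Type*} [MeasurableSpace Ω] {μ : Measure Ω}
    [IsProbabilityMeasure μ] {P : Matrix (Fin n) (Fin n) ℝ} {p ν : Fin n → ℝ}
    {X : ℕ → Ω → Fin n} (hX : IsRandomWalk μ P ν X) (hν : ν ∈ stdSimplex ℝ (Fin n)) {κ : ℝ}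
    (hκ : 0 < κ) (hn : 2 ≤ n) (hPR : IsPageRank P p) (hrev : IsReversible P p)
    (hp : ∀ i, 0 < p i ∧ Real.log (p i)⁻¹ ≤ κ * Real.log n) (hα : 0 < α)
    (hgap : α ≤ spectralGap P) (hε : 0 < ε) (hε1 : ε ≤ 1) (hσ : 0 < σ) (hσ1 : σ < 1) {C : ℝ}
    (hC : C = 2 * (1 + κ) + 2 + 448 * (3 + κ / 2)) :
    1 - σ ≤ μ.real {ω | ‖visitAverage (burnIn (1 + κ) ε α n) (runLength C ε σ α n)
      (fun t => X t ω) - vec2 p‖ ≤ ε} := by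
  obtain ⟨hlt, htail⟩ := burnIn_lt_runLength_and_tail_le hκ hα (hgap.trans (spectralGap_le_one P))
    hn hε hε1 hσ hσ1 hC
  exact hX.measure_visitAverage_ge hν hPR hrev (fun i => (hp i).1) hα hgap
    (fun i => inv_le_exp_sq (hp i).1 (hp i).2) (Real.exp_pos _).le
    (burnIn_pos (by linarith) hα hn hε hε1) hlt hε htail

/-- The operation count of the single walk. -/
lemma mcmc_cost_le {C : ℝ} (hC : 0 < C) (hα : 0 < α) (hα1 : α ≤ 1) (hn : 2 ≤ n)
    (hε : 0 < ε) (hε1 : ε ≤ 1) (hσ : 0 < σ) (hσ1 : σ < 1) {c : ℕ}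
    (hc : c ≤ 8 * n + (6 * Nat.clog 2 n + 12) * runLength C ε σ α n + 13) :
    (c : ℝ) ≤ (15 + 48 * (C + 2)) * (n + Real.log n * Real.log (n / σ) / (α * ε ^ 2)) := by
  have hℓ := half_le_log hn
  have hs := Real.log_neg hσ hσ1
  have hL := clog_le_log hn
  have hn2 : (2 : ℝ) ≤ n := by exact_mod_cast hn
  have hαε : α * ε ^ 2 ≤ 1 := mul_le_one₀ hα1 (by positivity) (pow_le_one₀ hε.le hε1)
  set A := (Real.log n - Real.log σ) / (α * ε ^ 2) with hA
  have hA2 : 1 / 2 ≤ A := by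
    rw [hA, le_div_iff₀ (by positivity)]
    linarith
  have hT : (runLength C ε σ α n : ℝ) ≤ (C + 2) * A := by
    have h1 : (runLength C ε σ α n : ℝ) < C * (Real.log n - Real.log σ) / (α * ε ^ 2) + 1 := by
      rw [runLength, log_natCast_div hn hσ]
      exact Nat.ceil_lt_add_one (div_nonneg (mul_nonneg hC.le (by linarith)) (by positivity))
    rw [mul_div_assoc, ← hA] at h1
    linarith
  have h2 : (c : ℝ) ≤ 8 * n + (6 * Nat.clog 2 n + 12) * runLength C ε σ α n + 13 := by
    exact_mod_cast hc
  have h3 : (6 * (Nat.clog 2 n : ℝ) + 12) * runLength C ε σ α n ≤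
      (48 * Real.log n) * ((C + 2) * A) :=
    mul_le_mul (by linarith) hT (Nat.cast_nonneg _) (by linarith)
  have h4 : Real.log n * Real.log (n / σ) / (α * ε ^ 2) = Real.log n * A := by
    rw [log_natCast_div hn hσ, mul_div_assoc]
  rw [h4]
  have h5 : 0 ≤ Real.log n * A := mul_nonneg (by linarith) (by linarith)
  have h6 : 0 ≤ (48 * (C + 2)) * n := by positivity
  nlinarith

/-- The operation count of the parallel version. -/
lemma parallel_cost_le {C : ℝ} (hC : 0 < C) (hα : 0 < α) (hα1 : α ≤ 1) (hn : 2 ≤ n)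
    (hε : 0 < ε) (hε1 : ε ≤ 1) (hσ : 0 < σ) (hσ1 : σ < 1) {c : ℕ}
    (hc : c ≤ 8 * n + ((6 * Nat.clog 2 n + 8) * burnIn C (ε / 2) α n + 6 * Nat.clog 2 n + 14) *
      ⌈walkerBound ε σ⌉₊ + 11) :
    (c : ℝ) ≤ (14 + (80 * (C + 1) + 104) * 6) *
      (n + Real.log n * Real.log (n / ε) * (1 + Real.log σ⁻¹) / (α * ε ^ 2)) := by
  have hℓ := half_le_log hn
  have he := Real.log_nonpos hε.le hε1
  have hs : 0 < Real.log σ⁻¹ := Real.log_pos (one_lt_inv_iff₀.2 ⟨hσ, hσ1⟩)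
  have hL := clog_le_log hn
  have hn2 : (2 : ℝ) ≤ n := by exact_mod_cast hn
  set B := (Real.log n - Real.log ε) / α with hB
  have hB2 : 1 / 2 ≤ B := by
    rw [hB, le_div_iff₀ hα]
    linarith
  set W := (1 + Real.log σ⁻¹) / ε ^ 2 with hW
  have hT : (burnIn C (ε / 2) α n : ℝ) ≤ 2 * (C + 1) * B := by
    have h1 := burnIn_lt hC hα hn (half_pos hε) (by linarith)
    have h2 : Real.log (ε / 2) = Real.log ε - Real.log 2 := Real.log_div hε.ne' two_ne_zero
    have h3 : Real.log 2 ≤ Real.log n := Real.log_le_log two_pos hn2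
    have h4 : C * (Real.log n - Real.log (ε / 2)) / α ≤
        C * (2 * (Real.log n - Real.log ε)) / α := by
      gcongr
      linarith
    have h5 : C * (2 * (Real.log n - Real.log ε)) / α = 2 * C * B := by rw [hB]; ring
    linarith
  have hN : (⌈walkerBound ε σ⌉₊ : ℝ) ≤ 6 * W := by
    have h1 : (⌈walkerBound ε σ⌉₊ : ℝ) < walkerBound ε σ + 1 :=
      Nat.ceil_lt_add_one (by rw [walkerBound]; positivity)
    have h2 : 1 ≤ 2 / ε ^ 2 := by
      rw [le_div_iff₀ (by positivity)]
      linarith [pow_le_one₀ hε.le hε1 (n := 2)]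
    have h3 : walkerBound ε σ + 2 / ε ^ 2 = 6 * W := by
      rw [walkerBound, hW]
      ring
    linarith
  have hW0 : 0 ≤ W := by positivity
  have h2 : (c : ℝ) ≤ 8 * n + ((6 * Nat.clog 2 n + 8) * burnIn C (ε / 2) α n +
      6 * Nat.clog 2 n + 14) * ⌈walkerBound ε σ⌉₊ + 11 := by
    exact_mod_cast hc
  have h3 : (6 * (Nat.clog 2 n : ℝ) + 8) * burnIn C (ε / 2) α n ≤
      (40 * Real.log n) * (2 * (C + 1) * B) :=
    mul_le_mul (by linarith) hT (Nat.cast_nonneg _) (by linarith)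
  have h4 : 6 * (Nat.clog 2 n : ℝ) + 14 ≤ 104 * (Real.log n * B) := by nlinarith
  have h5 : ((6 * (Nat.clog 2 n : ℝ) + 8) * burnIn C (ε / 2) α n + 6 * Nat.clog 2 n + 14) *
      ⌈walkerBound ε σ⌉₊ ≤ ((80 * (C + 1) + 104) * (Real.log n * B)) * (6 * W) :=
    mul_le_mul (by linarith) hN (Nat.cast_nonneg _)
      (mul_nonneg (by linarith) (mul_nonneg (by linarith) (by linarith)))
  have h6 : Real.log n * Real.log (n / ε) * (1 + Real.log σ⁻¹) / (α * ε ^ 2) =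
      Real.log n * B * W := by
    rw [log_natCast_div hn hε, hB, hW]
    field_simp
  rw [h6]
  have h7 : 0 ≤ Real.log n * B * W :=
    mul_nonneg (mul_nonneg (by linarith) (by linarith)) hW0
  have h8 : 0 ≤ (80 * (C + 1) + 104) * 6 * n := by positivity
  linarith

end Constants

/-! ### Mixing, accuracy, operation counts, and optimality of the number of walks -/

theorem mainTheorem2 :
    -- Mixing, accuracy and operation counts for reversible chains.
    (∀ κ : ℝ, 0 < κ → ∃ C₀ C K : ℝ, 0 < C₀ ∧ 0 < C ∧ 0 < K ∧
      ∀ (n : ℕ) (P : Matrix (Fin n) (Fin n) ℝ) (π : Fin n → ℝ) (α : ℝ),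
        2 ≤ n → IsPageRank P π → IsReversible P π →
        (∀ i, 0 < π i ∧ Real.log (π i)⁻¹ ≤ κ * Real.log n) →
        0 < α → α ≤ spectralGap P →
        -- mixing after the burn-in time
        (∀ δ : ℝ, 0 < δ → δ ≤ 1 → ∀ t, burnIn C₀ δ α n ≤ t → MixedAt P π δ t) ∧
        ∀ ε σ : ℝ, 0 < ε → ε ≤ 1 → 0 < σ → σ < 1 →
          -- the estimator, for a walk with any starting law
          (burnIn C₀ ε α n < runLength C ε σ α n ∧
            ∀ {Ω : Type*} [MeasurableSpace Ω] (μ : Measure Ω) [IsProbabilityMeasure μ]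
              (ν : Fin n → ℝ) (X : ℕ → Ω → Fin n),
              ν ∈ stdSimplex ℝ (Fin n) → IsRandomWalk μ P ν X →
              1 - σ ≤ μ.real {ω | ‖visitAverage (burnIn C₀ ε α n) (runLength C ε σ α n)
                (fun t => X t ω) - vec2 π‖ ≤ ε}) ∧
          -- its program: operation count for all random numbers, accuracy
          (∀ s : State, StoresMatrix s P →
            s.ireg .burn = burnIn C₀ ε α n → s.ireg .len = runLength C ε σ α n →
            (∀ u : Tape, ∃ (s' : State) (c : ℕ), Runs u mcmcProg s s' c ∧
              (c : ℝ) ≤ K * (n + Real.log n * Real.log (n / σ) / (α * ε ^ 2))) ∧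
            1 - σ ≤ tapeMeasure.real {u | ∃ (s' : State) (c : ℕ), Runs u mcmcProg s s' c ∧
              ‖s'.answer n - vec2 π‖ ≤ ε}) ∧
          -- the program of the parallel version
          (∀ (s : State) (ν : Fin n → ℝ), ν ∈ stdSimplex ℝ (Fin n) →
            StoresMatrix s P → StoresRow s n ν →
            s.ireg .walkers = ⌈walkerBound ε σ⌉₊ → s.ireg .len = burnIn C₀ (ε / 2) α n →
            (∀ u : Tape, ∃ (s' : State) (c : ℕ), Runs u parallelProg s s' c ∧
              (c : ℝ) ≤ K * (n + Real.log n * Real.log (n / ε) * (1 + Real.log σ⁻¹) /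
                (α * ε ^ 2))) ∧
            1 - σ ≤ tapeMeasure.real {u | ∃ (s' : State) (c : ℕ), Runs u parallelProg s s' c ∧
              ‖s'.answer n - vec2 π‖ ≤ ε})) ∧
    -- The parallel version for any chain: Hoeffding-type inequality, sufficient number of walks.
    (∀ (n : ℕ) (P : Matrix (Fin n) (Fin n) ℝ) (π ν : Fin n → ℝ) (N : ℕ)
        {Ω : Type*} [MeasurableSpace Ω] (μ : Measure Ω) [IsProbabilityMeasure μ]
        (X : Fin N → ℕ → Ω → Fin n) (t : ℕ),
        IsPageRank P π → ν ∈ stdSimplex ℝ (Fin n) → IndepWalks μ P ν N X →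
        (∀ r : ℝ, 0 < N → ∫ ω, ‖∑ k, (posVec (X k t ω) - vec2 π)‖ ∂μ ≤ r →
          μ.real {ω | r ≤ ‖∑ k, (posVec (X k t ω) - vec2 π)‖} ≤
            Real.exp (-(1 / (4 * N)) *
              (r - ∫ ω, ‖∑ k, (posVec (X k t ω) - vec2 π)‖ ∂μ) ^ 2)) ∧
        ∀ ε σ : ℝ, 0 < ε → 0 < σ → σ < 1 → MixedAt P π (ε / 2) t → walkerBound ε σ ≤ N →
          μ.real {ω | ε ≤ ‖walkerAverage (fun k => X k t ω) - vec2 π‖} ≤ σ) ∧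
    -- Tightness of the number of walks, in every dimension.
    (∃ c : ℝ, 0 < c ∧ ∀ n : ℕ, 2 ≤ n →
      ∃ (P : Matrix (Fin n) (Fin n) ℝ) (π : Fin n → ℝ),
        IsPageRank P π ∧ IsReversible P π ∧
        (∀ i, 0 < π i ∧ Real.log (π i)⁻¹ ≤ 2 * Real.log n) ∧ spectralGap P = 1 ∧
        (∀ t, 1 ≤ t → MixedAt P π 0 t) ∧
        ∀ (ε σ : ℝ) (N : ℕ), 0 < ε → ε ≤ c → 0 < σ → σ ≤ c → 0 < N →
          (N : ℝ) ≤ c * walkerBound ε σ →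
          ∀ {Ω : Type*} [MeasurableSpace Ω] (μ : Measure Ω) [IsProbabilityMeasure μ]
            (ν : Fin n → ℝ) (X : Fin N → ℕ → Ω → Fin n) (t : ℕ),
            ν ∈ stdSimplex ℝ (Fin n) → IndepWalks μ P ν N X → 1 ≤ t →
            σ < μ.real {ω | ε ≤ ‖walkerAverage (fun k => X k t ω) - vec2 π‖}) ∧
    -- Uniform PageRank vector, large dimension: with few walks the error is at least `ε` with
    -- probability close to `1`.
    (∃ c : ℝ, 0 < c ∧ ∀ σ : ℝ, 0 < σ → σ < 1 → ∃ n₀ : ℕ, ∀ n : ℕ, n₀ ≤ n →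
      ∀ (ε : ℝ) (N : ℕ), 0 < ε → 0 < N → (N : ℝ) ≤ c / ε ^ 2 →
        ∀ {Ω : Type*} [MeasurableSpace Ω] (μ : Measure Ω) [IsProbabilityMeasure μ]
          (ν : Fin n → ℝ) (X : Fin N → ℕ → Ω → Fin n) (t : ℕ),
          ν ∈ stdSimplex ℝ (Fin n) →
          IndepWalks μ (fun _ _ => (n : ℝ)⁻¹) ν N X → 1 ≤ t →
          σ < μ.real {ω | ε ≤ ‖walkerAverage (fun k => X k t ω) - vec2 (fun _ => (n : ℝ)⁻¹)‖}) := by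
  refine ⟨fun κ hκ => ?_, fun n P p ν N Ω _ μ _ X t hPR hν hX => ⟨fun r hN hr => ?_, ?_⟩,
    ⟨Real.exp (-200), Real.exp_pos _, fun n hn => ?_⟩, ⟨1 / 4, by norm_num, fun σ hσ hσ1 => ?_⟩⟩
  · set C := 2 * (1 + κ) + 2 + 448 * (3 + κ / 2) with hC
    set K₁ := 15 + 48 * (C + 2) with hK₁
    set K₂ := 14 + (80 * (1 + κ + 1) + 104) * 6 with hK₂
    have hC0 : 0 < C := by positivity
    have hK₁0 : 0 < K₁ := by positivity
    have hK₂0 : 0 < K₂ := by positivity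
    refine ⟨1 + κ, C, max K₁ K₂, by positivity, hC0, lt_max_of_lt_left hK₁0, ?_⟩
    intro n P p α hn hPR hrev hp hα hgap
    have hα1 : α ≤ 1 := hgap.trans (spectralGap_le_one P)
    have hn0 : 0 < n := by omega
    have hmix : ∀ δ : ℝ, 0 < δ → δ ≤ 1 → ∀ t, burnIn (1 + κ) δ α n ≤ t → MixedAt P p δ t :=
      fun δ hδ hδ1 t ht => mixedAt_of_burnIn_le hκ hn hPR hrev hp hα hgap hδ hδ1 ht
    refine ⟨hmix, fun ε σ hε hε1 hσ hσ1 => ?_⟩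
    have hℓ := half_le_log hn
    have he := Real.log_nonpos hε.le hε1
    have hs := Real.log_neg hσ hσ1
    have hlt := (burnIn_lt_runLength_and_tail_le hκ hα hα1 hn hε hε1 hσ hσ1 hC).1
    refine ⟨⟨hlt, fun μ _ ν X hν hX => hX.measure_visitAverage_burnIn_ge hν hκ hn hPR hrev hp hα
      hgap hε hε1 hσ hσ1 hC⟩, fun s hM hburn hlen => ⟨fun u => ?_, ?_⟩,
      fun s ν hν hM hS hw hlen => ⟨fun u => ?_, ?_⟩⟩
    · obtain ⟨step, hstep, -, -⟩ := hM.exists_step hPR.stochastic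
      obtain ⟨s', c, hr, hc, -⟩ := runs_mcmcProg hPR.stochastic hM hstep
        (Nat.le_pow_clog one_lt_two n) u hn0
      rw [hlen] at hc
      refine ⟨s', c, hr, (mcmc_cost_le hC0 hα hα1 hn hε hε1 hσ hσ1 hc).trans ?_⟩
      refine mul_le_mul_of_nonneg_right (le_max_left _ _) ?_
      rw [log_natCast_div hn hσ]
      exact add_nonneg (Nat.cast_nonneg n)
        (div_nonneg (mul_nonneg (by linarith) (by linarith)) (by positivity))
    · refine hM.measure_mcmcProg_ge hPR.stochastic hn0 (by rw [hburn, hlen]; exact hlt.le)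
        fun X hX => ?_
      rw [hburn, hlen]
      exact hX.measure_visitAverage_burnIn_ge (single_mem_stdSimplex ℝ _) hκ hn hPR hrev hp hα hgap
        hε hε1 hσ hσ1 hC
    · obtain ⟨step, hstep, -, -⟩ := hM.exists_step hPR.stochastic
      obtain ⟨start, hstart, -, -⟩ := hS.exists_sampler hν
      obtain ⟨s', c, hr, hc, -⟩ := runs_parallelProg hPR.stochastic hM hstep
        (Nat.le_pow_clog one_lt_two n) hν hS hstart u
      rw [hlen, hw] at hc
      refine ⟨s', c, hr, (parallel_cost_le (by linarith) hα hα1 hn hε hε1 hσ hσ1 hc).trans ?_⟩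
      refine mul_le_mul_of_nonneg_right (le_max_right _ _) ?_
      rw [log_natCast_div hn hε, Real.log_inv]
      exact add_nonneg (Nat.cast_nonneg n) (div_nonneg
        (mul_nonneg (mul_nonneg (by linarith) (by linarith)) (by linarith)) (by positivity))
    · refine hM.measure_parallelProg_ge hPR.stochastic hν hS hε hσ hσ1 ?_ ?_
      · rw [hw]
        exact Nat.le_ceil _
      · rw [hlen]
        exact hmix _ (half_pos hε) (by linarith) _ le_rfl
  · exact hX.norm_sum_tail hPR.stochastic hν _ t hN hr
  · exact fun ε σ hε hσ hσ1 hmix hN => hX.measure_error_le hPR.stochastic hν hε hσ hσ1 hmix hN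
  · have hq := halfLaw_mem hn
    refine ⟨Matrix.of fun _ => halfLaw n, halfLaw n, isPageRank_const_rows hq,
      fun i j => mul_comm _ _, fun i => ⟨halfLaw_pos hn i, log_halfLaw_inv_le hn i⟩,
      spectralGap_const_rows hq.2, fun t ht i => ?_, ?_⟩
    · rw [const_rows_pow hq.2 ht]
      simp
    · intro ε σ N hε hε1 hσ hσ1 hN hNb Ω _ μ _ ν X t hν hX ht
      refine (lt_iidExp_halfLaw hn hε hε1 hσ hσ1 hN hNb).trans_eq ?_
      exact (hX.measure_const_rows hq.2 hν ht
        {x | ε ≤ ‖walkerAverage x - vec2 (halfLaw n)‖}).symm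
  · -- `n₀` makes the error term `32 / n` of Chebyshev's inequality smaller than `1 - σ`
    refine ⟨⌊32 / (1 - σ)⌋₊ + 2, fun n hn ε N hε hN hNε Ω _ μ _ ν X t hν hX ht => ?_⟩
    have hn2 : 2 ≤ n := by omega
    have h1 : 32 / (1 - σ) < n := (Nat.floor_lt' (by omega)).1 (by omega)
    have h2 : (32 : ℝ) / n < 1 - σ := by
      rw [div_lt_iff₀ (by linarith)] at h1
      rw [div_lt_iff₀ (by positivity)]
      linarith
    have h3 := hX.measure_const_rows (uniform_mem (by omega)).2 hν ht
      {x | ε ≤ ‖walkerAverage x - vec2 (fun _ => (n : ℝ)⁻¹)‖}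
    have h4 := le_iidExp_uniform hn2 hε hN hNε
    rw [← h3] at h4
    exact lt_of_lt_of_le (by linarith) h4
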